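/- **Theorem (invariant foliations: global version).** *Setting.* Let $M$ be a set, $u:M\to M$ a map, and let $X_m,Y_m$ ($m\in M$) be complete metric spaces; distances are written $|\cdot-\cdot|$, and $X_m\times Y_m$ carries a product metric $d_p$, $1\le p\le\infty$. For each $m$ let $H_m:X_m\times Y_m\to X_{u(m)}\times Y_{u(m)}$ be a map with a generating map $(F_m,G_m)$, that is, $F_m:X_m\times Y_{u(m)}\to X_{u(m)}$, $G_m:X_m\times Y_{u(m)}\to Y_m$ and $$(x_2,y_2)=H_m(x_1,y_1)\iff y_1=G_m(x_1,y_2)\ \text{and}\ x_2=F_m(x_1,y_2).$$ Put $H^{(n)}_m=H_{u^{n-1}(m)}\circ\dots\circ H_m$ and, for $\varepsilon:M\to\mathbb R$, $\varepsilon^{(n)}(m)=\prod_{k<n}\varepsilon(u^k(m))$. Let $\alpha,\lambda_u,\beta,\beta',\lambda_s:M\to[0,\infty)$ be bounded. Below $(x_2,y_2)=H_m(x_1,y_1)$ and $(x_2',y_2')=H_m(x_1',y_1')$ are arbitrary. Assume condition (B): if $|y_2-y_2'|\le\beta(m)|x_2-x_2'|$, then $|y_1-y_1'|\le\beta'(m)|x_1-x_1'|$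 and $|x_2-x_2'|\le\lambda_s(m)|x_1-x_1'|$. Assume moreover one of the following. * (i) Condition (A$'$): $\operatorname{Lip}F_m(x,\cdot)\le\alpha(m)$ and $\operatorname{Lip}G_m(x,\cdot)\le\lambda_u(m)$ for all $m$, $x$. Then set $\vartheta(m)=(1-\alpha(m)\beta'(u(m)))^{-1}$. * (i$'$) Condition (A): if $|x_1-x_1'|\le\alpha(m)|y_1-y_1'|$, then $|x_2-x_2'|\le\alpha(m)|y_2-y_2'|$ and $|y_1-y_1'|\le\lambda_u(m)|y_2-y_2'|$; and $\alpha(m)\le\alpha(u(m))$ for all $m$. Then set $\vartheta\equiv1$. Assume finally the angle condition $\sup_m\alpha(m)\beta'(u(m))<1$, $\beta'(u(m))\le\beta(m)$ for all $m$, and the spectral condition $\sup_m\lambda_s(m)\lambda_u(m)\vartheta(m)<1$. *Existence.* There is a unique family of sets $W^s_m(q)\subset X_m\times Y_m$ ($m\in M$, $q\in X_m\times Y_m$) such that 1. $q\in W^s_m(q)$, and $W^s_m(q)$ is the graph of a map $f_{(m,q)}:X_m\to Y_m$ with $\operatorname{Lip}f_{(m,q)}\le\beta'(m)$; 2. $H_m(W^s_m(q))\subset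 W^s_{u(m)}(H_m(q))$. In addition: 3. If $\varsigma>0$ and $\varepsilon:M\to\mathbb R$ satisfy $\lambda_s(m)+\varsigma<\varepsilon(m)$ for all $m$ and $\sup_m\varepsilon(m)\lambda_u(m)\vartheta(m)<1$, then for all $m$ and $q$ $$W^s_m(q)=\{p:\ \exists C\ \forall n\ge0,\ d(H^{(n)}_m(p),H^{(n)}_m(q))\le C\,\varepsilon^{(n)}(m)\}.$$ 4. If $W^s_m(q_1)\cap W^s_m(q_2)\ne\emptyset$, then $q_1\in W^s_m(q_2)$ and $W^s_m(q_1)=W^s_m(q_2)$; so the sets $W^s_m(q)$ partition $X_m\times Y_m$. If all $H_m$ are continuous, this is a $C^0$ foliation: $(q,x)\mapsto f_{(m,q)}(x)$ is continuous on $(X_m\times Y_m)\times X_m$ for every $m$. *Regularity.* 5. If $\sup_m\operatorname{Lip}H_m<\infty$, then the foliation is locally Hölder uniformly in $m$: there is $\theta\in(0,1]$ such that for every $r>0$ there is a constant $C$ with $|f_{(m,q)}(x)-f_{(m,q')}(x')|\le C\,d((q,x),(q',x'))^\theta$ for all $m$ and all $(q,x),(q',x')\in(X_m\times Y_m)\times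 X_m$ with $|x-q_X|\le r$, $|x'-q'_X|\le r$, $d((q,x),(q',x'))\le r$. Here $q_X$ is the $X_m$-component of $q$. 6. Suppose that all $X_m,Y_m$ are real Banach spaces. A family of maps is called $C^{1,\gamma}$ uniformly if its members are $C^1$ and their derivatives are bounded and globally $\gamma$-Hölder, with one constant for the family. (i) If all $F_m,G_m$ are $C^1$, then every $f_{(m,q)}$ is $C^1$, and if moreover all $H_m$ are continuous, then $(q,x)\mapsto Df_{(m,q)}(x)$ is continuous for every $m$. If $0<\gamma\le1$ and $F_m,G_m$ are $C^{1,\gamma}$ uniformly in $m$, then there is $\zeta\in(0,\gamma]$ such that the maps $f_{(m,q)}$ are $C^{1,\zeta}$ uniformly in $(m,q)$. If in addition $\sup_m\operatorname{Lip}H_m<\infty$, then the tangent distribution is locally Hölder uniformly in $m$: there are $\theta\in(0,1]$ and $C$ such that $\|Df_{(m,q)}(q_X)-Df_{(m,q')}(q'_X)\|\le C\,d(q,q')^\theta$ for all $m$ and all $q,q'\in X_m\times Y_m$ with $d(q,q')\le1$. (ii) Suppose that $F_m,G_m$ are $C^{1,1}$ uniformly in $m$, that $\operatorname{Lip}H_m\le\mu(m)$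 with respect to the metrics $d_p$, where $\mu:M\to[0,\infty)$ is bounded, and that $$\sup_m\mu(m)\lambda_s(m)\lambda_u(m)\vartheta(m)<1.$$ Then $(q,x)\mapsto f_{(m,q)}(x)$ is $C^1$ for every $m$. Suppose in addition that $H_m$ is $C^{1,1}$ uniformly in $m$ and that either $\sup_m\lambda_s(m)<1$, or both $\sup_m\lambda_s(m)^2\lambda_u(m)\vartheta(m)<1$ and $\sup_m\mu(m)\lambda_s(m)^2\lambda_u(m)\vartheta(m)<1$. Then the foliation is locally $C^{1,\varsigma}$ uniformly in $m$, for some $\varsigma\in(0,1]$: for every $r>0$ there is $C$ such that $\Phi_m(q,x)=f_{(m,q)}(x)$ satisfies $\|D\Phi_m(z)\|\le C$ and $\|D\Phi_m(z)-D\Phi_m(z')\|\le C\,d(z,z')^\varsigma$ for all $m$ and all $z=(q,x)$, $z'=(q',x')$ with $|x-q_X|\le r$, $|x'-q'_X|\le r$, $d(z,z')\le r$. -/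

import Mathlib

open scoped NNReal ENNReal

universe a b c

namespace BundleFoliation


section Metric

variable {M : Type a} {X : M → Type b} {Y : M → Type c} {u : M → M}

/-- `H ~ (F, G)` over `u`: in every fiber, `(x₂, y₂) = H_m (x₁, y₁)` if and only if
`y₁ = G_m (x₁, y₂)` and `x₂ = F_m (x₁, y₂)`. -/
def HasGeneratingMap
    (H : ∀ m, X m × Y m → X (u m) × Y (u m))
    (F : ∀ m, X m × Y (u m) → X (u m))
    (G : ∀ m, X m × Y (u m) → Y m) : Prop :=
  ∀ (m : M) (x₁ : X m) (y₁ : Y m) (x₂ : X (u m)) (y₂ : Y (u m)),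
    H m (x₁, y₁) = (x₂, y₂) ↔ (y₁ = G m (x₁, y₂) ∧ x₂ = F m (x₁, y₂))

/-- The `n`-th iterate `H^{(n)}_m : X_m × Y_m → X_{u^n(m)} × Y_{u^n(m)}` of a bundle map. -/
def iter (H : ∀ m, X m × Y m → X (u m) × Y (u m)) :
    ∀ (n : ℕ) (m : M), X m × Y m → X (u^[n] m) × Y (u^[n] m)
  | 0, _, z => z
  | n + 1, m, z => iter H n (u m) (H m z)

/-- The cocycle `ε^{(n)}(m) = ε(m) ε(u(m)) ⋯ ε(u^{n-1}(m))`. -/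
def cocycle (u : M → M) (ε : M → ℝ) (n : ℕ) (m : M) : ℝ :=
  ∏ k ∈ Finset.range n, ε (u^[k] m)

/-- `sup_m g(m) < 1`. -/
def SupLtOne (g : M → ℝ) : Prop := ∃ c : ℝ, c < 1 ∧ ∀ m, g m ≤ c

/-- The graph `W_m(q)` of `f_{(m,q)} : X_m → Y_m`. -/
def leaf (f : ∀ m, X m × Y m → X m → Y m) (m : M) (q : X m × Y m) : Set (X m × Y m) :=
  {p | p.2 = f m q p.1}

variable [∀ m, MetricSpace (X m)] [∀ m, MetricSpace (Y m)]

/-- The (A') condition: `Lip F_m(x, ·) ≤ α(m)` and `Lip G_m(x, ·) ≤ λ_u(m)`. -/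
def CondA'
    (F : ∀ m, X m × Y (u m) → X (u m)) (G : ∀ m, X m × Y (u m) → Y m)
    (α lu : M → ℝ≥0) : Prop :=
  ∀ (m : M) (x : X m),
    LipschitzWith (α m) (fun y => F m (x, y)) ∧ LipschitzWith (lu m) (fun y => G m (x, y))

/-- The (A) condition: invariance of the cones `|x - x'| ≤ α |y - y'|`, and expansion in them. -/
def CondA (H : ∀ m, X m × Y m → X (u m) × Y (u m)) (α lu : M → ℝ≥0) : Prop :=
  ∀ (m : M) (z z' : X m × Y m), dist z.1 z'.1 ≤ α m * dist z.2 z'.2 →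
    dist (H m z).1 (H m z').1 ≤ α m * dist (H m z).2 (H m z').2 ∧
    dist z.2 z'.2 ≤ lu m * dist (H m z).2 (H m z').2

/-- The (B) condition: backward invariance of the cones `|y - y'| ≤ β |x - x'|`, and
contraction in them. -/
def CondB (H : ∀ m, X m × Y m → X (u m) × Y (u m)) (β β' ls : M → ℝ≥0) : Prop :=
  ∀ (m : M) (z z' : X m × Y m),
    dist (H m z).2 (H m z').2 ≤ β m * dist (H m z).1 (H m z').1 →
    dist z.2 z'.2 ≤ β' m * dist z.1 z'.1 ∧
    dist (H m z).1 (H m z').1 ≤ ls m * dist z.1 z'.1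

/-- The standing assumptions on `H ~ (F, G)` with rate functions `α, λ_u, β, β', λ_s`, together
with the value of the function `ϑ` in each of the two cases. -/
structure Hyperbolic
    (H : ∀ m, X m × Y m → X (u m) × Y (u m))
    (F : ∀ m, X m × Y (u m) → X (u m)) (G : ∀ m, X m × Y (u m) → Y m)
    (α lu β β' ls : M → ℝ≥0) (ϑ : M → ℝ) : Prop where
  generating : HasGeneratingMap H F G
  bdd_α : BddAbove (Set.range α)
  bdd_lu : BddAbove (Set.range lu)
  bdd_β : BddAbove (Set.range β)
  bdd_β' : BddAbove (Set.range β')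
  bdd_ls : BddAbove (Set.range ls)
  condB : CondB H β β' ls
  condA : (CondA' F G α lu ∧ ϑ = fun m => (1 - (α m : ℝ) * β' (u m))⁻¹) ∨
    (CondA H α lu ∧ (∀ m, α m ≤ α (u m)) ∧ ϑ = fun _ => 1)
  angle : SupLtOne (fun m => (α m : ℝ) * β' (u m))
  angle_β : ∀ m, β' (u m) ≤ β m
  spectral : SupLtOne (fun m => (ls m : ℝ) * lu m * ϑ m)

/-- `W_m(q)`, `q ∈ X_m × Y_m`, is an `H`-invariant family of `β'(m)`-Lipschitz graphs
`X_m → Y_m` with `q ∈ W_m(q)`. -/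
def IsInvariantGraphFamily
    (H : ∀ m, X m × Y m → X (u m) × Y (u m)) (β' : M → ℝ≥0)
    (W : ∀ m, X m × Y m → Set (X m × Y m)) : Prop :=
  (∀ m q, q ∈ W m q ∧
    ∃ g : X m → Y m, LipschitzWith (β' m) g ∧ W m q = {p | p.2 = g p.1}) ∧
  ∀ m q, H m '' W m q ⊆ W (u m) (H m q)

/-- `sup_m Lip H_m < ∞`. -/
def UniformLipschitz (H : ∀ m, X m × Y m → X (u m) × Y (u m)) : Prop :=
  ∃ K : ℝ≥0, ∀ m, LipschitzWith K (H m)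

/-- The set of the pairs `((q, x), (q', x'))` of points of `(X_m × Y_m) × X_m` at a distance
at most `r` from each other, with `x` and `x'` within `r` of the base points of the leaves
of `q` and of `q'`. -/
def Near (r : ℝ) (m : M) (z z' : (X m × Y m) × X m) : Prop :=
  dist z.2 z.1.1 ≤ r ∧ dist z'.2 z'.1.1 ≤ r ∧ dist z z' ≤ r

/-- `(q, x) ↦ f_{(m,q)}(x)` is locally Hölder, uniformly in `m`: the exponent `θ` is one for all,
and the constant depends only on the size `r` of the neighborhoods. -/
def UniformLocallyHolder (f : ∀ m, X m × Y m → X m → Y m) : Prop :=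
  ∃ θ : ℝ, 0 < θ ∧ θ ≤ 1 ∧ ∀ r : ℝ, 0 < r → ∃ C : ℝ, ∀ (m : M) (z z' : (X m × Y m) × X m),
    Near r m z z' → dist (f m z.1 z.2) (f m z'.1 z'.2) ≤ C * dist z z' ^ θ

end Metric

section Banach

/-- A family of `C^{1,γ}` maps between normed spaces, uniform for the index: the derivatives are
bounded and globally `γ`-Hölder, with one constant for the whole family. -/
def UniformC1Holder {ι : Type*} {E E' : ι → Type*}
    [∀ i, NormedAddCommGroup (E i)] [∀ i, NormedSpace ℝ (E i)]
    [∀ i, NormedAddCommGroup (E' i)] [∀ i, NormedSpace ℝ (E' i)]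
    (γ : ℝ) (φ : ∀ i, E i → E' i) : Prop :=
  (∀ i, ContDiff ℝ 1 (φ i)) ∧ ∃ C : ℝ, ∀ (i : ι) (x x' : E i),
    ‖fderiv ℝ (φ i) x‖ ≤ C ∧
    ‖fderiv ℝ (φ i) x - fderiv ℝ (φ i) x'‖ ≤ C * ‖x - x'‖ ^ γ

variable {M : Type a} {X : M → Type b} {Y : M → Type c} {u : M → M}
  [∀ m, NormedAddCommGroup (X m)] [∀ m, NormedSpace ℝ (X m)]
  [∀ m, NormedAddCommGroup (Y m)] [∀ m, NormedSpace ℝ (Y m)]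

/-- `(q, x) ↦ D f_{(m,q)}(x)` is continuous on `(X_m × Y_m) × X_m` for every `m`. -/
def LeafDerivContinuous (f : ∀ m, X m × Y m → X m → Y m) : Prop :=
  ∀ m, Continuous (fun z : (X m × Y m) × X m => fderiv ℝ (f m z.1) z.2)

/-- The tangent distribution `q ↦ T_q W_m(q) = Graph D f_{(m,q)}(q_X)` is locally Hölder,
with an exponent and a constant that do not depend on `m`. -/
def TangentUniformLocallyHolder (f : ∀ m, X m × Y m → X m → Y m) : Prop :=
  ∃ θ : ℝ, 0 < θ ∧ θ ≤ 1 ∧ ∃ C : ℝ, ∀ (m : M) (q q' : X m × Y m), dist q q' ≤ 1 →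
    ‖fderiv ℝ (f m q) q.1 - fderiv ℝ (f m q') q'.1‖ ≤ C * dist q q' ^ θ

/-- `(q, x) ↦ f_{(m,q)}(x)` is `C^1` on `(X_m × Y_m) × X_m` for every `m`. -/
def IsC1Foliation (f : ∀ m, X m × Y m → X m → Y m) : Prop :=
  ∀ m, ContDiff ℝ 1 (fun z : (X m × Y m) × X m => f m z.1 z.2)

/-- `(q, x) ↦ f_{(m,q)}(x)` is locally `C^{1,s}`, uniformly in `m`. -/
def IsUniformLocallyC1HolderFoliation (s : ℝ) (f : ∀ m, X m × Y m → X m → Y m) : Prop :=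
  IsC1Foliation f ∧ ∀ r : ℝ, 0 < r → ∃ C : ℝ, ∀ (m : M) (z z' : (X m × Y m) × X m),
    Near r m z z' →
      ‖fderiv ℝ (fun w : (X m × Y m) × X m => f m w.1 w.2) z‖ ≤ C ∧
      ‖fderiv ℝ (fun w : (X m × Y m) × X m => f m w.1 w.2) z -
        fderiv ℝ (fun w : (X m × Y m) × X m => f m w.1 w.2) z'‖ ≤ C * dist z z' ^ s

/-- `Lip H_m ≤ μ(m)` for the metric `d_p` on the products `X_m × Y_m`. -/
def LipschitzBound (p : ℝ≥0∞) [Fact (1 ≤ p)]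
    (H : ∀ m, X m × Y m → X (u m) × Y (u m)) (μ : M → ℝ≥0) : Prop :=
  ∀ (m : M) (z z' : X m × Y m),
    dist (WithLp.toLp p (H m z)) (WithLp.toLp p (H m z')) ≤
      μ m * dist (WithLp.toLp p z) (WithLp.toLp p z')

end Banach

end BundleFoliation

/-! A section is a choice of maps X_m → Y_m. Its graph transform is the section whose graph `H`
sends into the given graph. It exists and is unique because the generating map turns the condition
into a fixed point problem with contraction factor α(m)β'(u(m)) < 1, and condition (B) keeps the
slopes below β'. With Λ = λ_u ϑ, two competing rates decide everything. The vertical distance of a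
point to the n-th transform of a graph is at most a constant times Λ^{(n)} times the distance of its
n-th iterate to the graph (`dist_iterate_le`), while points of such a transform approach each other
at rate λ_s^{(n)} (`dist_iter_le`). Hence sections through common invariant base points which differ
by O(|x - o|) have transforms that differ by O(c^n |x - o|), where c < 1 comes from the spectral
condition. Existence and uniqueness of an invariant section follow.

A foliation is an invariant section over a larger base: the total space of points (m, q), moved by
`H`, with q itself as base point (`pullback`). Other parameter bundles give the rest. Pairs on a
common leaf show that leaves coincide or are disjoint; pairs of arbitrary points let two leaves be
compared.

Hölder estimates come from bounds of the form R^n δ + c^n, valid for every n, optimized in n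
(`exists_rpow_bound`). For smoothness, approximating sections are differentiated by the chain rule,
and they are close enough to the leaves, to first order at the base point, for the derivatives to
pass to the limit (`exists_hasFDerivAt_of_approx`). Slopes at different points are compared by
translating one leaf to the other base point. The translate fails to be invariant only by second
differences of `F` and `G` (`dist_translate_transform_le`). Under the bunching condition the
resulting series converges with a Lipschitz bound in the base points. Vertical translates of the
leaf of q through nearby q' then generate approximations with error O(c₁^n |q - q'|), so the
foliation is C¹. The Lipschitz constants of the approximating derivatives grow at most
exponentially, which gives the Hölder derivative by interpolation again. -/

namespace BundleFoliation

open Filter Topology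

/-! ### Products of rates along orbits. -/

section Cocycle

variable {M : Type*} {u : M → M}

theorem cocycle_zero (ε : M → ℝ) (m : M) : cocycle u ε 0 m = 1 := by
  simp [cocycle]

theorem cocycle_succ (ε : M → ℝ) (n : ℕ) (m : M) :
    cocycle u ε (n + 1) m = ε m * cocycle u ε n (u m) := by
  simp [cocycle, Finset.prod_range_succ', mul_comm]

theorem cocycle_succ' (ε : M → ℝ) (n : ℕ) (m : M) :
    cocycle u ε (n + 1) m = cocycle u ε n m * ε (u^[n] m) := by
  simp [cocycle, Finset.prod_range_succ]

theorem cocycle_nonneg {ε : M → ℝ} (h : ∀ m, 0 ≤ ε m) (n : ℕ) (m : M) :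
    0 ≤ cocycle u ε n m :=
  Finset.prod_nonneg fun _ _ => h _

theorem cocycle_mul (ε δ : M → ℝ) (n : ℕ) (m : M) :
    cocycle u (fun m => ε m * δ m) n m = cocycle u ε n m * cocycle u δ n m := by
  simp [cocycle, Finset.prod_mul_distrib]

theorem cocycle_le_pow {ε : M → ℝ} {c : ℝ} (h : ∀ m, 0 ≤ ε m) (hc : ∀ m, ε m ≤ c)
    (n : ℕ) (m : M) : cocycle u ε n m ≤ c ^ n := by
  simpa [cocycle] using Finset.prod_le_prod (s := Finset.range n)
    (fun k _ => h (u^[k] m)) (fun k _ => hc (u^[k] m))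

theorem cocycle_mono {ε δ : M → ℝ} (h : ∀ m, 0 ≤ ε m) (hc : ∀ m, ε m ≤ δ m)
    (n : ℕ) (m : M) : cocycle u ε n m ≤ cocycle u δ n m :=
  Finset.prod_le_prod (fun _ _ => h _) (fun _ _ => hc _)

end Cocycle

/-! ### The graph transform and its invariant sections. -/

section Transform

variable {M : Type*} {X : M → Type*} {Y : M → Type*} {u : M → M}

/-- The graph transform on sections `h_m : X_m → Y_m`: the graph of the transformed section is
mapped by `H` into the graph of the original one. -/
noncomputable def transform (H : ∀ m, X m × Y m → X (u m) × Y (u m)) [∀ m, Nonempty (Y m)]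
    (h : ∀ m, X m → Y m) : ∀ m, X m → Y m :=
  fun m x => Classical.epsilon fun y => (H m (x, y)).2 = h (u m) (H m (x, y)).1

variable [∀ m, MetricSpace (X m)] [∀ m, MetricSpace (Y m)]

/-- The standing assumptions in normal form, with explicit uniform constants: `r` is the slope of
the invariant graphs, `lu`, `ls` are the rates of expansion and contraction, and `Λ` is the rate
at which the distance of a point to a graph grows. -/
structure GraphSystem (H : ∀ m, X m × Y m → X (u m) × Y (u m))
    (F : ∀ m, X m × Y (u m) → X (u m)) (G : ∀ m, X m × Y (u m) → Y m)
    (α lu r ls Λ : M → ℝ) (κ c B : ℝ) : Prop where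
  generating : HasGeneratingMap H F G
  lip_F : ∀ m x y y', dist (F m (x, y)) (F m (x, y')) ≤ α m * dist y y'
  lip_G : ∀ m x y y', dist (G m (x, y)) (G m (x, y')) ≤ lu m * dist y y'
  cone : ∀ m z z', dist (H m z).2 (H m z').2 ≤ r (u m) * dist (H m z).1 (H m z').1 →
    dist z.2 z'.2 ≤ r m * dist z.1 z'.1 ∧ dist (H m z).1 (H m z').1 ≤ ls m * dist z.1 z'.1
  -- The first alternative is case (A'), where ϑ pays for the angle at every step. The second is
  -- case (A), where the cones are invariant and the angle is paid for only once.
  expansion : (∀ m, lu m ≤ Λ m * (1 - α m * r (u m))) ∨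
    ((∀ m z z', dist z.1 z'.1 ≤ α m * dist z.2 z'.2 →
      dist (H m z).1 (H m z').1 ≤ α m * dist (H m z).2 (H m z').2 ∧
      dist z.2 z'.2 ≤ Λ m * dist (H m z).2 (H m z').2) ∧ ∀ m, α m ≤ α (u m))
  α_nonneg : ∀ m, 0 ≤ α m
  lu_nonneg : ∀ m, 0 ≤ lu m
  r_nonneg : ∀ m, 0 ≤ r m
  ls_nonneg : ∀ m, 0 ≤ ls m
  Λ_nonneg : ∀ m, 0 ≤ Λ m
  angle : ∀ m, α m * r (u m) ≤ κ
  κ_nonneg : 0 ≤ κ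
  κ_lt : κ < 1
  rate : ∀ m, Λ m * ls m ≤ c
  c_nonneg : 0 ≤ c
  c_lt : c < 1
  one_le : 1 ≤ B
  α_le : ∀ m, α m ≤ B
  lu_le : ∀ m, lu m ≤ B
  r_le : ∀ m, r m ≤ B
  ls_le : ∀ m, ls m ≤ B
  Λ_le : ∀ m, Λ m ≤ B

/-- The maps `h_m` are `r(m)`-Lipschitz. -/
def LipSection (r : M → ℝ) (h : ∀ m, X m → Y m) : Prop :=
  ∀ m x x', dist (h m x) (h m x') ≤ r m * dist x x'

variable {H : ∀ m, X m × Y m → X (u m) × Y (u m)}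
  {F : ∀ m, X m × Y (u m) → X (u m)} {G : ∀ m, X m × Y (u m) → Y m}
  {α lu r ls Λ : M → ℝ} {κ c B : ℝ}

namespace GraphSystem

/-- Pulling back to a larger base. -/
theorem pullback (S : GraphSystem H F G α lu r ls Λ κ c B) {D : M → Type*}
    (v : ∀ m, D m → D (u m)) :
    GraphSystem (M := Σ m, D m) (u := fun i => ⟨u i.1, v i.1 i.2⟩) (X := fun i => X i.1)
      (Y := fun i => Y i.1) (fun i => H i.1) (fun i => F i.1) (fun i => G i.1)
      (fun i => α i.1) (fun i => lu i.1) (fun i => r i.1) (fun i => ls i.1) (fun i => Λ i.1)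
      κ c B where
  generating i := S.generating i.1
  lip_F i := S.lip_F i.1
  lip_G i := S.lip_G i.1
  cone i := S.cone i.1
  expansion := S.expansion.imp (fun h i => h i.1) (fun h => ⟨fun i => h.1 i.1, fun i => h.2 i.1⟩)
  α_nonneg i := S.α_nonneg i.1
  lu_nonneg i := S.lu_nonneg i.1
  r_nonneg i := S.r_nonneg i.1
  ls_nonneg i := S.ls_nonneg i.1
  Λ_nonneg i := S.Λ_nonneg i.1
  angle i := S.angle i.1
  κ_nonneg := S.κ_nonneg
  κ_lt := S.κ_lt
  rate i := S.rate i.1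
  c_nonneg := S.c_nonneg
  c_lt := S.c_lt
  one_le := S.one_le
  α_le i := S.α_le i.1
  lu_le i := S.lu_le i.1
  r_le i := S.r_le i.1
  ls_le i := S.ls_le i.1
  Λ_le i := S.Λ_le i.1

variable (S : GraphSystem H F G α lu r ls Λ κ c B)
include S

theorem eq_G (m : M) (z : X m × Y m) : z.2 = G m (z.1, (H m z).2) :=
  ((S.generating m z.1 z.2 (H m z).1 (H m z).2).1 rfl).1

theorem eq_F (m : M) (z : X m × Y m) : (H m z).1 = F m (z.1, (H m z).2) :=
  ((S.generating m z.1 z.2 (H m z).1 (H m z).2).1 rfl).2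

theorem dist_fst_le (m : M) (x : X m) (y y' : Y m) :
    dist (H m (x, y)).1 (H m (x, y')).1 ≤ α m * dist (H m (x, y)).2 (H m (x, y')).2 := by
  rw [S.eq_F m (x, y), S.eq_F m (x, y')]
  exact S.lip_F m x _ _

theorem dist_snd_le (m : M) (x : X m) (y y' : Y m) :
    dist y y' ≤ lu m * dist (H m (x, y)).2 (H m (x, y')).2 := by
  have h := S.eq_G m (x, y)
  have h' := S.eq_G m (x, y')
  dsimp only at h h'
  calc dist y y' = dist (G m (x, (H m (x, y)).2)) (G m (x, (H m (x, y')).2)) := by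
        rw [← h, ← h']
    _ ≤ _ := S.lip_G m x _ _

theorem one_sub_pos : 0 < 1 - κ := sub_pos.2 S.κ_lt

theorem B_nonneg : 0 ≤ B := zero_le_one.trans S.one_le

/-- Points over the same `x`: the distance of their images is controlled by the distance of one
of the images to a graph through the other. -/
theorem dist_image_le {h : ∀ m, X m → Y m} (hh : LipSection r h) {m : M} {x : X m} {y y' : Y m}
    (hy' : (H m (x, y')).2 = h (u m) (H m (x, y')).1) :
    (1 - α m * r (u m)) * dist (H m (x, y)).2 (H m (x, y')).2 ≤
      dist (H m (x, y)).2 (h (u m) (H m (x, y)).1) := by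
  have h1 := S.dist_fst_le m x y y'
  have h2 := hh (u m) (H m (x, y)).1 (H m (x, y')).1
  have h3 := dist_triangle (H m (x, y)).2 (h (u m) (H m (x, y)).1) (H m (x, y')).2
  rw [hy'] at h1 h3 ⊢
  -- The second point lies on the graph, so moving along the graph costs at most r times the
  -- horizontal distance, which is at most α times the vertical one.
  have h4 := mul_le_mul_of_nonneg_left h1 (S.r_nonneg (u m))
  nlinarith

/-- Since 1 - αr is positive, images on the same graph have equal second coordinates; the Lipschitz
bound for `G` carries this back to y and y'. -/
theorem eq_of_mem_graph {h : ∀ m, X m → Y m} (hh : LipSection r h) {m : M} {x : X m} {y y' : Y m}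
    (hy : (H m (x, y)).2 = h (u m) (H m (x, y)).1)
    (hy' : (H m (x, y')).2 = h (u m) (H m (x, y')).1) : y = y' := by
  have h1 := S.dist_image_le hh (y := y) hy'
  rw [← hy, dist_self] at h1
  have h2 : dist (H m (x, y)).2 (H m (x, y')).2 ≤ 0 := by
    have := S.angle m
    have := S.κ_lt
    by_contra hlt
    nlinarith
  have h3 := S.dist_snd_le m x y y'
  have h4 := S.lu_nonneg m
  exact dist_le_zero.1 (h3.trans (mul_nonpos_of_nonneg_of_nonpos h4 h2))

variable [∀ m, Nonempty (Y m)]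

/-- The first coordinate x' of the image must solve x' = F(x, h(x')). The right-hand side is a
contraction by the angle condition, and `G` recovers y. Completeness of the horizontal fibers enters
here. -/
theorem exists_mem_graph [∀ m, CompleteSpace (X m)] {h : ∀ m, X m → Y m} (hh : LipSection r h)
    (m : M) (x : X m) : ∃ y, (H m (x, y)).2 = h (u m) (H m (x, y)).1 := by
  have hc : ContractingWith κ.toNNReal (fun x' => F m (x, h (u m) x')) := by
    refine ⟨by simpa using S.κ_lt, LipschitzWith.of_dist_le_mul fun x₁ x₂ => ?_⟩
    rw [Real.coe_toNNReal _ S.κ_nonneg]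
    calc _ ≤ α m * dist (h (u m) x₁) (h (u m) x₂) := S.lip_F m x _ _
      _ ≤ α m * (r (u m) * dist x₁ x₂) := by
        gcongr
        exacts [S.α_nonneg m, hh _ _ _]
      _ ≤ κ * dist x₁ x₂ := by
        rw [← mul_assoc]
        gcongr
        exact S.angle m
  have : Nonempty (X (u m)) := ⟨(H m (x, Classical.arbitrary _)).1⟩
  set x' := hc.fixedPoint
  have hx' : F m (x, h (u m) x') = x' := hc.fixedPoint_isFixedPt
  refine ⟨G m (x, h (u m) x'), ?_⟩
  rw [(S.generating m x (G m (x, h (u m) x')) x' (h (u m) x')).2 ⟨rfl, hx'.symm⟩]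

variable [∀ m, CompleteSpace (X m)]

theorem transform_spec {h : ∀ m, X m → Y m} (hh : LipSection r h) (m : M) (x : X m) :
    (H m (x, transform H h m x)).2 = h (u m) (H m (x, transform H h m x)).1 :=
  Classical.epsilon_spec (S.exists_mem_graph hh m x)

theorem eq_transform {h : ∀ m, X m → Y m} (hh : LipSection r h) {m : M} {x : X m} {y : Y m}
    (hy : (H m (x, y)).2 = h (u m) (H m (x, y)).1) : y = transform H h m x :=
  S.eq_of_mem_graph hh hy (S.transform_spec hh m x)

theorem transform_eq_self {h : ∀ m, X m → Y m} (hh : LipSection r h)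
    (hi : ∀ m x, (H m (x, h m x)).2 = h (u m) (H m (x, h m x)).1) : transform H h = h :=
  funext fun m => funext fun x => (S.eq_transform hh (hi m x)).symm

/-- Images on an r-Lipschitz graph satisfy the premise of the cone condition, whose conclusion is
the slope bound one step earlier. -/
theorem lipSection_transform {h : ∀ m, X m → Y m} (hh : LipSection r h) :
    LipSection r (transform H h) := by
  intro m x x'
  refine (S.cone m (x, transform H h m x) (x', transform H h m x') ?_).1
  rw [S.transform_spec hh, S.transform_spec hh]
  exact hh _ _ _

theorem lipSection_iterate {h : ∀ m, X m → Y m} (hh : LipSection r h) (n : ℕ) :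
    LipSection r ((transform H)^[n] h) := by
  induction n with
  | zero => exact hh
  | succ n ih =>
    rw [Function.iterate_succ_apply']
    exact S.lipSection_transform ih

/-- A step of the graph transform of a section with the point on the graph mapped forward. -/
theorem iterate_spec {h : ∀ m, X m → Y m} (hh : LipSection r h) (n : ℕ) {m : M} {p : X m × Y m}
    (hp : p.2 = (transform H)^[n + 1] h m p.1) :
    (H m p).2 = (transform H)^[n] h (u m) (H m p).1 := by
  have := S.transform_spec (S.lipSection_iterate hh n) m p.1
  rw [Function.iterate_succ_apply'] at hp
  rw [← hp] at this
  exact this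

/-- The distance of a point to the `n`-th transform of a graph, in terms of the distance of its
`n`-th iterate to the graph. -/
theorem dist_iterate_le {h : ∀ m, X m → Y m} (hh : LipSection r h) (n : ℕ) (m : M)
    (p : X m × Y m) :
    dist p.2 ((transform H)^[n] h m p.1) ≤ (1 - κ)⁻¹ * (cocycle u Λ n m *
      dist (iter H n m p).2 (h (u^[n] m) (iter H n m p).1)) := by
  have hκ : 1 ≤ (1 - κ)⁻¹ := by
    rw [one_le_inv₀ S.one_sub_pos]
    linarith [S.κ_nonneg]
  rcases S.expansion with hA | ⟨hA, hα⟩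
  -- Here the loss 1 - αr of each step is already contained in Λ, so the induction needs no factor
  -- (1 - κ)⁻¹.
  · have key : ∀ n m (p : X m × Y m), dist p.2 ((transform H)^[n] h m p.1) ≤
        cocycle u Λ n m * dist (iter H n m p).2 (h (u^[n] m) (iter H n m p).1) := by
      intro n
      induction n with
      | zero =>
        intro m p
        rw [cocycle_zero, one_mul]
        exact le_rfl
      | succ n ih =>
        intro m p
        have hL := S.lipSection_iterate hh n
        rw [cocycle_succ, mul_assoc, Function.iterate_succ_apply']
        have h1 := S.dist_image_le hL (y := p.2) (S.transform_spec hL m p.1)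
        have h2 := S.dist_snd_le m p.1 p.2 (transform H ((transform H)^[n] h) m p.1)
        have h3 := ih (u m) (H m p)
        calc _ ≤ _ := h2
          _ ≤ Λ m * (1 - α m * r (u m)) * _ :=
            mul_le_mul_of_nonneg_right (hA m) dist_nonneg
          _ = Λ m * ((1 - α m * r (u m)) * _) := mul_assoc _ _ _
          _ ≤ Λ m * _ := mul_le_mul_of_nonneg_left (h1.trans h3) (S.Λ_nonneg m)
    refine (key n m p).trans (le_mul_of_one_le_left ?_ hκ)
    exact mul_nonneg (cocycle_nonneg S.Λ_nonneg _ _) dist_nonneg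
  -- The orbit of p is compared with that of a point p' on the transform, the pair staying in a
  -- cone. The aperture a is 0 at the start and then that of the preceding fiber: the angle
  -- condition pairs α(m) with r(u(m)), so α(u(m)) could not be used over u(m). The factor (1 - κ)⁻¹
  -- arises once, at n = 0, on passing from the distance of the points to the distance to the graph.
  · have key : ∀ n m (p p' : X m × Y m) (a : ℝ), 0 ≤ a → a ≤ α m → a * r m ≤ κ →
        dist p.1 p'.1 ≤ a * dist p.2 p'.2 → p'.2 = (transform H)^[n] h m p'.1 →
        dist p.2 p'.2 ≤ (1 - κ)⁻¹ * (cocycle u Λ n m *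
          dist (iter H n m p).2 (h (u^[n] m) (iter H n m p).1)) := by
      intro n
      induction n with
      | zero =>
        intro m p p' a ha _ hr hd hp'
        have h1 := hh m p.1 p'.1
        have h2 := dist_triangle p.2 (h m p.1) (h m p'.1)
        simp only [Function.iterate_zero, id] at hp'
        rw [cocycle_zero, one_mul, le_inv_mul_iff₀ S.one_sub_pos]
        change (1 - κ) * dist p.2 p'.2 ≤ dist p.2 (h m p.1)
        rw [← hp'] at h1 h2
        have h3 := mul_le_mul_of_nonneg_left hd (S.r_nonneg m)
        have h4 := mul_le_mul_of_nonneg_right hr (dist_nonneg (x := p.2) (y := p'.2))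
        nlinarith
      | succ n ih =>
        intro m p p' a ha haα hr hd hp'
        obtain ⟨h1, h2⟩ := hA m p p' (hd.trans (mul_le_mul_of_nonneg_right haα dist_nonneg))
        have h3 := ih (u m) (H m p) (H m p') (α m) (S.α_nonneg m) (hα m) (S.angle m) h1
          (S.iterate_spec hh n hp')
        rw [cocycle_succ, mul_assoc, mul_left_comm]
        exact h2.trans (mul_le_mul_of_nonneg_left h3 (S.Λ_nonneg m))
    refine key n m p (p.1, (transform H)^[n] h m p.1) 0 le_rfl (S.α_nonneg m) ?_ ?_ rfl
    · simpa using S.κ_nonneg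
    · simp

theorem iter_mem_graph {h : ∀ m, X m → Y m} (hh : LipSection r h) (n : ℕ) : ∀ {m : M}
    {p : X m × Y m}, p.2 = (transform H)^[n] h m p.1 →
    (iter H n m p).2 = h (u^[n] m) (iter H n m p).1 := by
  induction n with
  | zero => exact fun hp => hp
  | succ n ih => exact fun hp => ih (S.iterate_spec hh n hp)

/-- After each step both points still lie on a common r-Lipschitz graph, so the contraction in the
cone condition applies again. -/
theorem dist_iter_le {h : ∀ m, X m → Y m} (hh : LipSection r h) (n : ℕ) : ∀ {m : M}
    {p p' : X m × Y m}, p.2 = (transform H)^[n] h m p.1 → p'.2 = (transform H)^[n] h m p'.1 →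
    dist (iter H n m p).1 (iter H n m p').1 ≤ cocycle u ls n m * dist p.1 p'.1 := by
  induction n with
  | zero =>
    intro m p p' _ _
    rw [cocycle_zero, one_mul]
    exact le_rfl
  | succ n ih =>
    intro m p p' hp hp'
    have h1 := S.iterate_spec hh n hp
    have h2 := S.iterate_spec hh n hp'
    have h3 := (S.cone m p p' (by
      rw [h1, h2]
      exact S.lipSection_iterate hh n _ _ _)).2
    refine (ih h1 h2).trans ?_
    rw [cocycle_succ, mul_comm (ls m), mul_assoc]
    exact mul_le_mul_of_nonneg_left h3 (cocycle_nonneg S.ls_nonneg _ _)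

omit [∀ m, Nonempty (Y m)] [∀ m, CompleteSpace (X m)] in
theorem cocycle_rate_le (n : ℕ) (m : M) : cocycle u Λ n m * cocycle u ls n m ≤ c ^ n := by
  rw [← cocycle_mul]
  exact cocycle_le_pow (fun m => mul_nonneg (S.Λ_nonneg m) (S.ls_nonneg m)) S.rate n m

section Pointed

variable {o : ∀ m, X m × Y m} (ho : ∀ m, H m (o m) = o (u m))
include ho

omit S [∀ m, Nonempty (Y m)] [∀ m, CompleteSpace (X m)] [∀ m, MetricSpace (X m)]
  [∀ m, MetricSpace (Y m)] in
theorem iter_base (n : ℕ) : ∀ m, iter H n m (o m) = o (u^[n] m) := by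
  induction n with
  | zero => exact fun _ => rfl
  | succ n ih =>
    intro m
    change iter H n (u m) (H m (o m)) = _
    rw [ho]
    exact ih (u m)

theorem base_mem_iterate {h : ∀ m, X m → Y m} (hh : LipSection r h)
    (hho : ∀ m, (o m).2 = h m (o m).1) (n : ℕ) (m : M) :
    (o m).2 = (transform H)^[n] h m (o m).1 := by
  have := S.dist_iterate_le hh n m (o m)
  rw [iter_base ho, ← hho, dist_self, mul_zero, mul_zero] at this
  exact dist_le_zero.1 this

/-- Two sections through the base points which are close to first order have close transforms. -/
theorem dist_iterate_iterate_le {g g' : ∀ m, X m → Y m} (hg : LipSection r g)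
    (hg' : LipSection r g') (hgo : ∀ m, (o m).2 = g' m (o m).1)
    {e : M → ℝ} (he : ∀ m x, dist (g m x) (g' m x) ≤ e m * dist x (o m).1) (he0 : ∀ m, 0 ≤ e m)
    (n : ℕ) (m : M) (x : X m) :
    dist ((transform H)^[n] g m x) ((transform H)^[n] g' m x) ≤
      (1 - κ)⁻¹ * (cocycle u Λ n m * cocycle u ls n m * e (u^[n] m) * dist x (o m).1) := by
  -- The point of the transform of g' is followed forward. Its n-th image lies on g', within
  -- ls^{(n)} |x - o| of the base point, where g and g' differ by at most e times that distance.
  have h1 := S.dist_iterate_le hg n m (x, (transform H)^[n] g' m x)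
  have h2 := S.iter_mem_graph hg' n (m := m) (p := (x, (transform H)^[n] g' m x)) rfl
  have h3 := S.dist_iter_le hg' n (m := m) (p := (x, (transform H)^[n] g' m x)) (p' := o m) rfl
    (S.base_mem_iterate ho hg' hgo n m)
  rw [iter_base ho] at h3
  rw [dist_comm] at h1
  refine h1.trans ?_
  rw [h2, dist_comm]
  have h4 := he (u^[n] m) (iter H n m (x, (transform H)^[n] g' m x)).1
  have h5 := S.one_sub_pos
  have h6 := cocycle_nonneg (u := u) S.Λ_nonneg n m
  rw [mul_assoc, mul_assoc, mul_left_comm (cocycle u ls n m)]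
  gcongr
  exact h4.trans (mul_le_mul_of_nonneg_left h3 (he0 _))

theorem dist_iterate_iterate_le_pow {g g' : ∀ m, X m → Y m} (hg : LipSection r g)
    (hg' : LipSection r g') (hgo : ∀ m, (o m).2 = g' m (o m).1)
    {e : ℝ} (he : ∀ m x, dist (g m x) (g' m x) ≤ e * dist x (o m).1) (he0 : 0 ≤ e)
    (n : ℕ) (m : M) (x : X m) :
    dist ((transform H)^[n] g m x) ((transform H)^[n] g' m x) ≤
      (1 - κ)⁻¹ * e * dist x (o m).1 * c ^ n := by
  refine (S.dist_iterate_iterate_le ho hg hg' hgo he (fun _ => he0) n m x).trans ?_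
  have h5 := S.one_sub_pos
  have := S.cocycle_rate_le n m
  calc _ ≤ (1 - κ)⁻¹ * (c ^ n * e * dist x (o m).1) := by gcongr
    _ = _ := by ring

omit ho [∀ m, Nonempty (Y m)] [∀ m, CompleteSpace (X m)] in
theorem dist_le_of_base {g g' : ∀ m, X m → Y m} (hg : LipSection r g) (hg' : LipSection r g')
    (hgo : ∀ m, (o m).2 = g m (o m).1) (hgo' : ∀ m, (o m).2 = g' m (o m).1) (m : M) (x : X m) :
    dist (g m x) (g' m x) ≤ 2 * B * dist x (o m).1 := by
  have h1 := hg m x (o m).1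
  have h2 := hg' m (o m).1 x
  have h3 := dist_triangle (g m x) (g m (o m).1) (g' m x)
  rw [← hgo, hgo' m] at h1 h3
  have h4 := S.r_le m
  have h5 := dist_nonneg (x := x) (y := (o m).1)
  rw [dist_comm (o m).1 x] at h2
  nlinarith

omit ho [∀ m, Nonempty (Y m)] [∀ m, CompleteSpace (X m)] in
theorem tendsto_mul_pow (K : ℝ) : Tendsto (fun n : ℕ => K * c ^ n) atTop (𝓝 0) := by
  simpa using (tendsto_pow_atTop_nhds_zero_of_lt_one S.c_nonneg S.c_lt).const_mul K

/-- The first order bound 2B|x - o| holds for any two sections through the base points; n transforms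
change neither section but shrink the bound like c^n. -/
theorem invariant_unique {g g' : ∀ m, X m → Y m} (hg : LipSection r g)
    (hg' : LipSection r g') (hgo : ∀ m, (o m).2 = g m (o m).1)
    (hgo' : ∀ m, (o m).2 = g' m (o m).1) (hT : transform H g = g) (hT' : transform H g' = g') :
    g = g' := by
  funext m x
  refine dist_le_zero.1 (ge_of_tendsto' (S.tendsto_mul_pow ((1 - κ)⁻¹ * (2 * B) * dist x (o m).1))
    fun n => ?_)
  have := S.dist_iterate_iterate_le_pow ho hg hg' hgo' (S.dist_le_of_base hg hg' hgo hgo')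
    (by linarith [S.B_nonneg]) n m x
  rwa [Function.iterate_fixed hT, Function.iterate_fixed hT'] at this

/-- The transforms of the horizontal sections through the base points form a Cauchy sequence at each
point, with geometric rate. -/
theorem exists_invariant [∀ m, CompleteSpace (Y m)] : ∃ f : ∀ m, X m → Y m, LipSection r f ∧
    (∀ m, (o m).2 = f m (o m).1) ∧ transform H f = f := by
  set g : ∀ m, X m → Y m := fun m _ => (o m).2 with hgdef
  have hg : LipSection r g := fun m x x' => by
    simpa [hgdef] using mul_nonneg (S.r_nonneg m) dist_nonneg
  have hgo : ∀ m, (o m).2 = g m (o m).1 := fun _ => rfl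
  have hg1 := S.lipSection_iterate hg 1
  have hgo1 := S.base_mem_iterate ho hg hgo 1
  have hcau : ∀ m x n, dist ((transform H)^[n] g m x) ((transform H)^[n + 1] g m x) ≤
      (1 - κ)⁻¹ * (2 * B) * dist x (o m).1 * c ^ n := fun m x n => by
    have := S.dist_iterate_iterate_le_pow ho hg hg1 hgo1 (S.dist_le_of_base hg hg1 hgo hgo1)
      (by linarith [S.B_nonneg]) n m x
    rwa [← Function.iterate_add_apply] at this
  choose f hf using fun m x => cauchySeq_tendsto_of_complete
    (cauchySeq_of_le_geometric c _ S.c_lt (hcau m x))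
  have hfl : LipSection r f := fun m x x' =>
    le_of_tendsto' ((hf m x).dist (hf m x')) fun n => S.lipSection_iterate hg n m x x'
  refine ⟨f, hfl, fun m => tendsto_nhds_unique (f := fun n => (transform H)^[n] g m (o m).1)
    (l := atTop) ?_ (hf m _), ?_⟩
  · exact tendsto_const_nhds.congr fun n => S.base_mem_iterate ho hg hgo n m
  · funext m x
    refine tendsto_nhds_unique (f := fun n => (transform H)^[n + 1] g m x) (l := atTop) ?_
      ((tendsto_add_atTop_iff_nat 1).2 (hf m x))
    rw [tendsto_iff_dist_tendsto_zero]
    set p : X m × Y m := (x, transform H f m x) with hp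
    -- Pointwise convergence suffices for the limit to be invariant: one transform step at x
    -- involves the sections only at the single point where p is mapped.
    have h1 : ∀ n, dist ((transform H)^[n + 1] g m x) (transform H f m x) ≤
        (1 - κ)⁻¹ * (cocycle u Λ 1 m *
          dist (f (u m) (H m p).1) ((transform H)^[n] g (u m) (H m p).1)) := fun n => by
      have := S.dist_iterate_le (S.lipSection_iterate hg n) 1 m p
      rw [← S.transform_spec hfl m x, dist_comm, Function.iterate_succ_apply']
      exact this
    refine squeeze_zero (fun _ => dist_nonneg) h1 ?_
    have h2 := ((tendsto_const_nhds (x := f (u m) (H m p).1)).dist (hf (u m) (H m p).1))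
    rw [dist_self] at h2
    simpa using (h2.const_mul (cocycle u Λ 1 m)).const_mul (1 - κ)⁻¹

/-- A section through the base points which is close to its transform to first order is close to
the invariant section. -/
theorem dist_invariant_le {f g : ∀ m, X m → Y m} (hg : LipSection r g)
    (hgo : ∀ m, (o m).2 = g m (o m).1) (hf : LipSection r f) (hfo : ∀ m, (o m).2 = f m (o m).1)
    (hT : transform H f = f) {e : M → ℝ}
    (he : ∀ m x, dist (g m x) (transform H g m x) ≤ e m * dist x (o m).1) (he0 : ∀ m, 0 ≤ e m)
    (n : ℕ) (m : M) (x : X m) :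
    dist (g m x) (f m x) ≤ (1 - κ)⁻¹ * (∑ k ∈ Finset.range n,
      cocycle u Λ k m * cocycle u ls k m * e (u^[k] m) + 2 * B * c ^ n) * dist x (o m).1 := by
  -- The sum telescopes over successive transforms and is kept finite, since e may grow along the
  -- orbit; n remains free to be optimized.
  have h1 := dist_le_range_sum_dist (fun k => (transform H)^[k] g m x) n
  have h2 := S.dist_iterate_iterate_le_pow ho hg hf hfo (S.dist_le_of_base hg hf hgo hfo)
    (by linarith [S.B_nonneg]) n m x
  rw [Function.iterate_fixed hT] at h2
  have h3 : ∑ k ∈ Finset.range n,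
      dist ((transform H)^[k] g m x) ((transform H)^[k + 1] g m x) ≤ ∑ k ∈ Finset.range n,
      (1 - κ)⁻¹ * (cocycle u Λ k m * cocycle u ls k m * e (u^[k] m) * dist x (o m).1) :=
    Finset.sum_le_sum fun k _ => S.dist_iterate_iterate_le ho hg (S.lipSection_transform hg)
      (S.base_mem_iterate ho hg hgo 1) he he0 k m x
  rw [← Finset.mul_sum, ← Finset.sum_mul] at h3
  have h4 := dist_triangle (g m x) ((transform H)^[n] g m x) (f m x)
  calc _ ≤ _ := h4
    _ ≤ _ := add_le_add (h1.trans h3) h2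
    _ = _ := by ring

end Pointed

end GraphSystem

end Transform

/-! ### From competing exponential bounds to Hölder bounds. -/

section Interpolation

/-- A quantity that is at most `R ^ n * δ + c ^ n` for all `n` is at most a power of `δ`. -/
theorem exists_rpow_bound_of_le_one {R c : ℝ} (hR : 0 ≤ R) (hc0 : 0 ≤ c) (hc : c < 1) :
    ∃ θ K : ℝ, 0 < θ ∧ θ ≤ 1 ∧ 0 ≤ K ∧ ∀ δ D : ℝ, 0 ≤ δ → δ ≤ 1 →
      (∀ n : ℕ, D ≤ R ^ n * δ + c ^ n) → D ≤ K * δ ^ θ := by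
  -- Enlarging c and R makes both logarithms below positive, so that θ is defined and lies in (0,
  -- 1].
  set c' := max c (1 / 2) with hc'
  set R' := max R 1 with hR'
  have hc'0 : 0 < c' := lt_max_of_lt_right (by norm_num)
  have hc'1 : c' < 1 := max_lt hc (by norm_num)
  have hR'1 : 1 ≤ R' := le_max_right _ _
  have hq : 1 < R' / c' := by
    rw [one_lt_div hc'0]
    linarith
  have hlq : 0 < Real.log (R' / c') := Real.log_pos hq
  have hlc : 0 < Real.log (1 / c') := Real.log_pos (by rwa [one_lt_div hc'0])
  set θ := Real.log (1 / c') / Real.log (R' / c') with hθ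
  have hθ0 : 0 < θ := div_pos hlc hlq
  have hθ1 : θ ≤ 1 := by
    rw [hθ, div_le_one hlq]
    exact Real.log_le_log (by positivity) (by gcongr)
  refine ⟨θ, 2 / c', hθ0, hθ1, by positivity, fun δ D hδ hδ1 hD => ?_⟩
  have hD' : ∀ n : ℕ, D ≤ R' ^ n * δ + c' ^ n := fun n => (hD n).trans <| by
    gcongr
    exacts [le_max_left _ _, le_max_left _ _]
  rcases hδ.eq_or_lt with rfl | hδ0
  · rw [Real.zero_rpow hθ0.ne', mul_zero]
    refine ge_of_tendsto' (tendsto_pow_atTop_nhds_zero_of_lt_one hc0 hc) fun n => ?_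
    simpa using hD n
  have hlogδ : 0 ≤ Real.log (1 / δ) / Real.log (R' / c') :=
    div_nonneg (Real.log_nonneg (by rwa [le_div_iff₀ hδ0, one_mul])) hlq.le
  -- The largest n with R'^n δ ≤ c'^n. Maximality gives c'^(n+1) ≤ δ^θ; hence the constant 2/c': two
  -- comparable terms and one lost power of c'.
  set n := ⌊Real.log (1 / δ) / Real.log (R' / c')⌋₊ with hn
  have h1 : (n : ℝ) * Real.log (R' / c') ≤ Real.log (1 / δ) := by
    rw [← le_div_iff₀ hlq]
    exact Nat.floor_le hlogδ
  have h2 : Real.log (1 / δ) < ((n : ℝ) + 1) * Real.log (R' / c') := by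
    rw [← div_lt_iff₀ hlq]
    exact Nat.lt_floor_add_one _
  have h3 : R' ^ n * δ ≤ c' ^ n := by
    have h4 : (R' / c') ^ n ≤ 1 / δ := by
      rw [← Real.log_le_log_iff (by positivity) (by positivity), Real.log_pow]
      exact h1
    rw [div_pow, div_le_div_iff₀ (by positivity) hδ0, one_mul] at h4
    exact h4
  have h5 : c' ^ (n + 1) ≤ δ ^ θ := by
    rw [← Real.log_le_log_iff (by positivity) (Real.rpow_pos_of_pos hδ0 _), Real.log_pow,
      Real.log_rpow hδ0]
    have h6 : θ * Real.log (1 / δ) ≤ ((n : ℝ) + 1) * Real.log (1 / c') := by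
      calc θ * Real.log (1 / δ) ≤ θ * (((n : ℝ) + 1) * Real.log (R' / c')) := by gcongr
        _ = ((n : ℝ) + 1) * (θ * Real.log (R' / c')) := by ring
        _ = _ := by rw [hθ, div_mul_cancel₀ _ hlq.ne']
    rw [one_div, Real.log_inv, one_div, Real.log_inv] at h6
    push_cast
    linarith
  have h7 : c' ^ n ≤ δ ^ θ / c' := by
    rw [le_div_iff₀ hc'0, ← pow_succ]
    exact h5
  calc D ≤ _ := hD' n
    _ ≤ 2 * (δ ^ θ / c') := by linarith
    _ = _ := by ring

/-- For δ > 1 the bound with n = 0 is enough, at the price of the factor 1 + δ. -/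
theorem exists_rpow_bound {R c : ℝ} (hR : 0 ≤ R) (hc0 : 0 ≤ c) (hc : c < 1) :
    ∃ θ K : ℝ, 0 < θ ∧ θ ≤ 1 ∧ 0 ≤ K ∧ ∀ E δ D : ℝ, 0 ≤ E → 0 ≤ δ →
      (∀ n : ℕ, D ≤ E * (R ^ n * δ + c ^ n)) → D ≤ E * K * (1 + δ) * δ ^ θ := by
  obtain ⟨θ, K, hθ0, hθ1, hK0, hK⟩ := exists_rpow_bound_of_le_one hR hc0 hc
  refine ⟨θ, K + 1, hθ0, hθ1, by positivity, fun E δ D hE hδ hD => ?_⟩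
  have hδθ : 0 ≤ δ ^ θ := Real.rpow_nonneg hδ _
  rcases hE.eq_or_lt with rfl | hE0
  · simpa using hD 0
  rcases le_or_gt δ 1 with hδ1 | hδ1
  · have := hK δ (D / E) hδ hδ1 fun n => by
      rw [div_le_iff₀ hE0, mul_comm]
      exact hD n
    rw [div_le_iff₀ hE0, mul_comm] at this
    have h1 : E * (K * δ ^ θ) ≤ E * ((K + 1) * (1 + δ) * δ ^ θ) := by
      gcongr
      nlinarith
    calc D ≤ _ := this
      _ ≤ _ := h1
      _ = _ := by ring
  · have h1 := hD 0
    have h2 : 1 ≤ δ ^ θ := Real.one_le_rpow hδ1.le hθ0.le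
    simp only [pow_zero, one_mul] at h1
    calc D ≤ E * (δ + 1) := h1
      _ = E * 1 * (1 + δ) * 1 := by ring
      _ ≤ E * (K + 1) * (1 + δ) * δ ^ θ := by
        gcongr
        linarith

end Interpolation

/-! ### The foliation: uniqueness, characterization of leaves, continuity, Hölder dependence. -/

section Family

variable {M : Type*} {X : M → Type*} {Y : M → Type*} {u : M → M}
  [∀ m, MetricSpace (X m)] [∀ m, MetricSpace (Y m)]

/-- An invariant family of Lipschitz graphs, in terms of the maps. -/
structure InvariantFamily (H : ∀ m, X m × Y m → X (u m) × Y (u m)) (r : M → ℝ)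
    (f : ∀ m, X m × Y m → X m → Y m) : Prop where
  lip : ∀ m q x x', dist (f m q x) (f m q x') ≤ r m * dist x x'
  base : ∀ m q, q.2 = f m q q.1
  inv : ∀ m q x, (H m (x, f m q x)).2 = f (u m) (H m q) (H m (x, f m q x)).1

variable {H : ∀ m, X m × Y m → X (u m) × Y (u m)}
  {F : ∀ m, X m × Y (u m) → X (u m)} {G : ∀ m, X m × Y (u m) → Y m}
  {α lu r ls Λ : M → ℝ} {κ c B : ℝ} {f : ∀ m, X m × Y m → X m → Y m}

omit [∀ m, MetricSpace (X m)] [∀ m, MetricSpace (Y m)] in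
-- The base orbit in the total space agrees with that of u only propositionally, so points of the
-- two fibers cannot be equated directly; they are compared through real-valued functions φ.
theorem iter_pullback {D : M → Type*} (v : ∀ m, D m → D (u m)) (w : ∀ m, D m → X m × Y m)
    (hw : ∀ m d, H m (w m d) = w (u m) (v m d))
    (φ : ∀ m, X m × Y m → X m × Y m → ℝ) (n : ℕ) : ∀ (m : M) (d : D m) (p : X m × Y m),
    φ ((fun i : Σ m, D m => (⟨u i.1, v i.1 i.2⟩ : Σ m, D m))^[n] ⟨m, d⟩).1
      (w _ ((fun i : Σ m, D m => (⟨u i.1, v i.1 i.2⟩ : Σ m, D m))^[n] ⟨m, d⟩).2)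
      (iter (M := Σ m, D m) (u := fun i => ⟨u i.1, v i.1 i.2⟩) (X := fun i => X i.1)
        (Y := fun i => Y i.1) (fun i => H i.1) n ⟨m, d⟩ p) =
    φ (u^[n] m) (iter H n m (w m d)) (iter H n m p) := by
  induction n with
  | zero => exact fun _ _ _ => rfl
  | succ n ih =>
    intro m d p
    change _ = φ (u^[n] (u m)) (iter H n (u m) (H m (w m d))) (iter H n (u m) (H m p))
    rw [hw]
    exact ih (u m) (v m d) (H m p)

theorem cocycle_pullback {D : M → Type*} (v : ∀ m, D m → D (u m)) (ε : M → ℝ) (n : ℕ) :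
    ∀ (m : M) (d : D m), cocycle (fun i : Σ m, D m => (⟨u i.1, v i.1 i.2⟩ : Σ m, D m))
      (fun i => ε i.1) n ⟨m, d⟩ = cocycle u ε n m := by
  induction n with
  | zero => intro m d; simp [cocycle_zero]
  | succ n ih => intro m d; rw [cocycle_succ, cocycle_succ, ih]

namespace GraphSystem

variable (S : GraphSystem H F G α lu r ls Λ κ c B)
include S

/-- Over the total space of points (m, q), moved by `H`, the tautological section q is invariant and
serves as the section of base points. -/
theorem exists_invariantFamily [∀ m, CompleteSpace (X m)] [∀ m, CompleteSpace (Y m)] :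
    ∃ f, InvariantFamily H r f := by
  have S' := S.pullback (D := fun m => X m × Y m) H
  have : ∀ i : Σ m, X m × Y m, Nonempty (Y i.1) := fun i => ⟨i.2.2⟩
  obtain ⟨f, hl, ho, hT⟩ := S'.exists_invariant (o := fun i => i.2) (fun _ => rfl)
  refine ⟨fun m q x => f ⟨m, q⟩ x, fun m q => hl ⟨m, q⟩, fun m q => ho ⟨m, q⟩, fun m q x => ?_⟩
  have := S'.transform_spec hl ⟨m, q⟩ x
  rw [hT] at this
  exact this

variable [∀ m, CompleteSpace (X m)]

/-- Uniqueness over an arbitrary bundle of parameters, which allows comparison of leaves indexed by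
more than one point. -/
theorem family_eq {D : M → Type*} (v : ∀ m, D m → D (u m)) {g g' : ∀ m, D m → X m → Y m}
    (o : ∀ m, D m → X m × Y m) (ho : ∀ m d, H m (o m d) = o (u m) (v m d))
    (hg : ∀ m d x x', dist (g m d x) (g m d x') ≤ r m * dist x x')
    (hg' : ∀ m d x x', dist (g' m d x) (g' m d x') ≤ r m * dist x x')
    (hgo : ∀ m d, (o m d).2 = g m d (o m d).1) (hgo' : ∀ m d, (o m d).2 = g' m d (o m d).1)
    (hi : ∀ m d x, (H m (x, g m d x)).2 = g (u m) (v m d) (H m (x, g m d x)).1)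
    (hi' : ∀ m d x, (H m (x, g' m d x)).2 = g' (u m) (v m d) (H m (x, g' m d x)).1) :
    g = g' := by
  have S' := S.pullback v
  have : ∀ i : Σ m, D m, Nonempty (Y i.1) := fun i => ⟨(o i.1 i.2).2⟩
  have h1 : LipSection (M := Σ m, D m) (X := fun i => X i.1) (Y := fun i => Y i.1)
    (fun i => r i.1) (fun i => g i.1 i.2) := fun i => hg i.1 i.2
  have h2 : LipSection (M := Σ m, D m) (X := fun i => X i.1) (Y := fun i => Y i.1)
    (fun i => r i.1) (fun i => g' i.1 i.2) := fun i => hg' i.1 i.2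
  have h3 := S'.invariant_unique (o := fun i => o i.1 i.2) (fun i => ho i.1 i.2) h1 h2
    (fun i => hgo i.1 i.2) (fun i => hgo' i.1 i.2)
    (S'.transform_eq_self h1 fun i => hi i.1 i.2) (S'.transform_eq_self h2 fun i => hi' i.1 i.2)
  funext m d
  exact congr_fun h3 ⟨m, d⟩

theorem invariantFamily_unique {g : ∀ m, X m × Y m → X m → Y m} (hf : InvariantFamily H r f)
    (hg : InvariantFamily H r g) : f = g :=
  S.family_eq H (fun _ q => q) (fun _ _ => rfl) hf.lip hg.lip hf.base hg.base hf.inv hg.inv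

/-- The pairs (p, q) with p on the leaf of q form an invariant bundle. Over it both leaves are
invariant and pass through p, so uniqueness applies with base point p. -/
theorem eq_of_mem_leaf (hf : InvariantFamily H r f) {m : M} {p q : X m × Y m}
    (hp : p.2 = f m q p.1) : f m p = f m q := by
  have h := S.family_eq (D := fun m => {d : (X m × Y m) × (X m × Y m) // d.1.2 = f m d.2 d.1.1})
    (fun m d => ⟨(H m d.1.1, H m d.1.2), by
      have := hf.inv m d.1.2 d.1.1.1
      rw [← d.2] at this
      exact this⟩) (g := fun m d => f m d.1.1) (g' := fun m d => f m d.1.2) (fun m d => d.1.1)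
    (fun _ _ => rfl) (fun m d => hf.lip m d.1.1) (fun m d => hf.lip m d.1.2)
    (fun m d => hf.base m d.1.1) (fun m d => d.2) (fun m d => hf.inv m d.1.1)
    (fun m d => hf.inv m d.1.2)
  exact congr_fun (congr_fun h m) ⟨(p, q), hp⟩

/-- The distance of a point to a leaf, in terms of the distance of the iterates. -/
theorem dist_leaf_le (hf : InvariantFamily H r f) (n : ℕ) (m : M) (p q : X m × Y m) :
    dist p.2 (f m q p.1) ≤ (1 - κ)⁻¹ * (cocycle u Λ n m *
      dist (iter H n m p).2 (f (u^[n] m) (iter H n m q) (iter H n m p).1)) := by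
  have S' := S.pullback (D := fun m => X m × Y m) H
  have : ∀ i : Σ m, X m × Y m, Nonempty (Y i.1) := fun i => ⟨i.2.2⟩
  have h1 : LipSection (M := Σ m, X m × Y m) (X := fun i => X i.1) (Y := fun i => Y i.1)
    (fun i => r i.1) (fun i => f i.1 i.2) := fun i => hf.lip i.1 i.2
  have h2 := S'.transform_eq_self h1 fun i => hf.inv i.1 i.2
  have h3 := S'.dist_iterate_le h1 n ⟨m, q⟩ p
  rw [Function.iterate_fixed h2, cocycle_pullback] at h3
  refine h3.trans (le_of_eq ?_)
  congr 2
  exact iter_pullback (D := fun m => X m × Y m) H (fun m q => q) (fun _ _ => rfl)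
    (fun m q p => dist p.2 (f m q p.1)) n m q p

end GraphSystem

theorem InvariantFamily.iter_mem (hf : InvariantFamily H r f) (n : ℕ) : ∀ {m : M}
    {p q : X m × Y m}, p.2 = f m q p.1 →
    (iter H n m p).2 = f (u^[n] m) (iter H n m q) (iter H n m p).1 := by
  induction n with
  | zero => exact fun hp => hp
  | succ n ih =>
    intro m p q hp
    have := hf.inv m q p.1
    rw [← hp] at this
    exact ih this

namespace GraphSystem

variable (S : GraphSystem H F G α lu r ls Λ κ c B)
include S

theorem dist_image_leaf_le (hf : InvariantFamily H r f) {m : M} {p p' q : X m × Y m}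
    (hp : p.2 = f m q p.1) (hp' : p'.2 = f m q p'.1) :
    dist (H m p).1 (H m p').1 ≤ ls m * dist p.1 p'.1 := by
  refine (S.cone m p p' ?_).2
  have h1 := hf.inv m q p.1
  have h2 := hf.inv m q p'.1
  rw [← hp] at h1
  rw [← hp'] at h2
  have := hf.lip (u m) (H m q) (H m p).1 (H m p').1
  rwa [← h1, ← h2] at this

theorem dist_iter_leaf_le (hf : InvariantFamily H r f) (n : ℕ) : ∀ {m : M}
    {p p' q : X m × Y m}, p.2 = f m q p.1 → p'.2 = f m q p'.1 →
    dist (iter H n m p).1 (iter H n m p').1 ≤ cocycle u ls n m * dist p.1 p'.1 := by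
  induction n with
  | zero =>
    intro m p p' q _ _
    rw [cocycle_zero, one_mul]
    exact le_rfl
  | succ n ih =>
    intro m p p' q hp hp'
    have h1 := hf.iter_mem 1 hp
    have h2 := hf.iter_mem 1 hp'
    refine (ih h1 h2).trans ?_
    rw [cocycle_succ, mul_comm (ls m), mul_assoc]
    exact mul_le_mul_of_nonneg_left (S.dist_image_leaf_le hf hp hp')
      (cocycle_nonneg S.ls_nonneg _ _)

theorem dist_le_of_fst (hf : InvariantFamily H r f) {m : M} {p p' q : X m × Y m}
    (hp : p.2 = f m q p.1) (hp' : p'.2 = f m q p'.1) : dist p p' ≤ B * dist p.1 p'.1 := by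
  rw [Prod.dist_eq]
  refine max_le (le_mul_of_one_le_left dist_nonneg S.one_le) ?_
  rw [hp, hp']
  exact (hf.lip _ _ _ _).trans (mul_le_mul_of_nonneg_right (S.r_le m) dist_nonneg)

variable [∀ m, CompleteSpace (X m)]

/-- On a leaf orbits approach at rate ls ≤ ε. Conversely, approach at rate ε bounds the vertical
distance to the leaf by a constant times Λ^{(n)} ε^{(n)}, which tends to 0. -/
theorem leaf_eq_setOf (hf : InvariantFamily H r f) {ε : M → ℝ} {c' : ℝ} (hε : ∀ m, ls m ≤ ε m)
    (hc' : c' < 1) (hεΛ : ∀ m, Λ m * ε m ≤ c') (m : M) (q : X m × Y m) :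
    leaf f m q = {p | ∃ C : ℝ, ∀ n : ℕ, dist (iter H n m p) (iter H n m q) ≤
      C * cocycle u ε n m} := by
  have hε0 : ∀ m, 0 ≤ ε m := fun m => (S.ls_nonneg m).trans (hε m)
  have hc0 : 0 ≤ c' := (mul_nonneg (S.Λ_nonneg m) (hε0 m)).trans (hεΛ m)
  have hB := S.B_nonneg
  ext p
  constructor
  · intro hp
    refine ⟨B * dist p.1 q.1, fun n => ?_⟩
    have h1 := S.dist_le_of_fst hf (hf.iter_mem n hp) (hf.iter_mem n (hf.base m q))
    have h2 := S.dist_iter_leaf_le hf n hp (hf.base m q)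
    have h3 := cocycle_mono (u := u) S.ls_nonneg hε n m
    calc _ ≤ _ := h1
      _ ≤ B * (cocycle u ε n m * dist p.1 q.1) := by
        gcongr
        exact h2.trans (by gcongr)
      _ = _ := by ring
  · rintro ⟨C, hC⟩
    have hC' : ∀ n, dist (iter H n m p) (iter H n m q) ≤ |C| * cocycle u ε n m := fun n =>
      (hC n).trans (mul_le_mul_of_nonneg_right (le_abs_self C) (cocycle_nonneg hε0 _ _))
    have h0 : Tendsto (fun n : ℕ => ((1 - κ)⁻¹ * ((1 + B) * |C|)) * c' ^ n) atTop (𝓝 0) := by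
      simpa using (tendsto_pow_atTop_nhds_zero_of_lt_one hc0 hc').const_mul
        ((1 - κ)⁻¹ * ((1 + B) * |C|))
    refine dist_le_zero.1 (ge_of_tendsto' h0 fun n => ?_)
    have h1 := S.dist_leaf_le hf n m p q
    set P := iter H n m p
    set Q := iter H n m q
    have h2 : dist P.2 (f (u^[n] m) Q P.1) ≤ (1 + B) * dist P Q := by
      have h3 := dist_triangle P.2 Q.2 (f (u^[n] m) Q P.1)
      have h4 := hf.lip (u^[n] m) Q Q.1 P.1
      rw [← hf.base] at h4
      have h5 : dist P.2 Q.2 ≤ dist P Q := le_max_right _ _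
      have h6 : dist Q.1 P.1 ≤ dist P Q := by
        rw [dist_comm]
        exact le_max_left _ _
      have h7 := mul_le_mul (S.r_le (u^[n] m)) h6 dist_nonneg hB
      linarith
    have h8 : cocycle u Λ n m * cocycle u ε n m ≤ c' ^ n := by
      rw [← cocycle_mul]
      exact cocycle_le_pow (fun m => mul_nonneg (S.Λ_nonneg m) (hε0 m)) hεΛ n m
    have h9 := S.one_sub_pos
    have h10 := cocycle_nonneg (u := u) S.Λ_nonneg n m
    calc _ ≤ _ := h1
      _ ≤ (1 - κ)⁻¹ * (cocycle u Λ n m * ((1 + B) * (|C| * cocycle u ε n m))) := by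
        gcongr
        exact h2.trans (by gcongr; exact hC' n)
      _ = ((1 - κ)⁻¹ * ((1 + B) * |C|)) * (cocycle u Λ n m * cocycle u ε n m) := by ring
      _ ≤ _ := by gcongr

/-- The point of the leaf of q over x is followed for n steps. It is then close to the iterate of q
by contraction, hence close to the leaf of the iterate of q', and this is pulled back. The first
error grows with n and the second decays. -/
theorem dist_leaves_le (hf : InvariantFamily H r f) (n : ℕ) (m : M) (q q' : X m × Y m)
    (x x' : X m) : dist (f m q x) (f m q' x') ≤ B * dist x x' + (1 - κ)⁻¹ * (
      (1 + B) * (cocycle u Λ n m * dist (iter H n m q) (iter H n m q')) +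
        2 * B * dist x q.1 * c ^ n) := by
  have hB := S.B_nonneg
  set p : X m × Y m := (x, f m q x) with hp
  have h1 := S.dist_leaf_le hf n m p q'
  have h2 := hf.iter_mem n (m := m) (p := p) (q := q) rfl
  have h3 := S.dist_iter_leaf_le hf n (m := m) (p := p) (q := q) rfl (hf.base m q)
  have h11 := S.cocycle_rate_le n m
  have h12 := cocycle_nonneg (u := u) S.Λ_nonneg n m
  set P := iter H n m p
  set Q := iter H n m q
  set Q' := iter H n m q'
  have h4 : dist P.2 (f (u^[n] m) Q' P.1) ≤ (1 + B) * dist Q Q' + 2 * B * dist P.1 Q.1 := by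
    have h5 := dist_triangle4 P.2 Q.2 Q'.2 (f (u^[n] m) Q' P.1)
    have h6 := hf.lip (u^[n] m) Q' Q'.1 P.1
    have h7 := hf.lip (u^[n] m) Q P.1 Q.1
    rw [← hf.base] at h6
    rw [← hf.base, ← h2] at h7
    have h8 : dist Q.2 Q'.2 ≤ dist Q Q' := le_max_right _ _
    have h9 : dist Q'.1 P.1 ≤ dist Q Q' + dist P.1 Q.1 := by
      have h10 := dist_triangle Q'.1 Q.1 P.1
      rw [dist_comm Q'.1 Q.1, dist_comm Q.1 P.1] at h10
      have : dist Q.1 Q'.1 ≤ dist Q Q' := le_max_left _ _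
      linarith
    have h10 := mul_le_mul (S.r_le (u^[n] m)) h9 dist_nonneg hB
    have h11 := mul_le_mul_of_nonneg_right (S.r_le (u^[n] m)) (dist_nonneg (x := P.1) (y := Q.1))
    linarith
  have h5 := S.one_sub_pos
  have h6 : dist (f m q x) (f m q' x) ≤ (1 - κ)⁻¹ * (
      (1 + B) * (cocycle u Λ n m * dist Q Q') + 2 * B * dist x q.1 * c ^ n) := by
    calc _ ≤ _ := h1
      _ ≤ (1 - κ)⁻¹ * (cocycle u Λ n m * ((1 + B) * dist Q Q' +
          2 * B * (cocycle u ls n m * dist x q.1))) := by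
        gcongr
        exact h4.trans (by gcongr)
      _ = (1 - κ)⁻¹ * ((1 + B) * (cocycle u Λ n m * dist Q Q') +
          2 * B * dist x q.1 * (cocycle u Λ n m * cocycle u ls n m)) := by ring
      _ ≤ _ := by gcongr
  have h7 := dist_triangle (f m q x) (f m q' x) (f m q' x')
  have h8 := hf.lip m q' x x'
  have h9 := mul_le_mul_of_nonneg_right (S.r_le m) (dist_nonneg (x := x) (y := x'))
  linarith

omit S [∀ m, CompleteSpace (X m)] in
theorem _root_.BundleFoliation.continuous_iter (hH : ∀ m, Continuous (H m)) (n : ℕ) :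
    ∀ m, Continuous (iter H n m) := by
  induction n with
  | zero => exact fun _ => continuous_id
  | succ n ih => exact fun m => (ih (u m)).comp (hH m)

/-- The decaying error in `dist_leaves_le` depends only on the fixed pair (q, x), so n can be chosen
first; the rest is continuous in the varying pair. -/
theorem continuous_family (hf : InvariantFamily H r f) (hH : ∀ m, Continuous (H m)) (m : M) :
    Continuous (fun z : (X m × Y m) × X m => f m z.1 z.2) := by
  rw [continuous_iff_continuousAt]
  rintro ⟨q, x⟩
  rw [ContinuousAt, tendsto_iff_dist_tendsto_zero]
  rw [Metric.tendsto_nhds]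
  intro η hη
  obtain ⟨n, hn⟩ := ((S.tendsto_mul_pow ((1 - κ)⁻¹ * (2 * B * dist x q.1))).eventually
    (gt_mem_nhds (half_pos hη))).exists
  have hcont : Continuous (fun z : (X m × Y m) × X m => B * dist x z.2 + (1 - κ)⁻¹ * (
      (1 + B) * (cocycle u Λ n m * dist (iter H n m q) (iter H n m z.1)))) := by
    have := continuous_iter hH n m
    fun_prop
  have h1 : ∀ᶠ z : (X m × Y m) × X m in 𝓝 (q, x), B * dist x z.2 + (1 - κ)⁻¹ * (
      (1 + B) * (cocycle u Λ n m * dist (iter H n m q) (iter H n m z.1))) < η / 2 :=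
    (hcont.tendsto (q, x)).eventually (gt_mem_nhds (by simpa using hη))
  filter_upwards [h1] with z hz
  have h2 := S.dist_leaves_le hf n m q z.1 x z.2
  rw [Real.dist_0_eq_abs, abs_of_nonneg dist_nonneg, dist_comm]
  calc _ ≤ _ := h2
    _ = (B * dist x z.2 + (1 - κ)⁻¹ * ((1 + B) *
        (cocycle u Λ n m * dist (iter H n m q) (iter H n m z.1)))) +
        (1 - κ)⁻¹ * (2 * B * dist x q.1) * c ^ n := by ring
    _ < η := by linarith

omit S [∀ m, CompleteSpace (X m)] in
theorem _root_.BundleFoliation.dist_iter_le_pow {K : ℝ≥0} (hK : ∀ m, LipschitzWith K (H m))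
    (n : ℕ) : ∀ m (p p' : X m × Y m), dist (iter H n m p) (iter H n m p') ≤ K ^ n * dist p p' := by
  induction n with
  | zero => intro m p p'; rw [pow_zero, one_mul]; exact le_rfl
  | succ n ih =>
    intro m p p'
    refine (ih (u m) (H m p) (H m p')).trans ?_
    rw [pow_succ, mul_assoc]
    gcongr
    exact (hK m).dist_le_mul p p'

theorem uniformLocallyHolder (hf : InvariantFamily H r f) (hH : UniformLipschitz H) :
    UniformLocallyHolder f := by
  obtain ⟨K, hK⟩ := hH
  have hB := S.B_nonneg
  have hκ := S.one_sub_pos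
  -- B bounds Λ and K bounds the expansion of `H`. The maximum with 1 lets R^n δ dominate the term
  -- that does not depend on n.
  obtain ⟨θ, K', hθ0, hθ1, hK'0, hK'⟩ := exists_rpow_bound (R := max 1 (B * K)) (c := c)
    (by positivity) S.c_nonneg S.c_lt
  refine ⟨θ, hθ0, hθ1, fun ρ hρ => ?_⟩
  set E := B + (1 - κ)⁻¹ * ((1 + B) + 2 * B * ρ) with hE
  have hE0 : 0 ≤ E := by positivity
  refine ⟨E * K' * (1 + ρ), ?_⟩
  rintro m ⟨q, x⟩ ⟨q', x'⟩ ⟨h1, h2, h3⟩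
  set δ := dist ((q, x) : (X m × Y m) × X m) (q', x') with hδ
  have hδ0 : 0 ≤ δ := dist_nonneg
  have hx : dist x x' ≤ δ := le_max_right _ _
  have hq : dist q q' ≤ δ := le_max_left _ _
  refine (hK' E δ (dist (f m q x) (f m q' x')) hE0 hδ0 fun n => ?_).trans (by gcongr)
  set R := max 1 (B * (K : ℝ)) with hR
  have hRn : 1 ≤ R ^ n := one_le_pow₀ (le_max_left _ _)
  have hcn : 0 ≤ c ^ n := pow_nonneg S.c_nonneg n
  have h4 : cocycle u Λ n m * dist (iter H n m q) (iter H n m q') ≤ R ^ n * δ := by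
    calc _ ≤ B ^ n * (K ^ n * δ) :=
          mul_le_mul (cocycle_le_pow S.Λ_nonneg S.Λ_le n m)
            ((dist_iter_le_pow hK n m q q').trans (by gcongr)) dist_nonneg (by positivity)
      _ = (B * K) ^ n * δ := by ring
      _ ≤ _ := by
        gcongr
        exact le_max_right _ _
  have h5 : dist x q.1 ≤ ρ := h1
  have h6 : dist x x' ≤ R ^ n * δ := hx.trans (le_mul_of_one_le_left hδ0 hRn)
  have h7 : 0 ≤ R ^ n * δ := by positivity
  calc _ ≤ _ := S.dist_leaves_le hf n m q q' x x'
    _ ≤ B * (R ^ n * δ + c ^ n) + (1 - κ)⁻¹ *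
        ((1 + B) * (R ^ n * δ + c ^ n) + 2 * B * ρ * (R ^ n * δ + c ^ n)) := by
      gcongr <;> linarith
    _ = _ := by ring

end GraphSystem

end Family

/-! ### From the hyperbolicity hypotheses to the normal form. -/

section Bridge

variable {M : Type*} {X : M → Type*} {Y : M → Type*} {u : M → M}
  [∀ m, MetricSpace (X m)] [∀ m, MetricSpace (Y m)]
  {H : ∀ m, X m × Y m → X (u m) × Y (u m)}
  {F : ∀ m, X m × Y (u m) → X (u m)} {G : ∀ m, X m × Y (u m) → Y m}
  {α lu β β' ls : M → ℝ≥0} {ϑ : M → ℝ} {f : ∀ m, X m × Y m → X m → Y m}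

omit [∀ m, MetricSpace (X m)] [∀ m, MetricSpace (Y m)] in
theorem HasGeneratingMap.apply (h : HasGeneratingMap H F G) (m : M) (x : X m) (y : Y (u m)) :
    H m (x, G m (x, y)) = (F m (x, y), y) :=
  (h m x _ _ y).2 ⟨rfl, rfl⟩

/-- Points over the same x lie in every cone |x - x'| ≤ α|y - y'|; the generating map parametrizes
them by the second coordinate of their images. -/
theorem CondA.condA' (h : CondA H α lu) (hH : HasGeneratingMap H F G) : CondA' F G α lu := by
  intro m x
  have key := fun y y' => h m (x, G m (x, y)) (x, G m (x, y')) (by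
    simpa using mul_nonneg (α m).2 dist_nonneg)
  simp only [hH.apply] at key
  exact ⟨LipschitzWith.of_dist_le_mul fun y y' => (key y y').1,
    LipschitzWith.of_dist_le_mul fun y y' => (key y y').2⟩

theorem Hyperbolic.exists_graphSystem (h : Hyperbolic H F G α lu β β' ls ϑ) :
    ∃ κ c B : ℝ, GraphSystem H F G (fun m => (α m : ℝ)) (fun m => (lu m : ℝ))
      (fun m => (β' m : ℝ)) (fun m => (ls m : ℝ)) (fun m => lu m * ϑ m) κ c B := by
  obtain ⟨κ₀, hκ₀, hκ⟩ := h.angle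
  obtain ⟨c₀, hc₀, hc⟩ := h.spectral
  obtain ⟨Bα, hBα⟩ := h.bdd_α
  obtain ⟨Bu, hBu⟩ := h.bdd_lu
  obtain ⟨Br, hBr⟩ := h.bdd_β'
  obtain ⟨Bs, hBs⟩ := h.bdd_ls
  set κ := max κ₀ 0 with hκdef
  have hκ1 : κ < 1 := max_lt hκ₀ one_pos
  have hang : ∀ m, (α m : ℝ) * β' (u m) ≤ κ := fun m => (hκ m).trans (le_max_left _ _)
  have hcond : CondA' F G α lu := h.condA.elim (fun h => h.1) fun h' => h'.1.condA' h.generating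
  have hpos : 0 < 1 - κ := sub_pos.2 hκ1
  have hϑ : ∀ m, 0 ≤ ϑ m ∧ ϑ m ≤ (1 - κ)⁻¹ := by
    rcases h.condA with ⟨-, h⟩ | ⟨-, -, h⟩
    · intro m
      have h1 := hang m
      rw [h]
      dsimp only
      exact ⟨inv_nonneg.2 (by linarith), by gcongr⟩
    · intro m
      rw [h]
      refine ⟨zero_le_one, ?_⟩
      rw [one_le_inv₀ hpos]
      linarith [le_max_right κ₀ 0]
  have hu : ∀ m, (lu m : ℝ) ≤ Bu := fun m => hBu ⟨m, rfl⟩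
  set B : ℝ := 1 + Bα + Bu + Br + Bs + Bu * (1 - κ)⁻¹ with hB
  have hP : 0 ≤ (Bu : ℝ) * (1 - κ)⁻¹ := by positivity
  have h0 := Bα.2
  have h1 := Bu.2
  have h2 := Br.2
  have h3 := Bs.2
  change (0 : ℝ) ≤ Bα at h0
  change (0 : ℝ) ≤ Bu at h1
  change (0 : ℝ) ≤ Br at h2
  change (0 : ℝ) ≤ Bs at h3
  refine ⟨κ, max c₀ 0, B,
    { generating := h.generating
      lip_F := fun m x y y' => (hcond m x).1.dist_le_mul y y'
      lip_G := fun m x y y' => (hcond m x).2.dist_le_mul y y'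
      -- Slope β'(u(m)) is at most β(m), so (B) applies and returns slope β'(m).
      cone := fun m z z' hz => h.condB m z z' (hz.trans (by
        gcongr
        exact h.angle_β m))
      expansion := ?_
      α_nonneg := fun m => (α m).2
      lu_nonneg := fun m => (lu m).2
      r_nonneg := fun m => (β' m).2
      ls_nonneg := fun m => (ls m).2
      Λ_nonneg := fun m => mul_nonneg (lu m).2 (hϑ m).1
      angle := hang
      κ_nonneg := le_max_right _ _
      κ_lt := hκ1
      rate := fun m => by
        refine le_trans (le_of_eq ?_) ((hc m).trans (le_max_left _ _))
        ring
      c_nonneg := le_max_right _ _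
      c_lt := max_lt hc₀ one_pos
      one_le := by linarith
      α_le := fun m => by
        have : (α m : ℝ) ≤ Bα := hBα ⟨m, rfl⟩
        linarith
      lu_le := fun m => by linarith [hu m]
      r_le := fun m => by
        have : (β' m : ℝ) ≤ Br := hBr ⟨m, rfl⟩
        linarith
      ls_le := fun m => by
        have : (ls m : ℝ) ≤ Bs := hBs ⟨m, rfl⟩
        linarith
      Λ_le := fun m => by
        have : (lu m : ℝ) * ϑ m ≤ Bu * (1 - κ)⁻¹ :=
          mul_le_mul (hu m) (hϑ m).2 (hϑ m).1 h1
        linarith }⟩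
  refine h.condA.imp ?_ ?_
  · rintro ⟨-, h⟩ m
    have h1 := hang m
    have h2 : 0 < 1 - (α m : ℝ) * β' (u m) := by linarith
    rw [h]
    dsimp only
    rw [mul_assoc, inv_mul_cancel₀ h2.ne', mul_one]
  · rintro ⟨h, h', h''⟩
    refine ⟨fun m z z' hz => ?_, fun m => h' m⟩
    rw [h'', mul_one]
    exact h m z z' hz

theorem isInvariantGraphFamily_iff :
    IsInvariantGraphFamily H β' (leaf f) ↔ InvariantFamily H (fun m => (β' m : ℝ)) f := by
  constructor
  · rintro ⟨h1, h2⟩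
    refine ⟨fun m q x x' => ?_, fun m q => (h1 m q).1, fun m q x => ?_⟩
    · obtain ⟨-, g, hg, hgq⟩ := h1 m q
      have : ∀ x, f m q x = g x := fun x => by
        have : (x, f m q x) ∈ leaf f m q := rfl
        rw [hgq] at this
        exact this
      rw [this, this]
      exact hg.dist_le_mul x x'
    · have : (x, f m q x) ∈ leaf f m q := rfl
      exact h2 m q (Set.mem_image_of_mem _ this)
  · intro h
    refine ⟨fun m q => ⟨h.base m q, f m q, LipschitzWith.of_dist_le_mul (h.lip m q), rfl⟩, ?_⟩
    rintro m q _ ⟨⟨x, y⟩, hp, rfl⟩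
    have hy : y = f m q x := hp
    rw [hy]
    exact h.inv m q x

theorem exists_leaf_eq {W : ∀ m, X m × Y m → Set (X m × Y m)}
    (hW : IsInvariantGraphFamily H β' W) : ∃ g : ∀ m, X m × Y m → X m → Y m, W = leaf g := by
  choose g hg using fun m q => (hW.1 m q).2
  exact ⟨g, funext fun m => funext fun q => (hg m q).2⟩

end Bridge

/-- Existence, uniqueness, characterization, continuity and Hölder regularity of the leaves. -/
theorem Hyperbolic.exists_foliation {M : Type*} {X : M → Type*} {Y : M → Type*} {u : M → M}
    [∀ m, MetricSpace (X m)] [∀ m, MetricSpace (Y m)]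
    [∀ m, CompleteSpace (X m)] [∀ m, CompleteSpace (Y m)]
    {H : ∀ m, X m × Y m → X (u m) × Y (u m)}
    {F : ∀ m, X m × Y (u m) → X (u m)} {G : ∀ m, X m × Y (u m) → Y m}
    {α lu β β' ls : M → ℝ≥0} {ϑ : M → ℝ} (h : Hyperbolic H F G α lu β β' ls ϑ) :
    ∃ f : ∀ m, X m × Y m → X m → Y m,
      IsInvariantGraphFamily H β' (leaf f) ∧
      (∀ W : ∀ m, X m × Y m → Set (X m × Y m), IsInvariantGraphFamily H β' W → W = leaf f) ∧
      (∀ (ς : ℝ) (ε : M → ℝ), 0 < ς → (∀ m, ls m + ς < ε m) →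
        SupLtOne (fun m => ε m * lu m * ϑ m) →
        ∀ (m : M) (q : X m × Y m), leaf f m q =
          {p | ∃ C : ℝ, ∀ n : ℕ, dist (iter H n m p) (iter H n m q) ≤ C * cocycle u ε n m}) ∧
      (∀ (m : M) (q₁ q₂ : X m × Y m), (leaf f m q₁ ∩ leaf f m q₂).Nonempty →
        q₁ ∈ leaf f m q₂ ∧ leaf f m q₁ = leaf f m q₂) ∧
      ((∀ m, Continuous (H m)) →
        ∀ m, Continuous (fun z : (X m × Y m) × X m => f m z.1 z.2)) ∧
      (UniformLipschitz H → UniformLocallyHolder f) := by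
  obtain ⟨κ, c, B, S⟩ := h.exists_graphSystem
  obtain ⟨f, hf⟩ := S.exists_invariantFamily
  refine ⟨f, isInvariantGraphFamily_iff.2 hf, fun W hW => ?_, fun ς ε hς hε hεΛ m q => ?_,
    fun m q₁ q₂ => ?_, S.continuous_family hf, S.uniformLocallyHolder hf⟩
  · obtain ⟨g, rfl⟩ := exists_leaf_eq hW
    rw [S.invariantFamily_unique hf (isInvariantGraphFamily_iff.1 hW)]
  · obtain ⟨c', hc', hεΛ⟩ := hεΛ
    refine S.leaf_eq_setOf hf (fun m => by linarith [hε m]) hc' (fun m => ?_) m q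
    refine le_trans (le_of_eq ?_) (hεΛ m)
    ring
  · rintro ⟨p, hp₁, hp₂⟩
    have h1 : f m q₁ = f m q₂ := (S.eq_of_mem_leaf hf hp₁).symm.trans (S.eq_of_mem_leaf hf hp₂)
    refine ⟨?_, by simp only [leaf, h1]⟩
    change q₁.2 = f m q₂ q₁.1
    rw [← h1]
    exact hf.base m q₁

open Asymptotics

/-! ### Tools from differential calculus. -/

section Calculus

variable {E X X' Y Y' : Type*} [NormedAddCommGroup E] [NormedSpace ℝ E]
  [NormedAddCommGroup X] [NormedSpace ℝ X] [NormedAddCommGroup X'] [NormedSpace ℝ X']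
  [NormedAddCommGroup Y] [NormedSpace ℝ Y] [NormedAddCommGroup Y'] [NormedSpace ℝ Y']

theorem hasFDerivAt_const_add_apply_sub (w₀ : E) (v : Y) (T : E →L[ℝ] Y) :
    HasFDerivAt (fun w => v + T (w - w₀)) T w₀ := by
  simpa using (T.hasFDerivAt.comp w₀ ((hasFDerivAt_id w₀).sub_const w₀)).const_add v

/-- Differentiability of the solution of the system `x' = F (ξ, y')`, `y' = h (w, x')`, whose
right-hand sides have Lipschitz constants with a product less than `1`. -/
theorem hasFDerivAt_of_implicit_system {ξ : E → X} {ξ' : E → X'} {η' : E → Y'} {h : E × X' → Y'}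
    {F : X × Y' → X'} {w₀ : E} {ξ₀ : E →L[ℝ] X} {A : E × X' →L[ℝ] Y'} {DF : X × Y' →L[ℝ] X'}
    {L : E →L[ℝ] Y'} {α β κ : ℝ} (hξ : HasFDerivAt ξ ξ₀ w₀) (hh : HasFDerivAt h A (w₀, ξ' w₀))
    (hF : HasFDerivAt F DF (ξ w₀, η' w₀)) (eqF : ∀ w, ξ' w = F (ξ w, η' w))
    (eqh : ∀ w, η' w = h (w, ξ' w)) (hβ : 0 ≤ β)
    (lipF : ∀ x y y', ‖F (x, y) - F (x, y')‖ ≤ α * ‖y - y'‖)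
    (liph : ∀ w x x', ‖h (w, x) - h (w, x')‖ ≤ β * ‖x - x'‖) (hκ : α * β ≤ κ) (hκ1 : κ < 1)
    (hL : L = A.comp ((ContinuousLinearMap.id ℝ E).prod (DF.comp (ξ₀.prod L)))) :
    HasFDerivAt η' L w₀ := by
  -- By `hL` these affine maps solve the linearized system, hence the system itself up to o(|w -
  -- w₀|). The contraction αβ ≤ κ < 1 bounds their distance to the true solution by these residuals.
  set η₁ : E → Y' := fun w => η' w₀ + L (w - w₀) with hη₁
  set ξ₁ : E → X' := fun w => ξ' w₀ + DF.comp (ξ₀.prod L) (w - w₀) with hξ₁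
  have hη₁0 : η₁ w₀ = η' w₀ := by simp [hη₁]
  have hξ₁0 : ξ₁ w₀ = ξ' w₀ := by
    simp only [hξ₁, sub_self, map_zero, add_zero]
  have dη₁ : HasFDerivAt η₁ L w₀ := hasFDerivAt_const_add_apply_sub _ _ _
  have dξ₁ : HasFDerivAt ξ₁ (DF.comp (ξ₀.prod L)) w₀ := hasFDerivAt_const_add_apply_sub _ _ _
  have h1 : HasFDerivAt (fun w => F (ξ w, η₁ w)) (DF.comp (ξ₀.prod L)) w₀ := by
    refine HasFDerivAt.comp w₀ (f := fun w => (ξ w, η₁ w)) (g := F) ?_ (hξ.prodMk dη₁)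
    rwa [hη₁0]
  have h2 : HasFDerivAt (fun w => h (w, ξ₁ w)) L w₀ := by
    rw [hL]
    refine HasFDerivAt.comp w₀ (f := fun w => (w, ξ₁ w)) (g := h) ?_ ((hasFDerivAt_id w₀).prodMk dξ₁)
    rwa [hξ₁0]
  have e1 : (fun w => F (ξ w, η₁ w) - ξ₁ w) =o[𝓝 w₀] fun w => w - w₀ := by
    have := (h1.sub dξ₁).isLittleO
    simpa [hη₁0, hξ₁0, ← eqF] using this
  have e2 : (fun w => h (w, ξ₁ w) - η₁ w) =o[𝓝 w₀] fun w => w - w₀ := by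
    have := (h2.sub dη₁).isLittleO
    simpa [hη₁0, hξ₁0, ← eqh] using this
  refine HasFDerivAt.of_isLittleO ?_
  refine IsBigO.trans_isLittleO (g := fun w => β * ‖F (ξ w, η₁ w) - ξ₁ w‖ + ‖h (w, ξ₁ w) - η₁ w‖)
    ?_ ((e1.norm_left.const_mul_left β).add e2.norm_left)
  refine IsBigO.of_bound (1 - κ)⁻¹ (Eventually.of_forall fun w => ?_)
  have hpos : 0 < 1 - κ := by linarith
  have h0 : 0 ≤ β * ‖F (ξ w, η₁ w) - ξ₁ w‖ + ‖h (w, ξ₁ w) - η₁ w‖ := by positivity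
  rw [Real.norm_of_nonneg h0, le_inv_mul_iff₀ hpos]
  have e3 : η' w - η' w₀ - L (w - w₀) = η' w - η₁ w := by
    simp only [hη₁]
    abel
  rw [e3]
  have h3 : ‖ξ' w - ξ₁ w‖ ≤ α * ‖η' w - η₁ w‖ + ‖F (ξ w, η₁ w) - ξ₁ w‖ := by
    have : ξ' w - ξ₁ w = (F (ξ w, η' w) - F (ξ w, η₁ w)) + (F (ξ w, η₁ w) - ξ₁ w) := by
      rw [eqF w]
      abel
    rw [this]
    exact (norm_add_le _ _).trans (add_le_add (lipF _ _ _) le_rfl)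
  have h4 : ‖η' w - η₁ w‖ ≤ β * ‖ξ' w - ξ₁ w‖ + ‖h (w, ξ₁ w) - η₁ w‖ := by
    have : η' w - η₁ w = (h (w, ξ' w) - h (w, ξ₁ w)) + (h (w, ξ₁ w) - η₁ w) := by
      rw [eqh w]
      abel
    rw [this]
    exact (norm_add_le _ _).trans (add_le_add (liph _ _ _) le_rfl)
  have h5 := mul_le_mul_of_nonneg_left h3 hβ
  have h6 := mul_le_mul_of_nonneg_right hκ (norm_nonneg (η' w - η₁ w))
  nlinarith

/-- A map with first order approximations, up to arbitrarily small errors, is differentiable. -/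
theorem exists_hasFDerivAt_of_approx [CompleteSpace Y] {φ : E → Y} {φn : ℕ → E → Y} {x : E}
    {Ln : ℕ → E →L[ℝ] Y} {ε : ℕ → ℝ} (hn : ∀ n, HasFDerivAt (φn n) (Ln n) x)
    (hx : ∀ n, φn n x = φ x) (hε : ∀ n, 0 ≤ ε n)
    (h : ∀ n, ∀ᶠ x' in 𝓝 x, ‖φ x' - φn n x'‖ ≤ ε n * ‖x' - x‖)
    (hε0 : Tendsto ε atTop (𝓝 0)) :
    ∃ L, HasFDerivAt φ L x ∧ ∀ n, ‖L - Ln n‖ ≤ ε n := by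
  -- Two approximations of the same map differ to first order by the sum of their errors, and so do
  -- their derivatives.
  have hcau : ∀ n k, ‖Ln n - Ln k‖ ≤ ε n + ε k := fun n k => by
    refine ((hn n).sub (hn k)).le_of_lip' (add_nonneg (hε n) (hε k)) ?_
    filter_upwards [h n, h k] with x' h1 h2
    have : (φn n - φn k) x' - (φn n - φn k) x = (φ x' - φn k x') - (φ x' - φn n x') := by
      simp [hx]
    rw [this, add_mul, add_comm]
    exact (norm_sub_le _ _).trans (add_le_add h2 h1)
  have hc : CauchySeq Ln := by
    rw [Metric.cauchySeq_iff']
    intro η hη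
    obtain ⟨N, hN⟩ := eventually_atTop.1 (hε0.eventually (gt_mem_nhds (half_pos hη)))
    refine ⟨N, fun n hnN => ?_⟩
    rw [dist_eq_norm]
    linarith [hcau n N, hN n hnN, hN N le_rfl]
  obtain ⟨L, hL⟩ := cauchySeq_tendsto_of_complete hc
  have hLn : ∀ n, ‖L - Ln n‖ ≤ ε n := fun n => by
    have h1 : Tendsto (fun k => ‖Ln k - Ln n‖) atTop (𝓝 ‖L - Ln n‖) := (hL.sub_const _).norm
    have h2 : Tendsto (fun k => ε k + ε n) atTop (𝓝 (0 + ε n)) := hε0.add_const _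
    rw [zero_add] at h2
    exact le_of_tendsto_of_tendsto' h1 h2 fun k => hcau k n
  refine ⟨L, HasFDerivAt.of_isLittleO (isLittleO_iff.2 fun η hη => ?_), hLn⟩
  obtain ⟨n, hnη⟩ := (hε0.eventually (gt_mem_nhds (by positivity : 0 < η / 3))).exists
  filter_upwards [h n, isLittleO_iff.1 (hn n).isLittleO (by positivity : 0 < η / 3)] with x' h1 h2
  have h3 : φ x' - φ x - L (x' - x) = (φ x' - φn n x') + (φn n x' - φn n x - Ln n (x' - x)) -
      (L - Ln n) (x' - x) := by
    rw [hx, sub_apply]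
    abel
  have h4 := (L - Ln n).le_of_opNorm_le (hLn n) (x' - x)
  rw [h3]
  calc _ ≤ ‖φ x' - φn n x'‖ + ‖φn n x' - φn n x - Ln n (x' - x)‖ + ‖(L - Ln n) (x' - x)‖ :=
        (norm_sub_le _ _).trans (add_le_add (norm_add_le _ _) le_rfl)
    _ ≤ ε n * ‖x' - x‖ + η / 3 * ‖x' - x‖ + ε n * ‖x' - x‖ := by gcongr
    _ = (ε n + η / 3 + ε n) * ‖x' - x‖ := by ring
    _ ≤ _ := by
      gcongr
      linarith

omit [NormedSpace ℝ E] in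
theorem continuous_of_geometric_approx {T : Type*} [TopologicalSpace T] {φ : T → E}
    {φn : ℕ → T → E} {g : T → ℝ} {c : ℝ} (hc0 : 0 ≤ c) (hc : c < 1) (hn : ∀ n, Continuous (φn n))
    (hg : Continuous g) (h : ∀ n t, ‖φ t - φn n t‖ ≤ g t * c ^ n) : Continuous φ := by
  refine (TendstoLocallyUniformly.continuous (F := φn) (p := atTop) ?_
    (Frequently.of_forall hn))
  rw [Metric.tendstoLocallyUniformly_iff]
  intro ε hε t
  refine ⟨{t' | g t' < |g t| + 1}, (hg.tendsto t).eventually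
    (gt_mem_nhds ((le_abs_self _).trans_lt (lt_add_one _))), ?_⟩
  have h0 : Tendsto (fun n : ℕ => (|g t| + 1) * c ^ n) atTop (𝓝 0) := by
    simpa using (tendsto_pow_atTop_nhds_zero_of_lt_one hc0 hc).const_mul (|g t| + 1)
  filter_upwards [h0.eventually (gt_mem_nhds hε)] with n hnε t' ht'
  rw [dist_eq_norm]
  refine (h n t').trans_lt (lt_of_le_of_lt ?_ hnε)
  have : g t' < |g t| + 1 := ht'
  have := pow_nonneg hc0 n
  gcongr

/-- Second differences of a map with a Hölder derivative. -/
theorem norm_second_difference_le {φ : E → Y} {C γ : ℝ} (hφ : Differentiable ℝ φ)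
    (h : ∀ z z', ‖fderiv ℝ φ z - fderiv ℝ φ z'‖ ≤ C * ‖z - z'‖ ^ γ) (z z' w w' : E) :
    ‖(φ (z + w) - φ (z' + w)) - (φ (z + w') - φ (z' + w'))‖ ≤ C * ‖z - z'‖ ^ γ * ‖w - w'‖ := by
  -- The mean value inequality is applied in w to the difference of two translates, whose derivative
  -- is small by the Hölder condition.
  have hd : ∀ w, HasFDerivAt (fun w => φ (z + w) - φ (z' + w))
      (fderiv ℝ φ (z + w) - fderiv ℝ φ (z' + w)) w := fun w => by
    have key : ∀ z : E, HasFDerivAt (fun w => φ (z + w)) (fderiv ℝ φ (z + w)) w := fun z => by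
      exact (hφ (z + w)).hasFDerivAt.comp w ((hasFDerivAt_id w).const_add z)
    exact (key z).sub (key z')
  have := convex_univ.norm_image_sub_le_of_norm_hasFDerivWithin_le
    (fun w _ => (hd w).hasFDerivWithinAt) (C := C * ‖z - z'‖ ^ γ) (fun w _ => by
      have := h (z + w) (z' + w)
      rwa [add_sub_add_right_eq_sub] at this) (Set.mem_univ w') (Set.mem_univ w)
  exact this

section Resolvent

variable [CompleteSpace Y] {A A' : Y →L[ℝ] Y} {κ : ℝ}

/-- The inverse of `1 - A`. -/
noncomputable def resolvent₁ (A : Y →L[ℝ] Y) : Y →L[ℝ] Y := Ring.inverse (1 - A)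

theorem isUnit_one_sub (hA : ‖A‖ ≤ κ) (hκ : κ < 1) : IsUnit (1 - A) :=
  isUnit_one_sub_of_norm_lt_one (hA.trans_lt hκ)

theorem resolvent₁_eq (hA : ‖A‖ ≤ κ) (hκ : κ < 1) (y : Y) :
    resolvent₁ A y = y + A (resolvent₁ A y) := by
  have h := Ring.mul_inverse_cancel _ (isUnit_one_sub hA hκ)
  have h1 := congrArg (fun T : Y →L[ℝ] Y => T y) h
  simp only [sub_mul, one_mul, sub_apply,
    one_apply_eq_self] at h1
  exact sub_eq_iff_eq_add.1 h1

theorem norm_resolvent₁_le (hA : ‖A‖ ≤ κ) (hκ : κ < 1) : ‖resolvent₁ A‖ ≤ (1 - κ)⁻¹ := by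
  have hpos : 0 < 1 - κ := by linarith
  refine ContinuousLinearMap.opNorm_le_bound _ (by positivity) fun y => ?_
  rw [le_inv_mul_iff₀ hpos]
  have h1 : ‖resolvent₁ A y‖ ≤ ‖y‖ + ‖A (resolvent₁ A y)‖ := by
    nth_rewrite 1 [resolvent₁_eq hA hκ y]
    exact norm_add_le _ _
  have h2 := A.le_of_opNorm_le hA (resolvent₁ A y)
  linarith

theorem norm_resolvent₁_sub_le (hA : ‖A‖ ≤ κ) (hA' : ‖A'‖ ≤ κ) (hκ : κ < 1) :
    ‖resolvent₁ A - resolvent₁ A'‖ ≤ (1 - κ)⁻¹ * (1 - κ)⁻¹ * ‖A - A'‖ := by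
  have hpos : 0 < 1 - κ := by linarith
  -- The resolvent identity.
  have h1 : resolvent₁ A - resolvent₁ A' = resolvent₁ A * (A - A') * resolvent₁ A' := by
    have e1 := Ring.inverse_mul_cancel _ (isUnit_one_sub hA hκ)
    have e2 := Ring.mul_inverse_cancel _ (isUnit_one_sub hA' hκ)
    have e3 : A - A' = (1 - A') - (1 - A) := by abel
    rw [e3, mul_sub, sub_mul, mul_assoc]
    simp only [resolvent₁]
    rw [e1, e2, mul_one, one_mul]
  rw [h1]
  calc _ ≤ ‖resolvent₁ A‖ * ‖A - A'‖ * ‖resolvent₁ A'‖ :=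
        (norm_mul_le _ _).trans (mul_le_mul_of_nonneg_right (norm_mul_le _ _) (norm_nonneg _))
    _ ≤ (1 - κ)⁻¹ * ‖A - A'‖ * (1 - κ)⁻¹ := by
      gcongr
      exacts [norm_resolvent₁_le hA hκ, norm_resolvent₁_le hA' hκ]
    _ = _ := by ring

theorem continuous_resolvent₁ {T : Type*} [TopologicalSpace T] {A : T → Y →L[ℝ] Y}
    (hA : Continuous A) (hκA : ∀ t, ‖A t‖ ≤ κ) (hκ : κ < 1) :
    Continuous fun t => resolvent₁ (A t) := by
  rw [continuous_iff_continuousAt]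
  intro t
  obtain ⟨v, hv⟩ := isUnit_one_sub (hκA t) hκ
  have h1 : ContinuousAt Ring.inverse (1 - A t) := by
    rw [← hv]
    exact NormedRing.inverse_continuousAt v
  have h2 : ContinuousAt (fun t => 1 - A t) t := (continuous_const.sub hA).continuousAt
  exact ContinuousAt.comp (g := Ring.inverse) (f := fun t => 1 - A t) h1 h2

end Resolvent

/-- The derivative of a map with a Lipschitz right inverse is bijective. -/
theorem bijective_fderiv_of_lipschitz_inverse [CompleteSpace E] {φ : E → Y} {ψ : Y → E} {K : ℝ}
    {T : E →L[ℝ] Y} {z : E} (hφ : HasFDerivAt φ T z) (h1 : ∀ y, φ (ψ y) = y)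
    (h2 : ∀ x, ψ (φ x) = x) (hψ : ∀ y y', ‖ψ y - ψ y'‖ ≤ K * ‖y - y'‖) (hK : 0 < K) :
    Function.Bijective T := by
  -- The Lipschitz bound for ψ bounds difference quotients of φ from below. In the limit `T` is
  -- bounded below, hence injective with closed range.
  have hlow : ∀ v, ‖v‖ ≤ K * ‖T v‖ := by
    intro v
    refine le_of_forall_pos_le_add fun ε hε => ?_
    have hlim : Tendsto (fun t : ℝ => ‖t⁻¹ • (φ (z + t • v) - φ z)‖) (𝓝[≠] 0) (𝓝 ‖T v‖) := by
      have : HasDerivAt (fun t : ℝ => φ (z + t • v)) (T v) 0 := by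
        have h3 : HasDerivAt (fun t : ℝ => z + t • v) v 0 := by
          simpa using ((hasDerivAt_id (0 : ℝ)).smul_const v).const_add z
        refine HasFDerivAt.comp_hasDerivAt (x := (0 : ℝ)) (l := φ) (f := fun t : ℝ => z + t • v) ?_ h3
        simpa using hφ
      have := this.tendsto_slope.norm
      refine this.congr fun t => ?_
      simp [slope]
    have hev : ∀ᶠ t : ℝ in 𝓝[≠] 0, ‖v‖ ≤ K * ‖t⁻¹ • (φ (z + t • v) - φ z)‖ := by
      filter_upwards [self_mem_nhdsWithin] with t ht
      have ht' : t ≠ 0 := ht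
      have h3 := hψ (φ (z + t • v)) (φ z)
      rw [h2, h2, add_sub_cancel_left, norm_smul] at h3
      rw [norm_smul, norm_inv]
      have h4 : 0 < ‖t‖ := norm_pos_iff.2 ht'
      rw [← mul_assoc, mul_comm K, mul_assoc, le_inv_mul_iff₀ h4]
      exact h3
    have := ge_of_tendsto (hlim.const_mul K) hev
    linarith
  have hanti : AntilipschitzWith K.toNNReal T :=
    AddMonoidHomClass.antilipschitz_of_bound T fun v => by
      rw [Real.coe_toNNReal _ hK.le]
      exact hlow v
  refine ⟨hanti.injective, ?_⟩
  have hcl : IsClosed (Set.range T) := hanti.isClosed_range T.uniformContinuous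
  rw [← Set.range_eq_univ, Set.eq_univ_iff_forall]
  intro w
  rw [← hcl.closure_eq, Metric.mem_closure_iff]
  intro ε hε
  -- It remains to see that the range is dense. The preimage increment ψ(φ(z) + tw) - z has norm at
  -- most K|t|‖w‖, and `T` maps it to tw up to this η times its norm; dividing by t leaves an error
  -- below ε.
  have hη : 0 < ε / (2 * K * (‖w‖ + 1)) := by positivity
  have hev := (isLittleO_iff.1 hφ.isLittleO hη)
  have hlim : Tendsto (fun t : ℝ => ψ (φ z + t • w)) (𝓝 0) (𝓝 z) := by
    rw [tendsto_iff_norm_sub_tendsto_zero]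
    refine squeeze_zero (fun _ => norm_nonneg _) (g := fun t : ℝ => K * ‖t • w‖) (fun t => ?_) ?_
    · have := hψ (φ z + t • w) (φ z)
      rwa [h2, add_sub_cancel_left] at this
    · have : Continuous fun t : ℝ => K * ‖t • w‖ := by fun_prop
      simpa using this.tendsto 0
  have hev2 := (hlim.eventually hev).filter_mono (nhdsWithin_le_nhds (s := {(0 : ℝ)}ᶜ))
  obtain ⟨t, ht, ht0⟩ := (hev2.and self_mem_nhdsWithin).exists
  have ht' : t ≠ 0 := ht0
  have h4 : 0 < ‖t‖ := norm_pos_iff.2 ht'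
  refine ⟨T (t⁻¹ • (ψ (φ z + t • w) - z)), Set.mem_range_self _, ?_⟩
  rw [h1, add_sub_cancel_left] at ht
  have h5 := hψ (φ z + t • w) (φ z)
  rw [h2, add_sub_cancel_left, norm_smul] at h5
  have h6 : w - T (t⁻¹ • (ψ (φ z + t • w) - z)) = t⁻¹ • (t • w - T (ψ (φ z + t • w) - z)) := by
    rw [map_smul, smul_sub, inv_smul_smul₀ ht']
  rw [dist_eq_norm, h6, norm_smul, norm_inv, inv_mul_lt_iff₀ h4]
  calc _ ≤ _ := ht
    _ ≤ ε / (2 * K * (‖w‖ + 1)) * (K * (‖t‖ * ‖w‖)) := by gcongr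
    _ = ‖t‖ * ε * (‖w‖ / (2 * (‖w‖ + 1))) := by field_simp
    _ < ‖t‖ * ε * 1 := by
      gcongr
      rw [div_lt_one (by positivity)]
      linarith [norm_nonneg w]
    _ = _ := mul_one _

end Calculus

/-! ### Approximation of families indexed by a bundle of parameters. -/

section PulledBack

variable {M : Type*} {X : M → Type*} {Y : M → Type*} {u : M → M}
  [∀ m, MetricSpace (X m)] [∀ m, MetricSpace (Y m)]
  {H : ∀ m, X m × Y m → X (u m) × Y (u m)}
  {F : ∀ m, X m × Y (u m) → X (u m)} {G : ∀ m, X m × Y (u m) → Y m}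
  {α lu r ls Λ : M → ℝ} {κ c B : ℝ} {D : M → Type*}

/-- The map of the total space of a bundle of parameters. -/
def totalMap (v : ∀ m, D m → D (u m)) (i : Σ m, D m) : Σ m, D m := ⟨u i.1, v i.1 i.2⟩

namespace GraphSystem

variable (S : GraphSystem H F G α lu r ls Λ κ c B) [∀ m, CompleteSpace (X m)]
  (v : ∀ m, D m → D (u m)) (o : ∀ m, D m → X m × Y m)
  (ho : ∀ m d, H m (o m d) = o (u m) (v m d)) {f g : ∀ m, D m → X m → Y m}
  (hf : ∀ m d x x', dist (f m d x) (f m d x') ≤ r m * dist x x')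
  (hg : ∀ m d x x', dist (g m d x) (g m d x') ≤ r m * dist x x')
  (hfo : ∀ m d, (o m d).2 = f m d (o m d).1)
  (hfi : ∀ m d x, (H m (x, f m d x)).2 = f (u m) (v m d) (H m (x, f m d x)).1)
include S ho hf hg hfo hfi

/-- The iterated graph transforms of a family `g` approximate the invariant family `f` through
the base points. -/
theorem exists_approximants {e : (Σ m, D m) → ℝ} (he0 : ∀ i, 0 ≤ e i)
    (he : ∀ m d x, dist (g m d x) (f m d x) ≤ e ⟨m, d⟩ * dist x (o m d).1) :
    ∃ φ : ℕ → ∀ m, D m → X m → Y m, φ 0 = g ∧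
      (∀ n m d x x', dist (φ n m d x) (φ n m d x') ≤ r m * dist x x') ∧
      (∀ n m d x, (H m (x, φ (n + 1) m d x)).2 = φ n (u m) (v m d) (H m (x, φ (n + 1) m d x)).1) ∧
      ∀ n m d x, dist (φ n m d x) (f m d x) ≤ (1 - κ)⁻¹ * (cocycle u Λ n m * cocycle u ls n m *
        e ((totalMap v)^[n] ⟨m, d⟩) * dist x (o m d).1) := by
  have S' := S.pullback v
  have : ∀ i : Σ m, D m, Nonempty (Y i.1) := fun i => ⟨(o i.1 i.2).2⟩
  have h1 : LipSection (M := Σ m, D m) (X := fun i => X i.1) (Y := fun i => Y i.1)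
    (fun i => r i.1) (fun i => f i.1 i.2) := fun i => hf i.1 i.2
  have h2 : LipSection (M := Σ m, D m) (X := fun i => X i.1) (Y := fun i => Y i.1)
    (fun i => r i.1) (fun i => g i.1 i.2) := fun i => hg i.1 i.2
  have h3 := S'.transform_eq_self h1 fun i => hfi i.1 i.2
  refine ⟨fun n m d => (transform (M := Σ m, D m) (u := fun i => ⟨u i.1, v i.1 i.2⟩)
    (X := fun i => X i.1) (Y := fun i => Y i.1) (fun i => H i.1))^[n] (fun i => g i.1 i.2) ⟨m, d⟩,
    rfl, fun n m d => S'.lipSection_iterate h2 n ⟨m, d⟩, fun n m d x =>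
      S'.iterate_spec h2 n (m := ⟨m, d⟩) (p := (x, _)) rfl, fun n m d x => ?_⟩
  have h4 := S'.dist_iterate_iterate_le (o := fun i => o i.1 i.2) (fun i => ho i.1 i.2) h2 h1
    (fun i => hfo i.1 i.2) (e := e) (fun i => he i.1 i.2) he0 n ⟨m, d⟩ x
  rw [Function.iterate_fixed h3, cocycle_pullback, cocycle_pullback] at h4
  exact h4

/-- A family which is close to its transform is close to the invariant family. -/
theorem dist_family_le (hgo : ∀ m d, (o m d).2 = g m d (o m d).1) {e : (Σ m, D m) → ℝ}
    (he0 : ∀ i, 0 ≤ e i)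
    (he : ∀ m d x y, (H m (x, y)).2 = g (u m) (v m d) (H m (x, y)).1 →
      dist (g m d x) y ≤ e ⟨m, d⟩ * dist x (o m d).1) (n : ℕ) (m : M) (d : D m) (x : X m) :
    dist (g m d x) (f m d x) ≤ (1 - κ)⁻¹ * (∑ k ∈ Finset.range n,
      cocycle u Λ k m * cocycle u ls k m * e ((totalMap v)^[k] ⟨m, d⟩) + 2 * B * c ^ n) *
        dist x (o m d).1 := by
  have S' := S.pullback v
  have : ∀ i : Σ m, D m, Nonempty (Y i.1) := fun i => ⟨(o i.1 i.2).2⟩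
  have h1 : LipSection (M := Σ m, D m) (X := fun i => X i.1) (Y := fun i => Y i.1)
    (fun i => r i.1) (fun i => f i.1 i.2) := fun i => hf i.1 i.2
  have h2 : LipSection (M := Σ m, D m) (X := fun i => X i.1) (Y := fun i => Y i.1)
    (fun i => r i.1) (fun i => g i.1 i.2) := fun i => hg i.1 i.2
  have h3 := S'.transform_eq_self h1 fun i => hfi i.1 i.2
  have h4 := S'.dist_invariant_le (o := fun i => o i.1 i.2) (fun i => ho i.1 i.2) h2
    (fun i => hgo i.1 i.2) h1 (fun i => hfo i.1 i.2) h3 (e := e)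
    (fun i x => he i.1 i.2 x _ (S'.transform_spec h2 i x)) he0 n ⟨m, d⟩ x
  simp only [cocycle_pullback] at h4
  exact h4

end GraphSystem

end PulledBack

/-! ### Differentiability of the leaves at their base points. -/

section Slopes

variable {M : Type*} {X : M → Type*} {Y : M → Type*} {u : M → M}
  [∀ m, NormedAddCommGroup (X m)] [∀ m, NormedSpace ℝ (X m)]
  [∀ m, NormedAddCommGroup (Y m)] [∀ m, NormedSpace ℝ (Y m)]

section Defs

variable (H : ∀ m, X m × Y m → X (u m) × Y (u m))
  (F : ∀ m, X m × Y (u m) → X (u m)) (G : ∀ m, X m × Y (u m) → Y m) (m : M) (p : X m × Y m)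

/-- The derivative of `F_m` in the first variable, at the point that belongs to `p`. -/
noncomputable def dF₁ : X m →L[ℝ] X (u m) :=
  (fderiv ℝ (F m) (p.1, (H m p).2)).comp (ContinuousLinearMap.inl ℝ _ _)

/-- The derivative of `F_m` in the second variable, at the point that belongs to `p`. -/
noncomputable def dF₂ : Y (u m) →L[ℝ] X (u m) :=
  (fderiv ℝ (F m) (p.1, (H m p).2)).comp (ContinuousLinearMap.inr ℝ _ _)

/-- The derivative of `G_m` in the first variable, at the point that belongs to `p`. -/
noncomputable def dG₁ : X m →L[ℝ] Y m :=
  (fderiv ℝ (G m) (p.1, (H m p).2)).comp (ContinuousLinearMap.inl ℝ _ _)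

/-- The derivative of `G_m` in the second variable, at the point that belongs to `p`. -/
noncomputable def dG₂ : Y (u m) →L[ℝ] Y m :=
  (fderiv ℝ (G m) (p.1, (H m p).2)).comp (ContinuousLinearMap.inr ℝ _ _)

/-- The linear map by which perturbations of a graph with slope `K` are pulled back. -/
noncomputable def transverse (K : X (u m) →L[ℝ] Y (u m)) : Y (u m) →L[ℝ] Y m :=
  (dG₂ H G m p).comp (resolvent₁ (K.comp (dF₂ H F m p)))

/-- The slope at `p` of the transform of a graph with slope `K` at `H_m(p)`. -/
noncomputable def slopeStep (K : X (u m) →L[ℝ] Y (u m)) : X m →L[ℝ] Y m :=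
  dG₁ H G m p + (transverse H F G m p K).comp (K.comp (dF₁ H F m p))

/-- The slope at `p` of the `n`-th transform of the horizontal graph. -/
noncomputable def slope : ℕ → ∀ m : M, X m × Y m → (X m →L[ℝ] Y m)
  | 0, _, _ => 0
  | n + 1, m, p => slopeStep H F G m p (slope n (u m) (H m p))

end Defs

variable {H : ∀ m, X m × Y m → X (u m) × Y (u m)}
  {F : ∀ m, X m × Y (u m) → X (u m)} {G : ∀ m, X m × Y (u m) → Y m}
  {α lu r ls Λ : M → ℝ} {κ c B : ℝ} {f : ∀ m, X m × Y m → X m → Y m}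

namespace GraphSystem

variable (S : GraphSystem H F G α lu r ls Λ κ c B) (hF : ∀ m, ContDiff ℝ 1 (F m))
  (hG : ∀ m, ContDiff ℝ 1 (G m))

include S hF in
theorem norm_dF₂_le (m : M) (p : X m × Y m) : ‖dF₂ H F m p‖ ≤ α m := by
  have h : HasFDerivAt (fun y => F m (p.1, y)) (dF₂ H F m p) (H m p).2 :=
    (((hF m).differentiable one_ne_zero) (p.1, (H m p).2)).hasFDerivAt.comp _
      (hasFDerivAt_prodMk_right p.1 (H m p).2)
  refine h.le_of_lip' (S.α_nonneg m) (Eventually.of_forall fun y => ?_)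
  simpa [dist_eq_norm] using S.lip_F m p.1 y (H m p).2

include S hG in
theorem norm_dG₂_le (m : M) (p : X m × Y m) : ‖dG₂ H G m p‖ ≤ lu m := by
  have h : HasFDerivAt (fun y => G m (p.1, y)) (dG₂ H G m p) (H m p).2 :=
    (((hG m).differentiable one_ne_zero) (p.1, (H m p).2)).hasFDerivAt.comp _
      (hasFDerivAt_prodMk_right p.1 (H m p).2)
  refine h.le_of_lip' (S.lu_nonneg m) (Eventually.of_forall fun y => ?_)
  simpa [dist_eq_norm] using S.lip_G m p.1 y (H m p).2

include S hF in
theorem norm_comp_dF₂_le {m : M} (p : X m × Y m) {K : X (u m) →L[ℝ] Y (u m)}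
    (hK : ‖K‖ ≤ r (u m)) : ‖K.comp (dF₂ H F m p)‖ ≤ κ := by
  refine (K.opNorm_comp_le _).trans ?_
  refine le_trans ?_ (S.angle m)
  rw [mul_comm]
  exact mul_le_mul (S.norm_dF₂_le hF m p) hK (norm_nonneg _) (S.α_nonneg m)

variable [∀ m, CompleteSpace (Y m)]

include S hF hG

/-- One step of the graph transform with parameters is differentiable. -/
theorem hasFDerivAt_transform {E : Type*} [NormedAddCommGroup E] [NormedSpace ℝ E] {m : M}
    {ξ : E → X m} {y : E → Y m} {h : E × X (u m) → Y (u m)} {w₀ : E} {ξ₀ : E →L[ℝ] X m}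
    {A : E →L[ℝ] Y (u m)} {K : X (u m) →L[ℝ] Y (u m)} {p : X m × Y m}
    (hp : p = (ξ w₀, y w₀)) (hξ : HasFDerivAt ξ ξ₀ w₀)
    (hh : HasFDerivAt h (A.coprod K) (w₀, (H m p).1))
    (hlip : ∀ w x x', dist (h (w, x)) (h (w, x')) ≤ r (u m) * dist x x')
    (hy : ∀ w, (H m (ξ w, y w)).2 = h (w, (H m (ξ w, y w)).1)) :
    HasFDerivAt y ((dG₁ H G m p).comp ξ₀ +
      (transverse H F G m p K).comp (A + (K.comp (dF₁ H F m p)).comp ξ₀)) w₀ := by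
  subst hp
  -- The Lipschitz bound for h in x controls its partial derivative, which makes 1 - K ∘ dF₂
  -- invertible.
  have hK : ‖K‖ ≤ r (u m) := by
    have h1 : HasFDerivAt (fun x => h (w₀, x)) K (H m (ξ w₀, y w₀)).1 := by
      refine (hh.comp _ (hasFDerivAt_prodMk_right w₀ (H m (ξ w₀, y w₀)).1)).congr_fderiv ?_
      ext
      simp
    refine h1.le_of_lip' (S.r_nonneg _) (Eventually.of_forall fun x => ?_)
    simpa [dist_eq_norm] using hlip w₀ x _
  have hres := resolvent₁_eq (S.norm_comp_dF₂_le hF (ξ w₀, y w₀) hK) S.κ_lt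
  set p : X m × Y m := (ξ w₀, y w₀) with hp
  -- The solution of the linearized equation L = A + K(dF₁ ξ₀ + dF₂ L) for the second coordinate of
  -- the image.
  set L : E →L[ℝ] Y (u m) :=
    (resolvent₁ (K.comp (dF₂ H F m p))).comp (A + (K.comp (dF₁ H F m p)).comp ξ₀) with hL
  have split : ∀ (a : X m) (b : Y (u m)), fderiv ℝ (F m) (p.1, (H m p).2) (a, b) =
      dF₁ H F m p a + dF₂ H F m p b := fun a b => by
    simp [dF₁, dF₂, ← map_add]
  have splitG : ∀ (a : X m) (b : Y (u m)), fderiv ℝ (G m) (p.1, (H m p).2) (a, b) =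
      dG₁ H G m p a + dG₂ H G m p b := fun a b => by
    simp [dG₁, dG₂, ← map_add]
  have hη : HasFDerivAt (fun w => (H m (ξ w, y w)).2) L w₀ := by
    refine hasFDerivAt_of_implicit_system (ξ' := fun w => (H m (ξ w, y w)).1) (α := α m)
      (β := r (u m)) (κ := κ) hξ hh
      (((hF m).differentiable one_ne_zero) (p.1, (H m p).2)).hasFDerivAt
      (fun w => S.eq_F m (ξ w, y w)) hy (S.r_nonneg _)
      (fun x y y' => by simpa [dist_eq_norm] using S.lip_F m x y y')
      (fun w x x' => by simpa [dist_eq_norm] using hlip w x x') (S.angle m) S.κ_lt ?_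
    ext w
    have := hres (A w + K (dF₁ H F m p (ξ₀ w)))
    simp only [hL, ContinuousLinearMap.comp_apply, ContinuousLinearMap.prod_apply,
      ContinuousLinearMap.coprod_apply, ContinuousLinearMap.id_apply, add_apply, split,
      map_add] at this ⊢
    rw [this]
    abel
  have hy' : y = fun w => G m (ξ w, (H m (ξ w, y w)).2) := funext fun w => S.eq_G m (ξ w, y w)
  rw [hy']
  have hGd : HasFDerivAt (G m) (fderiv ℝ (G m) (p.1, (H m p).2)) (ξ w₀, (H m p).2) :=
    (((hG m).differentiable one_ne_zero) (p.1, (H m p).2)).hasFDerivAt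
  have := hGd.comp (f := fun w => (ξ w, (H m (ξ w, y w)).2)) w₀ (hξ.prodMk hη)
  refine HasFDerivAt.congr_fderiv (f := fun w => G m (ξ w, (H m (ξ w, y w)).2)) this ?_
  ext w
  simp [splitG, transverse, hL]

variable [∀ m, CompleteSpace (X m)]

/-- The leaves are differentiable at their base points, and the slopes are uniformly approximated
by those of the transforms of the horizontal graphs. -/
theorem hasFDerivAt_leaf_base (hf : InvariantFamily H r f) (m : M) (p : X m × Y m) :
    HasFDerivAt (f m p) (fderiv ℝ (f m p) p.1) p.1 ∧
      ∀ n, ‖fderiv ℝ (f m p) p.1 - slope H F G n m p‖ ≤ (1 - κ)⁻¹ * B * c ^ n ∧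
        ‖slope H F G n m p‖ ≤ r m := by
  have hκ := S.one_sub_pos
  have hB := S.B_nonneg
  -- Horizontal graphs differ from the leaves by at most B|x - q_X|. Their n-th transforms are
  -- therefore first order approximations with error O(c^n), and one-step differentiability computes
  -- their slopes.
  obtain ⟨φ, h0, hlip, hinv, happ⟩ := S.exists_approximants (D := fun m => X m × Y m) H
    (fun _ q => q) (fun _ _ => rfl) (f := f) (g := fun m q _ => q.2) hf.lip
    (fun m q x x' => by simpa using mul_nonneg (S.r_nonneg m) dist_nonneg) hf.base hf.inv
    (e := fun _ => B) (fun _ => hB) (fun m q x => by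
      rw [dist_comm, hf.base m q, ← hf.base m q]
      have h1 := hf.lip m q x q.1
      rw [← hf.base] at h1
      exact h1.trans (mul_le_mul_of_nonneg_right (S.r_le m) dist_nonneg))
  have happ' : ∀ n m q x, dist (φ n m q x) (f m q x) ≤ (1 - κ)⁻¹ * B * c ^ n * dist x q.1 :=
    fun n m q x => by
    refine (happ n m q x).trans ?_
    have := S.cocycle_rate_le n m
    calc _ ≤ (1 - κ)⁻¹ * (c ^ n * B * dist x q.1) := by gcongr
      _ = _ := by ring
  have hbase : ∀ n m q, φ n m q q.1 = f m q q.1 := fun n m q => by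
    have := happ' n m q q.1
    rw [dist_self, mul_zero] at this
    exact dist_le_zero.1 this
  have hd : ∀ n m (p : X m × Y m), HasFDerivAt (φ n m p) (slope H F G n m p) p.1 := by
    intro n
    induction n with
    | zero =>
      intro m p
      rw [h0]
      exact hasFDerivAt_const _ _
    | succ n ih =>
      intro m p
      have h1 := S.hasFDerivAt_transform hF hG (E := X m) (ξ := fun x => x) (y := φ (n + 1) m p)
        (h := fun z => φ n (u m) (H m p) z.2) (w₀ := p.1) (A := 0)
        (K := slope H F G n (u m) (H m p)) (p := p) (by rw [hbase, ← hf.base])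
        (hasFDerivAt_id _) (by
          refine HasFDerivAt.congr_fderiv ((ih (u m) (H m p)).comp (p.1, (H m p).1)
            hasFDerivAt_snd) ?_
          ext <;> simp) (fun w => hlip n (u m) (H m p)) (hinv n m p)
      refine h1.congr_fderiv ?_
      ext
      simp [slope, slopeStep]
  obtain ⟨L, hL, hLn⟩ := exists_hasFDerivAt_of_approx (φ := f m p) (fun n => hd n m p)
    (fun n => hbase n m p) (ε := fun n => (1 - κ)⁻¹ * B * c ^ n)
    (fun n => by have := pow_nonneg S.c_nonneg n; positivity)
    (fun n => Eventually.of_forall fun x => by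
      have := happ' n m p x
      rwa [dist_comm, dist_eq_norm, dist_eq_norm] at this)
    (S.tendsto_mul_pow _)
  rw [hL.fderiv]
  refine ⟨hL, fun n => ⟨hLn n, (hd n m p).le_of_lip' (S.r_nonneg m)
    (Eventually.of_forall fun x => ?_)⟩⟩
  simpa [dist_eq_norm] using hlip n m p x p.1

end GraphSystem

end Slopes

/-! ### Smooth leaves and Hölder tangent spaces. -/

section Regularity

variable {M : Type*} {X : M → Type*} {Y : M → Type*} {u : M → M}
  [∀ m, NormedAddCommGroup (X m)] [∀ m, NormedSpace ℝ (X m)]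
  [∀ m, NormedAddCommGroup (Y m)] [∀ m, NormedSpace ℝ (Y m)]
  {H : ∀ m, X m × Y m → X (u m) × Y (u m)}
  {F : ∀ m, X m × Y (u m) → X (u m)} {G : ∀ m, X m × Y (u m) → Y m}
  {α lu r ls Λ : M → ℝ} {κ c B : ℝ} {f : ∀ m, X m × Y m → X m → Y m}

section ContinuousSteps

variable {T : Type*} [TopologicalSpace T] {m : M} {φ : T → X m × Y m}

theorem continuous_dF₁ (hF : ContDiff ℝ 1 (F m)) (h0 : Continuous φ)
    (h1 : Continuous fun t => H m (φ t)) : Continuous fun t => dF₁ H F m (φ t) :=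
  ((hF.continuous_fderiv one_ne_zero).comp (h0.fst.prodMk h1.snd)).clm_comp continuous_const

theorem continuous_dF₂ (hF : ContDiff ℝ 1 (F m)) (h0 : Continuous φ)
    (h1 : Continuous fun t => H m (φ t)) : Continuous fun t => dF₂ H F m (φ t) :=
  ((hF.continuous_fderiv one_ne_zero).comp (h0.fst.prodMk h1.snd)).clm_comp continuous_const

theorem continuous_dG₁ (hG : ContDiff ℝ 1 (G m)) (h0 : Continuous φ)
    (h1 : Continuous fun t => H m (φ t)) : Continuous fun t => dG₁ H G m (φ t) :=
  ((hG.continuous_fderiv one_ne_zero).comp (h0.fst.prodMk h1.snd)).clm_comp continuous_const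

theorem continuous_dG₂ (hG : ContDiff ℝ 1 (G m)) (h0 : Continuous φ)
    (h1 : Continuous fun t => H m (φ t)) : Continuous fun t => dG₂ H G m (φ t) :=
  ((hG.continuous_fderiv one_ne_zero).comp (h0.fst.prodMk h1.snd)).clm_comp continuous_const

end ContinuousSteps

namespace GraphSystem

variable (S : GraphSystem H F G α lu r ls Λ κ c B) (hF : ∀ m, ContDiff ℝ 1 (F m))
  (hG : ∀ m, ContDiff ℝ 1 (G m)) [∀ m, CompleteSpace (Y m)]

include S hF hG

theorem continuous_transverse {T : Type*} [TopologicalSpace T] {m : M} {φ : T → X m × Y m}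
    {K : T → X (u m) →L[ℝ] Y (u m)} (h0 : Continuous φ) (h1 : Continuous fun t => H m (φ t))
    (hK : Continuous K) (hKr : ∀ t, ‖K t‖ ≤ r (u m)) :
    Continuous fun t => transverse H F G m (φ t) (K t) :=
  (continuous_dG₂ (hG m) h0 h1).clm_comp (continuous_resolvent₁
    (hK.clm_comp (continuous_dF₂ (hF m) h0 h1)) (fun t => S.norm_comp_dF₂_le hF (φ t) (hKr t))
    S.κ_lt)

variable [∀ m, CompleteSpace (X m)]

/-- Only continuity of the iterates along φ is required. Within a single leaf this holds even when
`H` is not continuous. -/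
theorem continuous_slope (hf : InvariantFamily H r f) {T : Type*} [TopologicalSpace T] (n : ℕ) :
    ∀ {m : M} {φ : T → X m × Y m}, (∀ k, Continuous fun t => iter H k m (φ t)) →
      Continuous fun t => slope H F G n m (φ t) := by
  induction n with
  | zero => exact fun _ => continuous_const
  | succ n ih =>
    intro m φ hφ
    have h0 : Continuous φ := hφ 0
    have h1 : Continuous fun t => H m (φ t) := hφ 1
    have h2 := ih (φ := fun t => H m (φ t)) fun k => hφ (k + 1)
    exact (continuous_dG₁ (hG m) h0 h1).add ((S.continuous_transverse hF hG h0 h1 h2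
      fun t => ((S.hasFDerivAt_leaf_base hF hG hf (u m) (H m (φ t))).2 n).2).clm_comp
      (h2.clm_comp (continuous_dF₁ (hF m) h0 h1)))

theorem continuous_fderiv_base (hf : InvariantFamily H r f) {T : Type*} [TopologicalSpace T]
    {m : M} {φ : T → X m × Y m} (hφ : ∀ k, Continuous fun t => iter H k m (φ t)) :
    Continuous fun t => fderiv ℝ (f m (φ t)) (φ t).1 :=
  continuous_of_geometric_approx S.c_nonneg S.c_lt
    (fun n => S.continuous_slope hF hG hf n hφ) (g := fun _ => (1 - κ)⁻¹ * B) continuous_const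
    fun n t => ((S.hasFDerivAt_leaf_base hF hG hf m (φ t)).2 n).1

/-- Every point of a leaf is a base point of the same leaf. -/
theorem hasFDerivAt_leaf (hf : InvariantFamily H r f) (m : M) (q : X m × Y m) (x : X m) :
    HasFDerivAt (f m q) (fderiv ℝ (f m (x, f m q x)) x) x := by
  have := (S.hasFDerivAt_leaf_base hF hG hf m (x, f m q x)).1
  rwa [S.eq_of_mem_leaf hf (p := (x, f m q x)) rfl] at this ⊢

theorem contDiff_leaf (hf : InvariantFamily H r f) (m : M) (q : X m × Y m) :
    ContDiff ℝ 1 (f m q) := by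
  rw [contDiff_one_iff_fderiv]
  have hd := S.hasFDerivAt_leaf hF hG hf m q
  refine ⟨fun x => (hd x).differentiableAt, ?_⟩
  have h1 : fderiv ℝ (f m q) = fun x => fderiv ℝ (f m (x, f m q x)) x :=
    funext fun x => (hd x).fderiv
  rw [h1]
  refine S.continuous_fderiv_base hF hG hf (φ := fun x => (x, f m q x)) fun k => ?_
  have hB := S.B_nonneg
  -- Along a leaf the k-th iterate expands horizontally by at most B^k; one more factor B passes
  -- from horizontal distance to distance.
  refine (LipschitzWith.of_dist_le_mul (K := (B * B ^ k).toNNReal) fun x x' => ?_).continuous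
  have h2 := S.dist_le_of_fst hf (hf.iter_mem k (m := m) (p := (x, f m q x)) (q := q) rfl)
    (hf.iter_mem k (m := m) (p := (x', f m q x')) (q := q) rfl)
  have h3 := S.dist_iter_leaf_le hf k (m := m) (p := (x, f m q x)) (p' := (x', f m q x')) (q := q)
    rfl rfl
  rw [Real.coe_toNNReal _ (by positivity)]
  have h4 := cocycle_le_pow (u := u) S.ls_nonneg S.ls_le k m
  calc _ ≤ _ := h2
    _ ≤ B * (B ^ k * dist x x') := by
      gcongr
      exact h3.trans (by gcongr)
    _ = _ := by ring

theorem leafDerivContinuous (hf : InvariantFamily H r f) (hH : ∀ m, Continuous (H m)) :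
    LeafDerivContinuous f := by
  intro m
  have h1 : (fun z : (X m × Y m) × X m => fderiv ℝ (f m z.1) z.2) =
      fun z => fderiv ℝ (f m (z.2, f m z.1 z.2)) (z.2, f m z.1 z.2).1 :=
    funext fun z => (S.hasFDerivAt_leaf hF hG hf m z.1 z.2).fderiv
  rw [h1]
  exact S.continuous_fderiv_base hF hG hf fun k => (continuous_iter hH k m).comp
    (continuous_snd.prodMk (S.continuous_family hf hH m))

theorem hasFDerivAt_translate (hf : InvariantFamily H r f) (m : M) (p : X m × Y m) :
    HasFDerivAt (fun v => f m p (p.1 + v) - p.2) (fderiv ℝ (f m p) p.1) 0 := by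
  have h1 : HasFDerivAt (f m p) (fderiv ℝ (f m p) p.1) (p.1 + 0) := by
    rw [add_zero]
    exact (S.hasFDerivAt_leaf_base hF hG hf m p).1
  exact (h1.comp (0 : X m) ((hasFDerivAt_id (0 : X m)).const_add p.1)).sub_const _

theorem norm_fderiv_base_le (hf : InvariantFamily H r f) (m : M) (p : X m × Y m) :
    ‖fderiv ℝ (f m p) p.1‖ ≤ r m := by
  refine (S.hasFDerivAt_leaf_base hF hG hf m p).1.le_of_lip' (S.r_nonneg m)
    (Eventually.of_forall fun x => ?_)
  simpa [dist_eq_norm] using hf.lip m p x p.1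

end GraphSystem

/-- The distance of a pair of points and of their images. -/
noncomputable def pairDist (H : ∀ m, X m × Y m → X (u m) × Y (u m))
    (i : Σ m, (X m × Y m) × (X m × Y m)) : ℝ :=
  max (dist i.2.1 i.2.2) (dist (H i.1 i.2.1) (H i.1 i.2.2))

/-- The map of pairs of points. -/
def pairMap (H : ∀ m, X m × Y m → X (u m) × Y (u m)) (m : M) (d : (X m × Y m) × (X m × Y m)) :
    (X (u m) × Y (u m)) × (X (u m) × Y (u m)) := (H m d.1, H m d.2)

omit [∀ m, NormedSpace ℝ (X m)] [∀ m, NormedSpace ℝ (Y m)] in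
theorem pairDist_nonneg (i : Σ m, (X m × Y m) × (X m × Y m)) : 0 ≤ pairDist H i :=
  dist_nonneg.trans (le_max_left _ _)

namespace GraphSystem

variable (S : GraphSystem H F G α lu r ls Λ κ c B) (hF : ∀ m, ContDiff ℝ 1 (F m))
  (hG : ∀ m, ContDiff ℝ 1 (G m)) {γ C₀ : ℝ} (hC₀ : 0 ≤ C₀) (hγ : 0 ≤ γ)
  (hF' : ∀ m z z', ‖fderiv ℝ (F m) z - fderiv ℝ (F m) z'‖ ≤ C₀ * ‖z - z'‖ ^ γ)
  (hG' : ∀ m z z', ‖fderiv ℝ (G m) z - fderiv ℝ (G m) z'‖ ≤ C₀ * ‖z - z'‖ ^ γ)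

include S hF hG hC₀ hγ hF' hG'

/-- The translate of a leaf to another base point is close to its graph transform. -/
theorem dist_translate_transform_le (hf : InvariantFamily H r f) (m : M) (p p' : X m × Y m)
    (x : X m) (y : Y m)
    (hy : (H m (x, y)).2 = f (u m) (H m p') ((H m (x, y)).1 - (H m p).1 + (H m p').1) +
      ((H m p).2 - (H m p').2)) :
    dist (f m p' (x - p.1 + p'.1) + (p.2 - p'.2)) y ≤
      C₀ * (B ^ 2 * (B ^ 2 * (1 - κ)⁻¹ + 1)) * pairDist H ⟨m, p, p'⟩ ^ γ * dist x p.1 := by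
  have hB := S.B_nonneg
  have hB1 := S.one_le
  have hκ := S.one_sub_pos
  set x' := x - p.1 + p'.1 with hx'
  have ey := S.eq_G m (x, y)
  have ea := S.eq_F m (x, y)
  have ey' := S.eq_G m (x', f m p' x')
  have ea' := S.eq_F m (x', f m p' x')
  have eb' := hf.inv m p' x'
  have ep := S.eq_G m p
  have eA := S.eq_F m p
  have ep' := S.eq_G m p'
  have eA' := S.eq_F m p'
  have eβ' := hf.base (u m) (H m p')
  have hls := S.dist_image_leaf_le hf (m := m) (p := (x', f m p' x')) (p' := p') (q := p') rfl
    (hf.base m p')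
  set δ := pairDist H ⟨m, p, p'⟩ with hδ
  have hδ0 : 0 ≤ δ := pairDist_nonneg _
  have hd1 : ‖p - p'‖ ≤ δ := by
    rw [← dist_eq_norm]
    exact le_max_left _ _
  have hd2 : ‖H m p - H m p'‖ ≤ δ := by
    rw [← dist_eq_norm]
    exact le_max_right _ _
  dsimp only at ey ea ey' ea' hls
  set a := (H m (x, y)).1
  set b := (H m (x, y)).2
  set a' := (H m (x', f m p' x')).1
  set b' := (H m (x', f m p' x')).2
  set β := (H m p).2
  set A := (H m p).1
  set β' := (H m p').2
  set A' := (H m p').1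
  -- `F` and `G` are compared at z, z' (the two base orbits) and at z + w, z' + w (the displaced
  -- points). Only their second differences obstruct exact translation invariance, and these are at
  -- most C₀ δ^γ ‖w‖.
  set z : X m × Y (u m) := (p.1, β) with hz
  set z' : X m × Y (u m) := (p'.1, β') with hz'
  set w : X m × Y (u m) := (x - p.1, b' - β') with hw
  have hzz : ‖z - z'‖ ≤ δ := by
    rw [hz, hz', Prod.mk_sub_mk, Prod.norm_def]
    exact max_le ((norm_fst_le (p - p')).trans hd1) ((norm_snd_le (H m p - H m p')).trans hd2)
  have hxx : dist x' p'.1 = ‖x - p.1‖ := by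
    rw [dist_eq_norm, hx']
    congr 1
    abel
  have hbβ : ‖b' - β'‖ ≤ B ^ 2 * ‖x - p.1‖ := by
    rw [← dist_eq_norm, eb', eβ']
    rw [hxx] at hls
    calc _ ≤ r (u m) * dist a' A' := hf.lip _ _ _ _
      _ ≤ B * (B * ‖x - p.1‖) := by
        gcongr
        exacts [S.r_le _, hls.trans (by gcongr; exact S.ls_le m)]
      _ = _ := by ring
  have hwn : ‖w‖ ≤ B ^ 2 * ‖x - p.1‖ := by
    rw [hw, Prod.norm_def]
    exact max_le (le_mul_of_one_le_left (norm_nonneg _) (one_le_pow₀ hB1)) hbβ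
  set Q := C₀ * δ ^ γ * (B ^ 2 * ‖x - p.1‖) with hQ
  have hQ0 : 0 ≤ Q := by positivity
  have hz1 : z + w = (x, β + (b' - β')) := by simp [hz, hw]
  have hz2 : z' + w = (x', b') := by
    simp only [hz', hw, hx', Prod.mk_add_mk, Prod.mk.injEq]
    constructor <;> abel
  have sF := norm_second_difference_le ((hF m).differentiable one_ne_zero) (hF' m) z z' w 0
  have sG := norm_second_difference_le ((hG m).differentiable one_ne_zero) (hG' m) z z' w 0
  rw [add_zero, add_zero, sub_zero, hz1, hz2] at sF sG
  have hbound : C₀ * ‖z - z'‖ ^ γ * ‖w‖ ≤ Q := by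
    rw [hQ]
    gcongr
  -- This bound and the next close up: each discrepancy controls the other, with product of the
  -- factors at most κ < 1, so both are O(Q).
  have hη : ‖b - (β + (b' - β'))‖ ≤ r (u m) * ‖(a - A) - (a' - A')‖ := by
    have e1 : b - (β + (b' - β')) = f (u m) (H m p') (a - A + A') - f (u m) (H m p') a' := by
      rw [← eb', hy]
      abel
    have e2 : (a - A) - (a' - A') = (a - A + A') - a' := by abel
    rw [e1, e2, ← dist_eq_norm, ← dist_eq_norm]
    exact hf.lip _ _ _ _
  have hξ : ‖(a - A) - (a' - A')‖ ≤ α m * ‖b - (β + (b' - β'))‖ + Q := by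
    have e1 : (a - A) - (a' - A') = (F m (x, b) - F m (x, β + (b' - β'))) +
        ((F m (x, β + (b' - β')) - F m (x', b')) - (F m z - F m z')) := by
      rw [ea, ea', eA, eA']
      abel
    rw [e1]
    refine (norm_add_le _ _).trans (add_le_add ?_ (sF.trans hbound))
    rw [← dist_eq_norm, ← dist_eq_norm]
    exact S.lip_F m x _ _
  have hξ' : ‖(a - A) - (a' - A')‖ ≤ (1 - κ)⁻¹ * Q := by
    rw [le_inv_mul_iff₀ hκ]
    have h1 := mul_le_mul_of_nonneg_left hη (S.α_nonneg m)
    have h2 := mul_le_mul_of_nonneg_right (S.angle m) (norm_nonneg ((a - A) - (a' - A')))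
    nlinarith
  have hη' : ‖b - (β + (b' - β'))‖ ≤ B * ((1 - κ)⁻¹ * Q) :=
    hη.trans (mul_le_mul (S.r_le _) hξ' (norm_nonneg _) hB)
  have e1 : f m p' x' + (p.2 - p'.2) - y = -((G m (x, b) - G m (x, β + (b' - β'))) +
      ((G m (x, β + (b' - β')) - G m (x', b')) - (G m z - G m z'))) := by
    rw [hz, hz', ← ey, ← ey', ← ep, ← ep']
    abel
  have hfin : ‖G m (x, b) - G m (x, β + (b' - β'))‖ ≤ B * (B * ((1 - κ)⁻¹ * Q)) := by
    have h1 := S.lip_G m x b (β + (b' - β'))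
    rw [dist_eq_norm, dist_eq_norm] at h1
    exact h1.trans (mul_le_mul (S.lu_le m) hη' (norm_nonneg _) hB)
  rw [dist_eq_norm, e1, norm_neg, dist_eq_norm]
  calc _ ≤ B * (B * ((1 - κ)⁻¹ * Q)) + Q :=
        (norm_add_le _ _).trans (add_le_add hfin (sG.trans hbound))
    _ = _ := by
      rw [hQ]
      ring

variable [∀ m, CompleteSpace (X m)]

/-- Comparison of the leaves through two points, translated to each other. -/
theorem exists_translate_bound (hf : InvariantFamily H r f) : ∃ C : ℝ, 0 ≤ C ∧
    ∀ (n : ℕ) (m : M) (p p' : X m × Y m) (v : X m),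
      ‖(f m p (p.1 + v) - p.2) - (f m p' (p'.1 + v) - p'.2)‖ ≤ C * (∑ k ∈ Finset.range n,
        cocycle u Λ k m * cocycle u ls k m *
          pairDist H ((totalMap (pairMap H))^[k] ⟨m, p, p'⟩) ^ γ + c ^ n) * ‖v‖ := by
  have hB := S.B_nonneg
  have hκ := S.one_sub_pos
  set C₁ := C₀ * (B ^ 2 * (B ^ 2 * (1 - κ)⁻¹ + 1)) with hC₁
  have hC₁0 : 0 ≤ C₁ := by positivity
  refine ⟨(1 - κ)⁻¹ * (C₁ + 2 * B), by positivity, fun n m p p' v => ?_⟩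
  -- Over the bundle of pairs (p, p'), with base point p, the true family is the leaf of p and the
  -- trial family is the leaf of p' translated to pass through p.
  have key := S.dist_family_le (pairMap H) (fun _ d => d.1) (fun _ _ => rfl)
    (f := fun m d => f m d.1) (g := fun m d x => f m d.2 (x - d.1.1 + d.2.1) + (d.1.2 - d.2.2))
    (fun m d => hf.lip m d.1) (fun m d x x' => by
      simpa using hf.lip m d.2 (x - d.1.1 + d.2.1) (x' - d.1.1 + d.2.1))
    (fun m d => hf.base m d.1) (fun m d => hf.inv m d.1)
    (fun m d => by simp [← hf.base]) (e := fun i => C₁ * pairDist H i ^ γ)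
    (fun i => mul_nonneg hC₁0 (Real.rpow_nonneg (pairDist_nonneg _) _))
    (fun m d x y hy => S.dist_translate_transform_le hF hG hC₀ hγ hF' hG' hf m d.1 d.2 x y hy)
    n m (p, p') (p.1 + v)
  have hs : 0 ≤ ∑ k ∈ Finset.range n, cocycle u Λ k m * cocycle u ls k m *
      pairDist H ((totalMap (pairMap H))^[k] ⟨m, p, p'⟩) ^ γ := Finset.sum_nonneg fun k _ =>
    mul_nonneg (mul_nonneg (cocycle_nonneg S.Λ_nonneg _ _) (cocycle_nonneg S.ls_nonneg _ _))
      (Real.rpow_nonneg (pairDist_nonneg _) _)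
  have hc := pow_nonneg S.c_nonneg n
  simp only [mul_left_comm _ C₁, ← Finset.mul_sum] at key
  rw [dist_comm, dist_eq_norm, dist_eq_norm] at key
  have e1 : (f m p (p.1 + v) - p.2) - (f m p' (p'.1 + v) - p'.2) =
      f m p (p.1 + v) - (f m p' (p.1 + v - p.1 + p'.1) + (p.2 - p'.2)) := by
    rw [add_sub_cancel_left, add_comm v]
    abel
  rw [e1]
  refine key.trans ?_
  rw [add_sub_cancel_left, mul_assoc (1 - κ)⁻¹ (C₁ + 2 * B)]
  refine mul_le_mul_of_nonneg_right (mul_le_mul_of_nonneg_left ?_ (inv_nonneg.2 hκ.le))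
    (norm_nonneg v)
  nlinarith

variable [∀ m, CompleteSpace (Y m)]

/-- The translated leaves agree at v = 0, so a bound linear in ‖v‖ for their difference bounds the
difference of the slopes. -/
theorem exists_slope_bound (hf : InvariantFamily H r f) : ∃ C : ℝ, 0 ≤ C ∧
    ∀ (n : ℕ) (m : M) (p p' : X m × Y m),
      ‖fderiv ℝ (f m p) p.1 - fderiv ℝ (f m p') p'.1‖ ≤ C * (∑ k ∈ Finset.range n,
        cocycle u Λ k m * cocycle u ls k m *
          pairDist H ((totalMap (pairMap H))^[k] ⟨m, p, p'⟩) ^ γ + c ^ n) := by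
  obtain ⟨C, hC, h⟩ := S.exists_translate_bound hF hG hC₀ hγ hF' hG' hf
  refine ⟨C, hC, fun n m p p' => ?_⟩
  refine ((S.hasFDerivAt_translate hF hG hf m p).sub
    (S.hasFDerivAt_translate hF hG hf m p')).le_of_lip' ?_ (Eventually.of_forall fun v => ?_)
  · refine mul_nonneg hC (add_nonneg (Finset.sum_nonneg fun k _ => ?_) (pow_nonneg S.c_nonneg n))
    exact mul_nonneg (mul_nonneg (cocycle_nonneg S.Λ_nonneg _ _)
      (cocycle_nonneg S.ls_nonneg _ _)) (Real.rpow_nonneg (pairDist_nonneg _) _)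
  · have := h n m p p' v
    simpa [← hf.base] using this

omit hγ in
/-- The slopes are Hölder with respect to a quantity that bounds the distance of the iterates. -/
theorem exists_slope_holder (hγ : 0 < γ) (hf : InvariantFamily H r f) {R E : ℝ} (hR : 1 ≤ R)
    (hE : 0 ≤ E) : ∃ ζ C : ℝ, 0 < ζ ∧ ζ ≤ γ ∧ 0 ≤ C ∧
      ∀ (m : M) (p p' : X m × Y m) (d : ℝ), 0 ≤ d →
      (∀ k, pairDist H ((totalMap (pairMap H))^[k] ⟨m, p, p'⟩) ≤ R ^ k * (E * d)) →
      ‖fderiv ℝ (f m p) p.1 - fderiv ℝ (f m p') p'.1‖ ≤ C * d ^ ζ := by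
  have hB := S.B_nonneg
  have hR0 : 0 ≤ R := zero_le_one.trans hR
  obtain ⟨C, hC, h⟩ := S.exists_slope_bound hF hG hC₀ hγ.le hF' hG' hf
  have hRγ : 1 ≤ R ^ γ := Real.one_le_rpow hR hγ.le
  -- The base 1 + R^γ absorbs the geometric sum of the powers of R^γ. Interpolating in (Ed)^γ yields
  -- the exponent γθ; the summand 2B in the constant serves d > 1, where the slope bound suffices.
  obtain ⟨θ, K, hθ0, hθ1, hK0, hK⟩ := exists_rpow_bound (R := 1 + R ^ γ) (c := c)
    (by positivity) S.c_nonneg S.c_lt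
  refine ⟨γ * θ, C * K * (1 + E ^ γ) * E ^ (γ * θ) + 2 * B, by positivity,
    mul_le_of_le_one_right hγ.le hθ1, by positivity, fun m p p' d hd hk => ?_⟩
  have hdγ : 0 ≤ d ^ (γ * θ) := Real.rpow_nonneg hd _
  rcases le_or_gt d 1 with hd1 | hd1
  · have h1 := hK C ((E * d) ^ γ) _ hC (by positivity) fun n => by
      refine (h n m p p').trans ?_
      gcongr
      have h2 : ∀ k ∈ Finset.range n, cocycle u Λ k m * cocycle u ls k m *
          pairDist H ((totalMap (pairMap H))^[k] ⟨m, p, p'⟩) ^ γ ≤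
          (R ^ γ) ^ k * (E * d) ^ γ := fun k _ => by
        have h3 : cocycle u Λ k m * cocycle u ls k m ≤ 1 :=
          (S.cocycle_rate_le k m).trans (pow_le_one₀ S.c_nonneg S.c_lt.le)
        have h4 : pairDist H ((totalMap (pairMap H))^[k] ⟨m, p, p'⟩) ^ γ ≤
            (R ^ γ) ^ k * (E * d) ^ γ := by
          refine (Real.rpow_le_rpow (pairDist_nonneg _) (hk k) hγ.le).trans (le_of_eq ?_)
          rw [Real.mul_rpow (by positivity) (by positivity), Real.rpow_pow_comm hR0]
        exact (mul_le_of_le_one_left (Real.rpow_nonneg (pairDist_nonneg _) _) h3).trans h4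
      refine (Finset.sum_le_sum h2).trans ?_
      rw [← Finset.sum_mul]
      gcongr
      have h5 : ∀ n : ℕ, ∑ k ∈ Finset.range n, (R ^ γ) ^ k ≤ (1 + R ^ γ) ^ n := fun n => by
        induction n with
        | zero => simp
        | succ n ih =>
          rw [Finset.sum_range_succ]
          have h6 : (R ^ γ) ^ n ≤ (1 + R ^ γ) ^ n := by
            gcongr
            linarith
          have h7 : (1 + R ^ γ) ^ n ≤ R ^ γ * (1 + R ^ γ) ^ n :=
            le_mul_of_one_le_left (by positivity) hRγ
          rw [pow_succ]
          nlinarith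
      exact h5 n
    have h2 : (E * d) ^ γ ≤ E ^ γ := by
      gcongr
      exact mul_le_of_le_one_right hE hd1
    have h3 : ((E * d) ^ γ) ^ θ = E ^ (γ * θ) * d ^ (γ * θ) := by
      rw [← Real.rpow_mul (by positivity), Real.mul_rpow hE hd]
    rw [h3] at h1
    calc _ ≤ _ := h1
      _ ≤ C * K * (1 + E ^ γ) * (E ^ (γ * θ) * d ^ (γ * θ)) := by gcongr
      _ = C * K * (1 + E ^ γ) * E ^ (γ * θ) * d ^ (γ * θ) := by ring
      _ ≤ _ := by
        gcongr
        linarith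
  · have h1 := S.norm_fderiv_base_le hF hG hf m p
    have h2 := S.norm_fderiv_base_le hF hG hf m p'
    have h3 : 1 ≤ d ^ (γ * θ) := Real.one_le_rpow hd1.le (by positivity)
    have h4 := S.r_le m
    have h5 : 0 ≤ C * K * (1 + E ^ γ) * E ^ (γ * θ) := by positivity
    calc _ ≤ _ := norm_sub_le _ _
      _ ≤ 2 * B := by linarith
      _ ≤ (C * K * (1 + E ^ γ) * E ^ (γ * θ) + 2 * B) * 1 := by linarith
      _ ≤ _ := by gcongr

omit hγ in
-- For two points of one leaf the expansion along the orbit is bounded by the rate ls, so no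
-- Lipschitz bound on `H` is needed.
theorem exists_uniformC1Holder_leaves (hγ : 0 < γ) (hf : InvariantFamily H r f) :
    ∃ ζ : ℝ, 0 < ζ ∧ ζ ≤ γ ∧
      UniformC1Holder ζ (fun (i : Σ m, X m × Y m) (x : X i.1) => f i.1 i.2 x) := by
  have hB := S.B_nonneg
  have hB1 := S.one_le
  obtain ⟨ζ, C, hζ0, hζ1, hC, h⟩ := S.exists_slope_holder hF hG hC₀ hF' hG' hγ hf (R := B)
    (E := B ^ 2) hB1 (by positivity)
  refine ⟨ζ, hζ0, hζ1, fun i => S.contDiff_leaf hF hG hf i.1 i.2, C + B, fun i x x' => ?_⟩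
  have hd := S.hasFDerivAt_leaf hF hG hf i.1 i.2
  rw [(hd x).fderiv, (hd x').fderiv]
  refine ⟨?_, ?_⟩
  · have h1 := S.norm_fderiv_base_le hF hG hf i.1 (x, f i.1 i.2 x)
    have h2 := S.r_le i.1
    linarith
  · have key : ∀ k (j : Σ m, (X m × Y m) × (X m × Y m)), j.2.1.2 = f j.1 j.2.2 j.2.1.1 →
        pairDist H ((totalMap (pairMap H))^[k] j) ≤ B ^ k * (B ^ 2 * dist j.2.1.1 j.2.2.1) := by
      have step : ∀ j : Σ m, (X m × Y m) × (X m × Y m), j.2.1.2 = f j.1 j.2.2 j.2.1.1 →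
          (H j.1 j.2.1).2 = f (u j.1) (H j.1 j.2.2) (H j.1 j.2.1).1 ∧
          dist (H j.1 j.2.1).1 (H j.1 j.2.2).1 ≤ B * dist j.2.1.1 j.2.2.1 := fun j hj =>
        ⟨hf.iter_mem 1 hj, (S.dist_image_leaf_le hf hj (hf.base _ _)).trans
          (mul_le_mul_of_nonneg_right (S.ls_le _) dist_nonneg)⟩
      intro k
      induction k with
      | zero =>
        intro j hj
        obtain ⟨h1, h2⟩ := step j hj
        have h3 := S.dist_le_of_fst hf hj (hf.base _ _)
        have h4 := S.dist_le_of_fst hf h1 (hf.base _ _)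
        have h5 : 0 ≤ dist j.2.1.1 j.2.2.1 := dist_nonneg
        rw [pow_zero, one_mul]
        refine max_le (h3.trans ?_) (h4.trans ?_)
        · gcongr
          exact le_self_pow₀ hB1 two_ne_zero
        · rw [pow_two, mul_assoc]
          gcongr
      | succ k ih =>
        intro j hj
        obtain ⟨h1, h2⟩ := step j hj
        refine (ih (totalMap (pairMap H) j) h1).trans ?_
        change B ^ k * (B ^ 2 * dist (H j.1 j.2.1).1 (H j.1 j.2.2).1) ≤ _
        calc _ ≤ B ^ k * (B ^ 2 * (B * dist j.2.1.1 j.2.2.1)) := by gcongr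
          _ = _ := by ring
    have h1 : ∀ p : X i.1 × Y i.1, p.2 = f i.1 i.2 p.1 → f i.1 p = f i.1 i.2 :=
      fun p hp => S.eq_of_mem_leaf hf hp
    have h2 := h i.1 (x, f i.1 i.2 x) (x', f i.1 i.2 x') (dist x x') dist_nonneg fun k =>
      key k ⟨i.1, (x, f i.1 i.2 x), (x', f i.1 i.2 x')⟩ (by rw [h1 (x', f i.1 i.2 x') rfl])
    rw [dist_eq_norm] at h2
    refine h2.trans ?_
    gcongr
    linarith

omit hγ in
theorem tangentUniformLocallyHolder (hγ : 0 < γ) (hγ1 : γ ≤ 1) (hf : InvariantFamily H r f)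
    (hH : UniformLipschitz H) : TangentUniformLocallyHolder f := by
  obtain ⟨K, hK⟩ := hH
  obtain ⟨ζ, C, hζ0, hζ1, hC, h⟩ := S.exists_slope_holder hF hG hC₀ hF' hG' hγ hf
    (R := max 1 K) (E := max 1 K) (le_max_left _ _) (by positivity)
  refine ⟨ζ, hζ0, hζ1.trans hγ1, C, fun m q q' _ => h m q q' _ dist_nonneg ?_⟩
  have key : ∀ k (j : Σ m, (X m × Y m) × (X m × Y m)),
      pairDist H ((totalMap (pairMap H))^[k] j) ≤ max 1 (K : ℝ) ^ k *
        (max 1 (K : ℝ) * dist j.2.1 j.2.2) := by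
    have step : ∀ j : Σ m, (X m × Y m) × (X m × Y m),
        dist (H j.1 j.2.1) (H j.1 j.2.2) ≤ max 1 (K : ℝ) * dist j.2.1 j.2.2 := fun j =>
      ((hK j.1).dist_le_mul _ _).trans (by
        gcongr
        exact le_max_right _ _)
    intro k
    induction k with
    | zero =>
      intro j
      rw [pow_zero, one_mul]
      exact max_le (le_mul_of_one_le_left dist_nonneg (le_max_left _ _)) (step j)
    | succ k ih =>
      intro j
      refine (ih (totalMap (pairMap H) j)).trans ?_
      change _ * (_ * dist (H j.1 j.2.1) (H j.1 j.2.2)) ≤ _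
      calc _ ≤ max 1 (K : ℝ) ^ k * (max 1 (K : ℝ) * (max 1 (K : ℝ) * dist j.2.1 j.2.2)) := by
            gcongr
            exact step j
        _ = _ := by ring
  exact fun k => key k ⟨m, q, q'⟩

end GraphSystem

end Regularity

/-! ### Bunching: Lipschitz slopes and differentiability in the base point. -/

section Bunching

variable {M : Type*} {X : M → Type*} {Y : M → Type*} {u : M → M}
  [∀ m, NormedAddCommGroup (X m)] [∀ m, NormedSpace ℝ (X m)]
  [∀ m, NormedAddCommGroup (Y m)] [∀ m, NormedSpace ℝ (Y m)]
  {H : ∀ m, X m × Y m → X (u m) × Y (u m)}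
  {F : ∀ m, X m × Y (u m) → X (u m)} {G : ∀ m, X m × Y (u m) → Y m}
  {α lu r ls Λ : M → ℝ} {κ c B : ℝ} {f : ∀ m, X m × Y m → X m → Y m}

/-- The iterates of `H` have Lipschitz constants that grow at a rate `μ` which is dominated by
the contraction of the slopes. -/
structure Bunched (H : ∀ m, X m × Y m → X (u m) × Y (u m)) (ls Λ μ : M → ℝ) (c A : ℝ) : Prop where
  μ_nonneg : ∀ m, 0 ≤ μ m
  μ_le : ∀ m, μ m ≤ A
  one_le : 1 ≤ A
  rate : ∀ m, Λ m * ls m * μ m ≤ c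
  c_nonneg : 0 ≤ c
  c_lt : c < 1
  -- The factor A occurs once for all k and not once per step, so a change between equivalent
  -- metrics does not affect the rate.
  dist_iter : ∀ k m (p p' : X m × Y m),
    dist (iter H k m p) (iter H k m p') ≤ A * cocycle u μ k m * dist p p'

omit [∀ m, NormedAddCommGroup (X m)] [∀ m, NormedSpace ℝ (X m)]
  [∀ m, NormedAddCommGroup (Y m)] [∀ m, NormedSpace ℝ (Y m)] in
theorem pair_iterate (φ : ∀ m, X m × Y m → X m × Y m → ℝ) (k : ℕ) : ∀ m (p p' : X m × Y m),
    φ ((totalMap (pairMap H))^[k] ⟨m, p, p'⟩).1 ((totalMap (pairMap H))^[k] ⟨m, p, p'⟩).2.1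
      ((totalMap (pairMap H))^[k] ⟨m, p, p'⟩).2.2 =
    φ (u^[k] m) (iter H k m p) (iter H k m p') := by
  induction k with
  | zero => exact fun _ _ _ => rfl
  | succ k ih => exact fun m p p' => ih (u m) (H m p) (H m p')

omit [∀ m, NormedSpace ℝ (X m)] [∀ m, NormedSpace ℝ (Y m)] in
theorem iter_succ_comp (k : ℕ) : ∀ m (p p' : X m × Y m),
    dist (H (u^[k] m) (iter H k m p)) (H (u^[k] m) (iter H k m p')) =
      dist (iter H (k + 1) m p) (iter H (k + 1) m p') := by
  induction k with
  | zero => exact fun _ _ _ => rfl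
  | succ k ih => exact fun m p p' => ih (u m) (H m p) (H m p')

namespace GraphSystem

variable (S : GraphSystem H F G α lu r ls Λ κ c B) (hF : ∀ m, ContDiff ℝ 1 (F m))
  (hG : ∀ m, ContDiff ℝ 1 (G m)) {C₀ : ℝ} (hC₀ : 0 ≤ C₀)
  (hF' : ∀ m z z', ‖fderiv ℝ (F m) z - fderiv ℝ (F m) z'‖ ≤ C₀ * ‖z - z'‖ ^ (1 : ℝ))
  (hG' : ∀ m z z', ‖fderiv ℝ (G m) z - fderiv ℝ (G m) z'‖ ≤ C₀ * ‖z - z'‖ ^ (1 : ℝ))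
  {μ : M → ℝ} {c₁ A : ℝ} (hμ : Bunched H ls Λ μ c₁ A)

omit [∀ m, NormedSpace ℝ (X m)] [∀ m, NormedSpace ℝ (Y m)] in
include S hμ in
theorem bunched_rate_le (k : ℕ) (m : M) :
    cocycle u Λ k m * cocycle u ls k m * cocycle u μ k m ≤ c₁ ^ k := by
  rw [← cocycle_mul, ← cocycle_mul]
  exact cocycle_le_pow (fun m => mul_nonneg (mul_nonneg (S.Λ_nonneg m) (S.ls_nonneg m))
    (hμ.μ_nonneg m)) hμ.rate k m

section

variable [∀ m, CompleteSpace (X m)]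

include S hF hG hC₀ hF' hG' hμ in
/-- Under the bunching condition the distance of two translated leaves is Lipschitz in the base
points. -/
theorem exists_translate_lipschitz (hf : InvariantFamily H r f) : ∃ C : ℝ, 0 ≤ C ∧
    ∀ (m : M) (p p' : X m × Y m) (v : X m),
      ‖(f m p (p.1 + v) - p.2) - (f m p' (p'.1 + v) - p'.2)‖ ≤ C * dist p p' * ‖v‖ := by
  obtain ⟨C, hC, h⟩ := S.exists_translate_bound hF hG hC₀ zero_le_one hF' hG' hf
  have hA1 := hμ.one_le
  have hA : 0 ≤ A := zero_le_one.trans hA1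
  have hc₁ : 0 < 1 - c₁ := sub_pos.2 hμ.c_lt
  refine ⟨C * (A * A * (1 - c₁)⁻¹), by positivity, fun m p p' v => ?_⟩
  -- With γ = 1 the k-th term is at most c₁^k A² |p - p'| because Λ ls μ ≤ c₁. The series converges,
  -- and n can tend to infinity without interpolation.
  have hsum : ∀ n, ∑ k ∈ Finset.range n, cocycle u Λ k m * cocycle u ls k m *
      pairDist H ((totalMap (pairMap H))^[k] ⟨m, p, p'⟩) ^ (1 : ℝ) ≤
      A * A * (1 - c₁)⁻¹ * dist p p' := fun n => by
    have h1 : ∀ k ∈ Finset.range n, cocycle u Λ k m * cocycle u ls k m *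
        pairDist H ((totalMap (pairMap H))^[k] ⟨m, p, p'⟩) ^ (1 : ℝ) ≤
        c₁ ^ k * (A * A * dist p p') := fun k _ => by
      have hμk := cocycle_nonneg (u := u) hμ.μ_nonneg k m
      have h2 : pairDist H ((totalMap (pairMap H))^[k] ⟨m, p, p'⟩) ≤
          A * A * cocycle u μ k m * dist p p' := by
        have h3 := pair_iterate (H := H) (fun m p p' => max (dist p p') (dist (H m p) (H m p')))
          k m p p'
        have h4 := iter_succ_comp (H := H) k m p p'
        have h5 := hμ.dist_iter k m p p'
        have h6 := hμ.dist_iter (k + 1) m p p'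
        rw [cocycle_succ'] at h6
        refine le_of_eq_of_le h3 (max_le (h5.trans ?_) (h4.le.trans (h6.trans ?_)))
        · gcongr
          exact le_mul_of_one_le_left hA hA1
        · have := hμ.μ_le (u^[k] m)
          calc _ ≤ A * (cocycle u μ k m * A) * dist p p' := by gcongr
            _ = _ := by ring
      have h7 := mul_nonneg (cocycle_nonneg (u := u) S.Λ_nonneg k m)
        (cocycle_nonneg (u := u) S.ls_nonneg k m)
      rw [Real.rpow_one]
      calc _ ≤ cocycle u Λ k m * cocycle u ls k m * (A * A * cocycle u μ k m * dist p p') := by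
            gcongr
        _ = cocycle u Λ k m * cocycle u ls k m * cocycle u μ k m * (A * A * dist p p') := by ring
        _ ≤ _ := by
          gcongr
          exact S.bunched_rate_le hμ k m
    refine (Finset.sum_le_sum h1).trans ?_
    rw [← Finset.sum_mul]
    have h8 : ∑ k ∈ Finset.range n, c₁ ^ k ≤ (1 - c₁)⁻¹ := by
      rw [← tsum_geometric_of_lt_one hμ.c_nonneg hμ.c_lt]
      exact (summable_geometric_of_lt_one hμ.c_nonneg hμ.c_lt).sum_le_tsum _
        (fun k _ => pow_nonneg hμ.c_nonneg k)
    calc _ ≤ (1 - c₁)⁻¹ * (A * A * dist p p') := by gcongr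
      _ = _ := by ring
  have hlim : Tendsto (fun n : ℕ => C * (A * A * (1 - c₁)⁻¹ * dist p p' + c ^ n) * ‖v‖) atTop
      (𝓝 (C * (A * A * (1 - c₁)⁻¹ * dist p p' + 0) * ‖v‖)) :=
    (((tendsto_pow_atTop_nhds_zero_of_lt_one S.c_nonneg S.c_lt).const_add _).const_mul _).mul_const
      _
  have := ge_of_tendsto' hlim fun n => (h n m p p' v).trans (by
    gcongr
    exact hsum n)
  calc _ ≤ _ := this
    _ = _ := by ring

omit [∀ m, NormedSpace ℝ (X m)] [∀ m, NormedSpace ℝ (Y m)] [∀ m, CompleteSpace (X m)] in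
include S in
theorem dist_snd_leaf_le (hf : InvariantFamily H r f) (m : M) (q q' : X m × Y m) :
    dist (f m q q'.1) q'.2 ≤ 2 * B * dist q q' := by
  have h1 := hf.lip m q q'.1 q.1
  rw [← hf.base] at h1
  have h2 := dist_triangle (f m q q'.1) q.2 q'.2
  have h3 : dist q'.1 q.1 ≤ dist q q' := by
    rw [dist_comm]
    exact le_max_left _ _
  have h4 : dist q.2 q'.2 ≤ dist q q' := le_max_right _ _
  have h5 := mul_le_mul (S.r_le m) h3 dist_nonneg S.B_nonneg
  have h6 := mul_le_mul_of_nonneg_right S.one_le (dist_nonneg (x := q) (y := q'))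
  linarith

include S hF hG hC₀ hF' hG' hμ in
/-- The variation of the vertical distance of two leaves. -/
theorem exists_vertical_bound (hf : InvariantFamily H r f) : ∃ C : ℝ, 0 ≤ C ∧
    ∀ (m : M) (q q' : X m × Y m) (x : X m),
      dist (f m q x + (q'.2 - f m q q'.1)) (f m q' x) ≤ C * dist q q' * dist x q'.1 := by
  obtain ⟨C, hC, h⟩ := S.exists_translate_lipschitz hF hG hC₀ hF' hG' hμ hf
  have hB := S.B_nonneg
  refine ⟨C * (2 * B), by positivity, fun m q q' x => ?_⟩
  -- The point of the leaf of q over q'_X has the same leaf as q, and between it and q' the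
  -- translation is purely vertical.
  have h1 := h m (q'.1, f m q q'.1) q' (x - q'.1)
  rw [S.eq_of_mem_leaf hf (p := (q'.1, f m q q'.1)) (q := q) rfl] at h1
  have h2 : dist ((q'.1, f m q q'.1) : X m × Y m) q' ≤ 2 * B * dist q q' := by
    rw [Prod.dist_eq, dist_self]
    exact max_le (by positivity) (S.dist_snd_leaf_le hf m q q')
  rw [dist_eq_norm, dist_eq_norm x]
  have h3 : f m q x + (q'.2 - f m q q'.1) - f m q' x =
      f m q ((q'.1, f m q q'.1).1 + (x - q'.1)) - (q'.1, f m q q'.1).2 -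
        (f m q' (q'.1 + (x - q'.1)) - q'.2) := by
    simp only [add_sub_cancel]
    abel
  rw [h3]
  calc _ ≤ _ := h1
    _ ≤ C * (2 * B * dist q q') * ‖x - q'.1‖ := by gcongr
    _ = _ := by ring

variable [∀ m, CompleteSpace (Y m)]

include S hF hG hC₀ hF' hG' hμ in
theorem exists_slope_lipschitz (hf : InvariantFamily H r f) : ∃ C : ℝ, 0 ≤ C ∧
    ∀ (m : M) (p p' : X m × Y m),
      ‖fderiv ℝ (f m p) p.1 - fderiv ℝ (f m p') p'.1‖ ≤ C * dist p p' := by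
  obtain ⟨C, hC, h⟩ := S.exists_translate_lipschitz hF hG hC₀ hF' hG' hμ hf
  refine ⟨C, hC, fun m p p' => ?_⟩
  refine ((S.hasFDerivAt_translate hF hG hf m p).sub (S.hasFDerivAt_translate hF hG hf m p')).le_of_lip'
    (by positivity) (Eventually.of_forall fun v => ?_)
  have := h m p p' v
  simpa [← hf.base] using this

include S hF hG in
/-- If `H` is Lipschitz, then it is `C¹`. -/
theorem contDiff_of_lipschitz {K : ℝ} (hK : 1 ≤ K)
    (hH : ∀ m z z', dist (H m z) (H m z') ≤ K * dist z z') (m : M) : ContDiff ℝ 1 (H m) := by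
  have hK0 : 0 < K := zero_lt_one.trans_le hK
  -- This C¹ map has the Lipschitz inverse ψ, so its derivative is bijective and ψ is C¹. The second
  -- coordinate of ψ is that of `H`, and composing `F` with ψ gives the first.
  set φ : X m × Y (u m) → X m × Y m := fun z => (z.1, G m z) with hφ
  set ψ : X m × Y m → X m × Y (u m) := fun z => (z.1, (H m z).2) with hψ
  have h1 : ∀ z, φ (ψ z) = z := fun z => Prod.ext rfl (S.eq_G m z).symm
  have h2 : ∀ z, ψ (φ z) = z := fun z => by
    have := S.generating.apply m z.1 z.2
    exact Prod.ext rfl (show (H m (z.1, G m (z.1, z.2))).2 = z.2 by rw [this])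
  have h3 : ∀ z z', dist (ψ z) (ψ z') ≤ K * dist z z' := fun z z' => by
    have h4 : dist z.1 z'.1 ≤ dist z z' := le_max_left _ _
    have h5 : dist (H m z).2 (H m z').2 ≤ dist (H m z) (H m z') := le_max_right _ _
    exact max_le (h4.trans (le_mul_of_one_le_left dist_nonneg hK)) (h5.trans (hH m z z'))
  have hφ1 : ContDiff ℝ 1 φ := contDiff_fst.prodMk (hG m)
  have hψc : Continuous ψ := (LipschitzWith.of_dist_le_mul (K := K.toNNReal) fun z z' => by
    rw [Real.coe_toNNReal _ hK0.le]
    exact h3 z z').continuous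
  have hbij : ∀ z, Function.Bijective (fderiv ℝ φ z) := fun z =>
    bijective_fderiv_of_lipschitz_inverse (hφ1.differentiable one_ne_zero z).hasFDerivAt h1 h2
      (fun z z' => by simpa [dist_eq_norm] using h3 z z') hK0
  let e : X m × Y (u m) ≃ₜ X m × Y m := ⟨⟨φ, ψ, h2, h1⟩, hφ1.continuous, hψc⟩
  have hψ1 : ContDiff ℝ 1 ψ := by
    refine Homeomorph.contDiff_symm e (f₀' := fun z => ContinuousLinearEquiv.ofBijective
      (fderiv ℝ φ z) (LinearMap.ker_eq_bot.2 (hbij z).1) (LinearMap.range_eq_top.2 (hbij z).2))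
      (fun z => ?_) hφ1
    have : HasFDerivAt φ (fderiv ℝ φ z) z := (hφ1.differentiable one_ne_zero z).hasFDerivAt
    exact this
  have e1 : H m = fun z => (F m (ψ z), (ψ z).2) := funext fun z =>
    Prod.ext (S.eq_F m z) rfl
  rw [e1]
  exact ((hF m).comp hψ1).prodMk hψ1.snd

end

end GraphSystem

section Vertical

variable (H F G f)

/-- The derivatives of the approximations of `(q', x) ↦ f_{(m,q')}(x)` in the first variable, at
`q' = q` and over the point `p` of the leaf of `q`. -/
noncomputable def verticalSlope : ℕ → ∀ m : M, X m × Y m → X m × Y m → (X m × Y m →L[ℝ] Y m)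
  -- The derivative at q' = q of the vertical shift q'_Y - f_{(m,q)}(q'_X) that moves the leaf of q
  -- to pass through q'.
  | 0, m, q, _ => ContinuousLinearMap.snd ℝ (X m) (Y m) -
      (fderiv ℝ (f m q) q.1).comp (ContinuousLinearMap.fst ℝ (X m) (Y m))
  | n + 1, m, q, p => (transverse H F G m p (fderiv ℝ (f (u m) (H m p)) (H m p).1)).comp
      ((verticalSlope n (u m) (H m q) (H m p)).comp (fderiv ℝ (H m) q))

end Vertical

namespace GraphSystem

variable (S : GraphSystem H F G α lu r ls Λ κ c B) (hF : ∀ m, ContDiff ℝ 1 (F m))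
  (hG : ∀ m, ContDiff ℝ 1 (G m)) [∀ m, CompleteSpace (X m)] [∀ m, CompleteSpace (Y m)]

include S hF hG in
-- The leaf of p is the graph transform of the leaf of `H m p`, so its slope is fixed by the slope
-- step.
theorem fderiv_base_eq (hf : InvariantFamily H r f) (m : M) (p : X m × Y m) :
    fderiv ℝ (f m p) p.1 = slopeStep H F G m p (fderiv ℝ (f (u m) (H m p)) (H m p).1) := by
  have h1 := S.hasFDerivAt_transform hF hG (E := X m) (ξ := fun x => x) (y := f m p)
    (h := fun z => f (u m) (H m p) z.2) (w₀ := p.1) (A := 0)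
    (K := fderiv ℝ (f (u m) (H m p)) (H m p).1) (p := p) (by rw [← hf.base])
    (hasFDerivAt_id _) (by
      refine HasFDerivAt.congr_fderiv (((S.hasFDerivAt_leaf_base hF hG hf (u m) (H m p)).1).comp
        (p.1, (H m p).1) hasFDerivAt_snd) ?_
      ext <;> simp) (fun w => hf.lip (u m) (H m p)) (hf.inv m p)
  rw [h1.fderiv]
  ext
  simp [slopeStep]

variable {C₀ : ℝ} (hC₀ : 0 ≤ C₀)
  (hF' : ∀ m z z', ‖fderiv ℝ (F m) z - fderiv ℝ (F m) z'‖ ≤ C₀ * ‖z - z'‖ ^ (1 : ℝ))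
  (hG' : ∀ m z z', ‖fderiv ℝ (G m) z - fderiv ℝ (G m) z'‖ ≤ C₀ * ‖z - z'‖ ^ (1 : ℝ))
  {μ : M → ℝ} {c₁ A : ℝ} (hμ : Bunched H ls Λ μ c₁ A)

include S hF hG hC₀ hF' hG' hμ in
/-- The foliation is differentiable, with uniform approximations of the derivative. -/
theorem exists_hasFDerivAt_foliation (hf : InvariantFamily H r f)
    (hH : ∀ m, ContDiff ℝ 1 (H m)) : ∃ C : ℝ, 0 ≤ C ∧
    ∀ (m : M) (z : (X m × Y m) × X m), DifferentiableAt ℝ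
        (fun w : (X m × Y m) × X m => f m w.1 w.2) z ∧
      ∀ n, ‖fderiv ℝ (fun w : (X m × Y m) × X m => f m w.1 w.2) z -
        (verticalSlope H F G f n m z.1 (z.2, f m z.1 z.2)).coprod
          (fderiv ℝ (f m (z.2, f m z.1 z.2)) z.2)‖ ≤ C * (dist z.2 z.1.1 + 2) * c₁ ^ n := by
  have hκ := S.one_sub_pos
  have hA : 0 ≤ A := zero_le_one.trans hμ.one_le
  obtain ⟨C, hC, hvert⟩ := S.exists_vertical_bound hF hG hC₀ hF' hG' hμ hf
  -- For a pair (q, q') the initial section is the leaf of q shifted vertically to pass through q'.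
  -- By `hvert` its error carries a factor |q - q'|, and bunching makes the n-th error O(c₁^n |q -
  -- q'|), that is, of first order in q'.
  obtain ⟨φ, h0, hlip, hinv, happ⟩ := S.exists_approximants (pairMap H)
    (fun _ d => d.2) (fun _ _ => rfl) (f := fun m d => f m d.2)
    (g := fun m d x => f m d.1 x + (d.2.2 - f m d.1 d.2.1)) (fun m d => hf.lip m d.2)
    (fun m d x x' => by simpa using hf.lip m d.1 x x') (fun m d => hf.base m d.2)
    (fun m d => hf.inv m d.2) (e := fun i => C * dist i.2.1 i.2.2)
    (fun i => by positivity) (fun m d x => hvert m d.1 d.2 x)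
  have happ' : ∀ n m (q q' : X m × Y m) x, dist (φ n m (q, q') x) (f m q' x) ≤
      (1 - κ)⁻¹ * C * A * c₁ ^ n * dist q q' * dist x q'.1 := fun n m q q' x => by
    refine (happ n m (q, q') x).trans ?_
    have h1 := pair_iterate (H := H) (fun m p p' => dist p p') n m q q'
    have h2 := hμ.dist_iter n m q q'
    have h3 := S.bunched_rate_le hμ n m
    have h4 := mul_nonneg (cocycle_nonneg (u := u) S.Λ_nonneg n m)
      (cocycle_nonneg (u := u) S.ls_nonneg n m)
    dsimp only at h1 ⊢
    rw [h1]
    calc _ ≤ (1 - κ)⁻¹ * (cocycle u Λ n m * cocycle u ls n m *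
          (C * (A * cocycle u μ n m * dist q q')) * dist x q'.1) := by gcongr
      _ = (1 - κ)⁻¹ * C * A * (cocycle u Λ n m * cocycle u ls n m * cocycle u μ n m) *
          dist q q' * dist x q'.1 := by ring
      _ ≤ _ := by gcongr
  have hbase : ∀ n m q x, φ n m (q, q) x = f m q x := fun n m q x => by
    have := happ' n m q q x
    rw [dist_self, mul_zero, zero_mul] at this
    exact dist_le_zero.1 this
  have hd : ∀ n m (q : X m × Y m) (x : X m), HasFDerivAt
      (fun w : (X m × Y m) × X m => φ n m (q, w.1) w.2)
      ((verticalSlope H F G f n m q (x, f m q x)).coprod (fderiv ℝ (f m (x, f m q x)) x))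
      (q, x) := by
    intro n
    induction n with
    | zero =>
      intro m q x
      rw [h0]
      have h1 : HasFDerivAt (fun w : (X m × Y m) × X m => f m q w.2) _ (q, x) :=
        (S.hasFDerivAt_leaf hF hG hf m q x).comp (q, x) hasFDerivAt_snd
      have h2 : HasFDerivAt (fun w : (X m × Y m) × X m => f m q w.1.1) _ (q, x) :=
        ((S.hasFDerivAt_leaf_base hF hG hf m q).1).comp (q, x) hasFDerivAt_fst.fst
      have h3 : HasFDerivAt (fun w : (X m × Y m) × X m => w.1.2) _ (q, x) :=
        (hasFDerivAt_fst (𝕜 := ℝ) (p := (q, x))).snd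
      refine (h1.add (h3.sub h2)).congr_fderiv ?_
      ext <;> simp [verticalSlope]
    | succ n ih =>
      intro m q x
      set p : X m × Y m := (x, f m q x) with hp
      have hp2 : (H m p).2 = f (u m) (H m q) (H m p).1 := hf.inv m q x
      have hIH := ih (u m) (H m q) (H m p).1
      have hp3 : ((H m p).1, f (u m) (H m q) (H m p).1) = H m p := Prod.ext rfl hp2.symm
      rw [hp3] at hIH
      have hHd : HasFDerivAt (H m) (fderiv ℝ (H m) q) q :=
        ((hH m).differentiable one_ne_zero q).hasFDerivAt
      have hin : HasFDerivAt (fun z : ((X m × Y m) × X m) × X (u m) => (H m z.1.1, z.2))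
          _ ((q, x), (H m p).1) :=
        (hHd.comp ((q, x), (H m p).1) hasFDerivAt_fst.fst).prodMk hasFDerivAt_snd
      have hcomp := hIH.comp ((q, x), (H m p).1) hin
      have h1 := S.hasFDerivAt_transform hF hG (E := (X m × Y m) × X m) (ξ := fun w => w.2)
        (y := fun w => φ (n + 1) m (q, w.1) w.2)
        (h := fun z => φ n (u m) (H m q, H m z.1.1) z.2) (w₀ := (q, x))
        (A := ((verticalSlope H F G f n (u m) (H m q) (H m p)).comp (fderiv ℝ (H m) q)).comp
          (ContinuousLinearMap.fst ℝ _ _))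
        (K := fderiv ℝ (f (u m) (H m p)) (H m p).1) (p := p) (by rw [hbase])
        hasFDerivAt_snd (by
          refine HasFDerivAt.congr_fderiv hcomp ?_
          ext <;> simp) (fun w => hlip n (u m) (H m q, H m w.1))
        (fun w => hinv n m (q, w.1) w.2)
      refine h1.congr_fderiv ?_
      -- At q' = q every approximation restricts to the leaf of q, so its x-derivative is the slope
      -- of the leaf for all n; only the part in q' changes.
      have h2 := S.fderiv_base_eq hF hG hf m p
      have h3 : (fderiv ℝ (f m p) x) = slopeStep H F G m p (fderiv ℝ (f (u m) (H m p)) (H m p).1) :=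
        h2
      rw [h3]
      ext <;> simp [verticalSlope, slopeStep]
  refine ⟨(1 - κ)⁻¹ * C * A, by positivity, ?_⟩
  rintro m ⟨q, x⟩
  obtain ⟨L, hL, hLn⟩ := exists_hasFDerivAt_of_approx
    (φ := fun w : (X m × Y m) × X m => f m w.1 w.2) (fun n => hd n m q x)
    (fun n => hbase n m q x) (ε := fun n => (1 - κ)⁻¹ * C * A * (dist x q.1 + 2) * c₁ ^ n)
    (fun n => by have := pow_nonneg hμ.c_nonneg n; positivity)
    (fun n => by
      filter_upwards [Metric.ball_mem_nhds (q, x) one_pos] with w hw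
      have h1 := happ' n m q w.1 w.2
      have h2 : dist w.2 x < 1 := (le_max_right _ _).trans_lt hw
      have h3 : dist w.1 q < 1 := (le_max_left _ _).trans_lt hw
      have h4 : dist w.1.1 q.1 < 1 := (le_max_left _ _).trans_lt h3
      -- The 2 comes from the unit ball: x and the base point each move by less than 1.
      have h5 : dist w.2 w.1.1 ≤ dist x q.1 + 2 := by
        have := dist_triangle4 w.2 x q.1 w.1.1
        rw [dist_comm q.1] at this
        linarith
      have h6 : dist q w.1 ≤ dist w (q, x) := by
        rw [dist_comm]
        exact le_max_left _ _
      have h7 := pow_nonneg hμ.c_nonneg n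
      rw [← dist_eq_norm, ← dist_eq_norm, dist_comm]
      calc _ ≤ _ := h1
        _ ≤ (1 - κ)⁻¹ * C * A * c₁ ^ n * dist w (q, x) * (dist x q.1 + 2) := by gcongr
        _ = _ := by ring)
    (by
      simpa using (tendsto_pow_atTop_nhds_zero_of_lt_one hμ.c_nonneg hμ.c_lt).const_mul
        ((1 - κ)⁻¹ * C * A * (dist x q.1 + 2)))
  refine ⟨hL.differentiableAt, fun n => ?_⟩
  rw [hL.fderiv]
  exact hLn n

end GraphSystem

end Bunching

/-- The product rule behind one recursion step of `verticalSlope`: size and variation of the middle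
factor, measured by ρ, both grow by at most 3b³. -/
theorem norm_comp_comp_le_and_sub_le {E₁ E₂ E₃ E₄ : Type*}
    [NormedAddCommGroup E₁] [NormedSpace ℝ E₁] [NormedAddCommGroup E₂] [NormedSpace ℝ E₂]
    [NormedAddCommGroup E₃] [NormedSpace ℝ E₃] [NormedAddCommGroup E₄] [NormedSpace ℝ E₄]
    {U U' : E₃ →L[ℝ] E₄} {V V' : E₂ →L[ℝ] E₃} {W W' : E₁ →L[ℝ] E₂} {b ρ δ : ℝ}
    (hb1 : 1 ≤ b) (hρ : 0 ≤ ρ) (hδ : 0 ≤ δ) (hU : ‖U‖ ≤ b) (hU' : ‖U'‖ ≤ b)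
    (hUU : ‖U - U'‖ ≤ b * δ) (hV : ‖V‖ ≤ ρ) (hV' : ‖V'‖ ≤ ρ) (hVV : ‖V - V'‖ ≤ ρ * (b * δ))
    (hW : ‖W‖ ≤ b) (hWW : ‖W - W'‖ ≤ b * δ) :
    ‖U.comp (V.comp W)‖ ≤ 3 * b ^ 3 * ρ ∧
      ‖U.comp (V.comp W) - U'.comp (V'.comp W')‖ ≤ 3 * b ^ 3 * ρ * δ := by
  have hb0 : 0 ≤ b := zero_le_one.trans hb1
  have hb2 : b ^ 2 ≤ b ^ 3 := pow_le_pow_right₀ hb1 (by norm_num)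
  have hb3 : 0 ≤ b ^ 3 := pow_nonneg hb0 3
  have comp3 : ∀ (P : E₃ →L[ℝ] E₄) (Q : E₂ →L[ℝ] E₃) (T : E₁ →L[ℝ] E₂),
      ‖P.comp (Q.comp T)‖ ≤ ‖P‖ * (‖Q‖ * ‖T‖) :=
    fun P Q T => (P.opNorm_comp_le _).trans
      (mul_le_mul_of_nonneg_left (Q.opNorm_comp_le T) (norm_nonneg _))
  constructor
  · calc ‖U.comp (V.comp W)‖ ≤ ‖U‖ * (‖V‖ * ‖W‖) := comp3 _ _ _
      _ ≤ b * (ρ * b) := by gcongr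
      _ = b ^ 2 * ρ := by ring
      _ ≤ 3 * b ^ 3 * ρ := by
        gcongr
        linarith
  · have e1 : U.comp (V.comp W) - U'.comp (V'.comp W') =
        (U - U').comp (V.comp W) + U'.comp ((V - V').comp W) + U'.comp (V'.comp (W - W')) := by
      simp only [ContinuousLinearMap.sub_comp, ContinuousLinearMap.comp_sub]
      abel
    rw [e1]
    calc _ ≤ ‖U - U'‖ * (‖V‖ * ‖W‖) + ‖U'‖ * (‖V - V'‖ * ‖W‖) + ‖U'‖ * (‖V'‖ * ‖W - W'‖) :=
          (norm_add_le _ _).trans (add_le_add ((norm_add_le _ _).trans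
            (add_le_add (comp3 _ _ _) (comp3 _ _ _))) (comp3 _ _ _))
      _ ≤ (b * δ) * (ρ * b) + b * (ρ * (b * δ) * b) + b * (ρ * (b * δ)) := by gcongr
      _ = (2 * b ^ 2 + b ^ 3) * ρ * δ := by ring
      _ ≤ 3 * b ^ 3 * ρ * δ := by
        gcongr
        linarith

/-! ### C¹ foliations with Hölder derivatives. -/

section Foliation

variable {M : Type*} {X : M → Type*} {Y : M → Type*} {u : M → M}
  [∀ m, NormedAddCommGroup (X m)] [∀ m, NormedSpace ℝ (X m)]
  [∀ m, NormedAddCommGroup (Y m)] [∀ m, NormedSpace ℝ (Y m)]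
  {H : ∀ m, X m × Y m → X (u m) × Y (u m)}
  {F : ∀ m, X m × Y (u m) → X (u m)} {G : ∀ m, X m × Y (u m) → Y m}
  {α lu r ls Λ : M → ℝ} {κ c B : ℝ} {f : ∀ m, X m × Y m → X m → Y m}

theorem norm_coprod_le_add {E E' V : Type*} [NormedAddCommGroup E] [NormedSpace ℝ E]
    [NormedAddCommGroup E'] [NormedSpace ℝ E'] [NormedAddCommGroup V] [NormedSpace ℝ V]
    (S : E →L[ℝ] V) (T : E' →L[ℝ] V) : ‖S.coprod T‖ ≤ ‖S‖ + ‖T‖ := by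
  refine ContinuousLinearMap.opNorm_le_bound _ (by positivity) fun z => ?_
  rw [ContinuousLinearMap.coprod_apply, add_mul]
  refine (norm_add_le _ _).trans (add_le_add ?_ ?_)
  · exact (S.le_opNorm _).trans (by gcongr; exact norm_fst_le z)
  · exact (T.le_opNorm _).trans (by gcongr; exact norm_snd_le z)

theorem norm_comp_inr_sub_le {E E' V : Type*} [NormedAddCommGroup E] [NormedSpace ℝ E]
    [NormedAddCommGroup E'] [NormedSpace ℝ E'] [NormedAddCommGroup V] [NormedSpace ℝ V]
    (S T : E × E' →L[ℝ] V) : ‖S.comp (ContinuousLinearMap.inr ℝ E E') -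
      T.comp (ContinuousLinearMap.inr ℝ E E')‖ ≤ ‖S - T‖ := by
  rw [← ContinuousLinearMap.sub_comp]
  exact ((S - T).opNorm_comp_le _).trans (mul_le_of_le_one_right (norm_nonneg _)
    (ContinuousLinearMap.norm_inr_le_one ℝ E E'))

namespace GraphSystem

variable (S : GraphSystem H F G α lu r ls Λ κ c B) (hF : ∀ m, ContDiff ℝ 1 (F m))
  (hG : ∀ m, ContDiff ℝ 1 (G m)) [∀ m, CompleteSpace (X m)] [∀ m, CompleteSpace (Y m)]
  {C₀ : ℝ} (hC₀ : 0 ≤ C₀)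
  (hF' : ∀ m z z', ‖fderiv ℝ (F m) z - fderiv ℝ (F m) z'‖ ≤ C₀ * ‖z - z'‖ ^ (1 : ℝ))
  (hG' : ∀ m z z', ‖fderiv ℝ (G m) z - fderiv ℝ (G m) z'‖ ≤ C₀ * ‖z - z'‖ ^ (1 : ℝ))
  {μ : M → ℝ} {c₁ A : ℝ} (hμ : Bunched H ls Λ μ c₁ A)

include S hF hG in
theorem continuous_fderiv_base_self (hf : InvariantFamily H r f) (hH : ∀ m, Continuous (H m))
    (m : M) : Continuous fun p : X m × Y m => fderiv ℝ (f m p) p.1 :=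
  S.continuous_fderiv_base hF hG hf (φ := fun p => p) fun k => continuous_iter hH k m

include S hF hG in
theorem continuous_verticalSlope (hf : InvariantFamily H r f) (hH : ∀ m, ContDiff ℝ 1 (H m))
    (n : ℕ) : ∀ m, Continuous fun d : (X m × Y m) × (X m × Y m) =>
      verticalSlope H F G f n m d.1 d.2 := by
  have hHc : ∀ m, Continuous (H m) := fun m => (hH m).continuous
  have hK := S.continuous_fderiv_base_self hF hG hf hHc
  induction n with
  | zero => exact fun m => continuous_const.sub (((hK m).comp continuous_fst).clm_comp
      continuous_const)
  | succ n ih =>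
    intro m
    have h1 : Continuous fun d : (X m × Y m) × (X m × Y m) => H m d.2 :=
      (hHc m).comp continuous_snd
    have h2 : Continuous fun d : (X m × Y m) × (X m × Y m) => (H m d.1, H m d.2) :=
      ((hHc m).comp continuous_fst).prodMk h1
    exact (S.continuous_transverse hF hG continuous_snd h1 ((hK (u m)).comp h1)
      fun d => S.norm_fderiv_base_le hF hG hf (u m) (H m d.2)).clm_comp
      (((ih (u m)).comp h2).clm_comp
        (((hH m).continuous_fderiv one_ne_zero).comp continuous_fst))

include S hF hG hC₀ hF' hG' hμ in
theorem isC1Foliation (hf : InvariantFamily H r f) (hH : ∀ m, ContDiff ℝ 1 (H m)) :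
    IsC1Foliation f := by
  intro m
  have hHc : ∀ m, Continuous (H m) := fun m => (hH m).continuous
  obtain ⟨C, hC, h⟩ := S.exists_hasFDerivAt_foliation hF hG hC₀ hF' hG' hμ hf hH
  rw [contDiff_one_iff_fderiv]
  refine ⟨fun z => (h m z).1, ?_⟩
  have h1 : Continuous fun z : (X m × Y m) × X m => (z.2, f m z.1 z.2) :=
    continuous_snd.prodMk (S.continuous_family hf hHc m)
  refine continuous_of_geometric_approx hμ.c_nonneg hμ.c_lt (fun n => ?_)
    (g := fun z => C * (dist z.2 z.1.1 + 2)) (by fun_prop) fun n z => (h m z).2 n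
  have h2 := (S.continuous_verticalSlope hF hG hf hH n m).comp (continuous_fst.prodMk h1)
  have h3 := (S.continuous_fderiv_base_self hF hG hf hHc m).comp h1
  have h4 := (h2.clm_comp (continuous_const (y := ContinuousLinearMap.fst ℝ (X m × Y m) (X m)))).add
    (h3.clm_comp (continuous_const (y := ContinuousLinearMap.snd ℝ (X m × Y m) (X m))))
  refine h4.congr fun z => ?_
  ext <;> simp

include S hF hG hC₀ hF' hG' hμ in
-- The derivatives of `F` and `G` are Lipschitz, the slopes are Lipschitz by bunching, and the
-- resolvent is Lipschitz on operators of norm at most κ.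
theorem exists_transverse_lipschitz (hf : InvariantFamily H r f) {K : ℝ} (hK : 0 ≤ K)
    (hHL : ∀ m z z', dist (H m z) (H m z') ≤ K * dist z z') : ∃ b : ℝ, 0 ≤ b ∧
    ∀ (m : M) (p p' : X m × Y m),
      ‖transverse H F G m p (fderiv ℝ (f (u m) (H m p)) (H m p).1)‖ ≤ b ∧
      ‖transverse H F G m p (fderiv ℝ (f (u m) (H m p)) (H m p).1) -
        transverse H F G m p' (fderiv ℝ (f (u m) (H m p')) (H m p').1)‖ ≤ b * dist p p' := by
  obtain ⟨C, hC, hlip⟩ := S.exists_slope_lipschitz hF hG hC₀ hF' hG' hμ hf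
  have hκ := S.one_sub_pos
  have hB := S.B_nonneg
  set D := C₀ * (1 + K) with hD
  set E := (1 - κ)⁻¹ * (1 - κ)⁻¹ * (C * K * B + B * D) with hE
  have hD0 : 0 ≤ D := by positivity
  have hE0 : 0 ≤ E := by positivity
  refine ⟨B * (1 - κ)⁻¹ + (D * (1 - κ)⁻¹ + B * E), by positivity, fun m p p' => ?_⟩
  set k := fderiv ℝ (f (u m) (H m p)) (H m p).1 with hk
  set k' := fderiv ℝ (f (u m) (H m p')) (H m p').1 with hk'
  have hkr : ‖k‖ ≤ r (u m) := S.norm_fderiv_base_le hF hG hf (u m) (H m p)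
  have hkr' : ‖k'‖ ≤ r (u m) := S.norm_fderiv_base_le hF hG hf (u m) (H m p')
  have hz : ‖((p.1, (H m p).2) : X m × Y (u m)) - (p'.1, (H m p').2)‖ ≤ (1 + K) * dist p p' := by
    rw [← dist_eq_norm]
    have h1 : dist p.1 p'.1 ≤ dist p p' := le_max_left _ _
    have h2 : dist (H m p).2 (H m p').2 ≤ dist (H m p) (H m p') := le_max_right _ _
    have h3 := hHL m p p'
    have h4 : 0 ≤ dist p p' := dist_nonneg
    have h5 := mul_nonneg hK h4
    exact max_le (by change dist p.1 p'.1 ≤ _; linarith)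
      (by change dist (H m p).2 (H m p').2 ≤ _; linarith)
  have hdF : ‖dF₂ H F m p - dF₂ H F m p'‖ ≤ D * dist p p' := by
    refine (norm_comp_inr_sub_le _ _).trans ((hF' m _ _).trans ?_)
    rw [Real.rpow_one, hD, mul_assoc]
    gcongr
  have hdG : ‖dG₂ H G m p - dG₂ H G m p'‖ ≤ D * dist p p' := by
    refine (norm_comp_inr_sub_le _ _).trans ((hG' m _ _).trans ?_)
    rw [Real.rpow_one, hD, mul_assoc]
    gcongr
  have hG2 : ∀ p, ‖dG₂ H G m p‖ ≤ B := fun p => (S.norm_dG₂_le hG m p).trans (S.lu_le m)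
  have hF2 : ∀ p, ‖dF₂ H F m p‖ ≤ B := fun p => (S.norm_dF₂_le hF m p).trans (S.α_le m)
  have hA := S.norm_comp_dF₂_le hF p hkr
  have hA' := S.norm_comp_dF₂_le hF p' hkr'
  have hJ := norm_resolvent₁_le hA S.κ_lt
  have hkk : ‖k - k'‖ ≤ C * K * dist p p' := by
    refine (hlip (u m) (H m p) (H m p')).trans ?_
    rw [mul_assoc]
    gcongr
    exact hHL m p p'
  have hAA : ‖k.comp (dF₂ H F m p) - k'.comp (dF₂ H F m p')‖ ≤
      (C * K * B + B * D) * dist p p' := by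
    have e1 : k.comp (dF₂ H F m p) - k'.comp (dF₂ H F m p') =
        (k - k').comp (dF₂ H F m p) + k'.comp (dF₂ H F m p - dF₂ H F m p') := by
      rw [ContinuousLinearMap.sub_comp, ContinuousLinearMap.comp_sub]
      abel
    rw [e1]
    calc _ ≤ ‖k - k'‖ * ‖dF₂ H F m p‖ + ‖k'‖ * ‖dF₂ H F m p - dF₂ H F m p'‖ :=
          (norm_add_le _ _).trans (add_le_add ((k - k').opNorm_comp_le _) (k'.opNorm_comp_le _))
      _ ≤ (C * K * dist p p') * B + B * (D * dist p p') := by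
        gcongr
        exacts [hF2 p, hkr'.trans (S.r_le _)]
      _ = _ := by ring
  have hJJ : ‖resolvent₁ (k.comp (dF₂ H F m p)) - resolvent₁ (k'.comp (dF₂ H F m p'))‖ ≤
      E * dist p p' := by
    refine (norm_resolvent₁_sub_le hA hA' S.κ_lt).trans ?_
    rw [hE, mul_assoc _ (C * K * B + B * D)]
    gcongr
  constructor
  · have h1 : ‖transverse H F G m p k‖ ≤ B * (1 - κ)⁻¹ :=
      ((dG₂ H G m p).opNorm_comp_le _).trans (by gcongr; exact hG2 p)
    have h2 : 0 ≤ D * (1 - κ)⁻¹ + B * E := by positivity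
    exact h1.trans (le_add_of_nonneg_right h2)
  · have e1 : transverse H F G m p k - transverse H F G m p' k' =
        (dG₂ H G m p - dG₂ H G m p').comp (resolvent₁ (k.comp (dF₂ H F m p))) +
        (dG₂ H G m p').comp (resolvent₁ (k.comp (dF₂ H F m p)) -
          resolvent₁ (k'.comp (dF₂ H F m p'))) := by
      rw [ContinuousLinearMap.sub_comp, ContinuousLinearMap.comp_sub, transverse, transverse]
      abel
    rw [e1]
    calc _ ≤ ‖dG₂ H G m p - dG₂ H G m p'‖ * ‖resolvent₁ (k.comp (dF₂ H F m p))‖ +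
          ‖dG₂ H G m p'‖ * ‖resolvent₁ (k.comp (dF₂ H F m p)) -
            resolvent₁ (k'.comp (dF₂ H F m p'))‖ :=
          (norm_add_le _ _).trans (add_le_add (ContinuousLinearMap.opNorm_comp_le _ _)
            (ContinuousLinearMap.opNorm_comp_le _ _))
      _ ≤ (D * dist p p') * (1 - κ)⁻¹ + B * (E * dist p p') := by
        gcongr
        exact hG2 p'
      _ = (D * (1 - κ)⁻¹ + B * E) * dist p p' := by ring
      _ ≤ _ := by
        have h2 : 0 ≤ B * (1 - κ)⁻¹ := by positivity
        exact mul_le_mul_of_nonneg_right (le_add_of_nonneg_left h2) dist_nonneg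

include S hF hG hC₀ hF' hG' hμ in
/-- The vertical slopes are Lipschitz, with constants that grow exponentially. -/
theorem exists_verticalSlope_lipschitz (hf : InvariantFamily H r f) {K : ℝ} (hK : 0 ≤ K)
    (hHL : ∀ m z z', dist (H m z) (H m z') ≤ K * dist z z')
    (hHd : ∀ m z z', ‖fderiv ℝ (H m) z‖ ≤ K ∧
      ‖fderiv ℝ (H m) z - fderiv ℝ (H m) z'‖ ≤ K * dist z z') :
    ∃ b R : ℝ, 0 ≤ b ∧ 0 ≤ R ∧ ∀ n m (q q' p p' : X m × Y m) (δ : ℝ), dist q q' ≤ δ →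
      dist p p' ≤ δ → ‖verticalSlope H F G f n m q p‖ ≤ R ^ n * b ∧
      ‖verticalSlope H F G f n m q p - verticalSlope H F G f n m q' p'‖ ≤ R ^ n * b * δ := by
  obtain ⟨C, hC, hlip⟩ := S.exists_slope_lipschitz hF hG hC₀ hF' hG' hμ hf
  obtain ⟨b₀, hb₀, htr⟩ := S.exists_transverse_lipschitz hF hG hC₀ hF' hG' hμ hf hK hHL
  have hB := S.B_nonneg
  set b := 1 + B + C + b₀ + K with hb
  have hb1 : 1 ≤ b := by linarith
  have hbb : b₀ ≤ b := by linarith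
  have hKb : K ≤ b := by linarith
  have hb0 : 0 ≤ b := zero_le_one.trans hb1
  refine ⟨b, 3 * b ^ 3, hb0, by positivity, fun n => ?_⟩
  induction n with
  | zero =>
    intro m q q' p p' δ hq hp
    have hδ : 0 ≤ δ := dist_nonneg.trans hq
    have hfst : ∀ T : X m →L[ℝ] Y m, ‖T.comp (ContinuousLinearMap.fst ℝ (X m) (Y m))‖ ≤ ‖T‖ :=
      fun T => (T.opNorm_comp_le _).trans (mul_le_of_le_one_right (norm_nonneg _)
        (ContinuousLinearMap.norm_fst_le ..))
    rw [pow_zero, one_mul]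
    constructor
    · have h1 : ‖ContinuousLinearMap.snd ℝ (X m) (Y m)‖ ≤ 1 := ContinuousLinearMap.norm_snd_le ..
      have h2 := (hfst (fderiv ℝ (f m q) q.1)).trans
        ((S.norm_fderiv_base_le hF hG hf m q).trans (S.r_le m))
      refine (norm_sub_le _ _).trans ?_
      linarith
    · have e1 : verticalSlope H F G f 0 m q p - verticalSlope H F G f 0 m q' p' =
          -((fderiv ℝ (f m q) q.1 - fderiv ℝ (f m q') q'.1).comp
            (ContinuousLinearMap.fst ℝ (X m) (Y m))) := by
        rw [ContinuousLinearMap.sub_comp, verticalSlope, verticalSlope]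
        abel
      rw [e1, norm_neg]
      refine (hfst _).trans ((hlip m q q').trans ?_)
      have hCb : C ≤ b := by linarith
      gcongr
  | succ n ih =>
    intro m q q' p p' δ hq hp
    have hδ : 0 ≤ δ := dist_nonneg.trans hq
    have hHq : dist (H m q) (H m q') ≤ b * δ := (hHL m q q').trans (by gcongr)
    have hHp : dist (H m p) (H m p') ≤ b * δ := (hHL m p p').trans (by gcongr)
    -- The separation δ grows by a factor b per step, which is why it is quantified inside the
    -- induction.
    obtain ⟨i1, i2⟩ := ih (u m) (H m q) (H m q') (H m p) (H m p') (b * δ) hHq hHp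
    obtain ⟨i1', -⟩ := ih (u m) (H m q') (H m q) (H m p') (H m p) (b * δ)
      (by rwa [dist_comm]) (by rwa [dist_comm])
    have hpow : (3 * b ^ 3) ^ (n + 1) * b = 3 * b ^ 3 * ((3 * b ^ 3) ^ n * b) := by
      rw [pow_succ]
      ring
    rw [hpow]
    exact norm_comp_comp_le_and_sub_le hb1 (by positivity) hδ ((htr m p p').1.trans hbb)
      ((htr m p' p).1.trans hbb) ((htr m p p').2.trans (by gcongr)) i1 i1' i2
      ((hHd m q q').1.trans hKb) ((hHd m q q').2.trans (by gcongr))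

include S hF hG hC₀ hF' hG' hμ in
-- The error c₁^n of the n-th approximate derivative is balanced against its Lipschitz constant,
-- which is O(R^n).
theorem exists_isUniformLocallyC1HolderFoliation (hf : InvariantFamily H r f)
    (hH : ∀ m, ContDiff ℝ 1 (H m)) {K : ℝ} (hK : 0 ≤ K)
    (hHL : ∀ m z z', dist (H m z) (H m z') ≤ K * dist z z')
    (hHd : ∀ m z z', ‖fderiv ℝ (H m) z‖ ≤ K ∧
      ‖fderiv ℝ (H m) z - fderiv ℝ (H m) z'‖ ≤ K * dist z z') :
    ∃ s : ℝ, 0 < s ∧ s ≤ 1 ∧ IsUniformLocallyC1HolderFoliation s f := by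
  have hB := S.B_nonneg
  obtain ⟨C₁, hC₁, hder⟩ := S.exists_hasFDerivAt_foliation hF hG hC₀ hF' hG' hμ hf hH
  obtain ⟨C₂, hC₂, hlip⟩ := S.exists_slope_lipschitz hF hG hC₀ hF' hG' hμ hf
  obtain ⟨C₃, hC₃, hvert⟩ := S.exists_vertical_bound hF hG hC₀ hF' hG' hμ hf
  obtain ⟨b, R, hb, hR, hvs⟩ := S.exists_verticalSlope_lipschitz hF hG hC₀ hF' hG' hμ hf hK hHL hHd
  obtain ⟨θ, J, hθ0, hθ1, hJ0, hJ⟩ := exists_rpow_bound (R := max 1 R) (c := c₁)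
    (by positivity) hμ.c_nonneg hμ.c_lt
  refine ⟨θ, hθ0, hθ1, S.isC1Foliation hF hG hC₀ hF' hG' hμ hf hH, fun ρ hρ => ?_⟩
  -- N compares the points of two leaves over x and x' with the parameters: B for moving along a
  -- leaf, 2B for the vertical gap at q', and C₃ρ for the change of that gap between q'_X and x'.
  set N := 1 + (B + C₃ * ρ + 2 * B) with hN
  have hN0 : 0 ≤ N := by positivity
  set E := 2 * (C₁ * (ρ + 2)) + (b + C₂) * N with hE
  have hE0 : 0 ≤ E := by positivity
  set V := C₁ * (ρ + 2) + (b + B) with hV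
  have hV0 : 0 ≤ V := by positivity
  refine ⟨V + E * J * (1 + ρ), fun m z z' hzz => ?_⟩
  obtain ⟨h1, h2, h3⟩ := hzz
  set δ := dist z z' with hδ
  have hδ0 : 0 ≤ δ := dist_nonneg
  have hx : dist z.2 z'.2 ≤ δ := le_max_right _ _
  have hq : dist z.1 z'.1 ≤ δ := le_max_left _ _
  have hK0 : ∀ p : X m × Y m, ‖fderiv ℝ (f m p) p.1‖ ≤ B := fun p =>
    (S.norm_fderiv_base_le hF hG hf m p).trans (S.r_le m)
  constructor
  · have h4 := (hder m z).2 0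
    have h5 := (hvs 0 m z.1 z.1 (z.2, f m z.1 z.2) (z.2, f m z.1 z.2) 0 (by simp) (by simp)).1
    have h6 := norm_coprod_le_add (verticalSlope H F G f 0 m z.1 (z.2, f m z.1 z.2))
      (fderiv ℝ (f m (z.2, f m z.1 z.2)) z.2)
    have h7 := hK0 (z.2, f m z.1 z.2)
    rw [pow_zero, one_mul] at h5
    rw [pow_zero, mul_one] at h4
    dsimp only at h7
    have h8 := norm_le_insert' (fderiv ℝ (fun w : (X m × Y m) × X m => f m w.1 w.2) z)
      ((verticalSlope H F G f 0 m z.1 (z.2, f m z.1 z.2)).coprod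
        (fderiv ℝ (f m (z.2, f m z.1 z.2)) z.2))
    have h9 : C₁ * (dist z.2 z.1.1 + 2) ≤ C₁ * (ρ + 2) := by gcongr
    have h10 : 0 ≤ E * J * (1 + ρ) := by positivity
    linarith
  · set p : X m × Y m := (z.2, f m z.1 z.2) with hp
    set p' : X m × Y m := (z'.2, f m z'.1 z'.2) with hp'
    have hpp : dist p p' ≤ N * δ := by
      rw [Prod.dist_eq]
      refine max_le (hx.trans (le_mul_of_one_le_left hδ0 (by
        have : 0 ≤ B + C₃ * ρ + 2 * B := by positivity
        linarith))) ?_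
      have i1 := hf.lip m z.1 z.2 z'.2
      have i2 := hvert m z.1 z'.1 z'.2
      have i3 := S.dist_snd_leaf_le hf m z.1 z'.1
      have i4 : dist (f m z.1 z'.2) (f m z.1 z'.2 + (z'.1.2 - f m z.1 z'.1.1)) =
          dist (f m z.1 z'.1.1) z'.1.2 := by
        rw [dist_self_add_right, ← dist_eq_norm, dist_comm]
      have i5 := dist_triangle4 (f m z.1 z.2) (f m z.1 z'.2)
        (f m z.1 z'.2 + (z'.1.2 - f m z.1 z'.1.1)) (f m z'.1 z'.2)
      have i6 : r m * dist z.2 z'.2 ≤ B * δ := mul_le_mul (S.r_le m) hx dist_nonneg hB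
      have i7 : C₃ * dist z.1 z'.1 * dist z'.2 z'.1.1 ≤ C₃ * δ * ρ := by gcongr
      have i8 : 2 * B * dist z.1 z'.1 ≤ 2 * B * δ := by gcongr
      change dist (f m z.1 z.2) (f m z'.1 z'.2) ≤ N * δ
      rw [i4] at i5
      have : N * δ = δ + (B * δ + C₃ * δ * ρ + 2 * B * δ) := by
        rw [hN]
        ring
      linarith
    have key : ∀ n : ℕ, ‖fderiv ℝ (fun w : (X m × Y m) × X m => f m w.1 w.2) z -
        fderiv ℝ (fun w : (X m × Y m) × X m => f m w.1 w.2) z'‖ ≤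
        E * ((max 1 R) ^ n * δ + c₁ ^ n) := fun n => by
      have j1 := (hder m z).2 n
      have j2 := (hder m z').2 n
      rw [norm_sub_rev] at j2
      have hqN : dist z.1 z'.1 ≤ N * δ := hq.trans (le_mul_of_one_le_left hδ0 (by
        have : 0 ≤ B + C₃ * ρ + 2 * B := by positivity
        linarith))
      have j3 := (hvs n m z.1 z'.1 p p' (N * δ) hqN hpp).2
      have j4 := hlip m p p'
      have hcn := pow_nonneg hμ.c_nonneg n
      set T := verticalSlope H F G f n m z.1 p
      set T' := verticalSlope H F G f n m z'.1 p'
      set Q : X m →L[ℝ] Y m := fderiv ℝ (f m p) z.2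
      set Q' : X m →L[ℝ] Y m := fderiv ℝ (f m p') z'.2
      have j4' : ‖Q - Q'‖ ≤ C₂ * dist p p' := j4
      set Z := fderiv ℝ (fun w : (X m × Y m) × X m => f m w.1 w.2) z
      set Z' := fderiv ℝ (fun w : (X m × Y m) × X m => f m w.1 w.2) z'
      have e1 : Z - Z' = (Z - T.coprod Q) + (T - T').coprod (Q - Q') + (T'.coprod Q' - Z') := by
        have : (T - T').coprod (Q - Q') = T.coprod Q - T'.coprod Q' := by
          ext <;> simp
        rw [this]
        abel
      have j5 : 1 ≤ (max 1 R) ^ n := one_le_pow₀ (le_max_left _ _)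
      have j6 : R ^ n ≤ (max 1 R) ^ n := by
        gcongr
        exact le_max_right _ _
      have hNδ : 0 ≤ N * δ := by positivity
      rw [e1]
      calc _ ≤ ‖Z - T.coprod Q‖ + (‖T - T'‖ + ‖Q - Q'‖) + ‖T'.coprod Q' - Z'‖ :=
            (norm_add_le _ _).trans (add_le_add ((norm_add_le _ _).trans
              (add_le_add le_rfl (norm_coprod_le_add _ _))) le_rfl)
        _ ≤ C₁ * (dist z.2 z.1.1 + 2) * c₁ ^ n + (R ^ n * b * (N * δ) + C₂ * dist p p') +
            C₁ * (dist z'.2 z'.1.1 + 2) * c₁ ^ n := by gcongr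
        _ ≤ C₁ * (ρ + 2) * c₁ ^ n + ((max 1 R) ^ n * b * (N * δ) +
            C₂ * ((max 1 R) ^ n * (N * δ))) + C₁ * (ρ + 2) * c₁ ^ n := by
          gcongr
          exact hpp.trans (le_mul_of_one_le_left hNδ j5)
        _ = 2 * (C₁ * (ρ + 2)) * c₁ ^ n + (b + C₂) * N * ((max 1 R) ^ n * δ) := by ring
        _ ≤ E * c₁ ^ n + E * ((max 1 R) ^ n * δ) := by
          have k1 : 2 * (C₁ * (ρ + 2)) ≤ E := le_add_of_nonneg_right (by positivity)
          have k2 : (b + C₂) * N ≤ E := le_add_of_nonneg_left (by positivity)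
          gcongr
        _ = _ := by ring
    have hδθ : 0 ≤ δ ^ θ := Real.rpow_nonneg hδ0 _
    calc _ ≤ E * J * (1 + δ) * δ ^ θ := hJ E δ _ hE0 hδ0 key
      _ ≤ E * J * (1 + ρ) * δ ^ θ := by gcongr
      _ ≤ _ := by
        gcongr
        linarith

end GraphSystem

section LipschitzBound

variable {p : ℝ≥0∞} [Fact (1 ≤ p)] {ν : M → ℝ≥0}

omit [∀ m, NormedSpace ℝ (X m)] [∀ m, NormedSpace ℝ (Y m)] in
theorem LipschitzBound.dist_iter_toLp_le (h : LipschitzBound p H ν) (k : ℕ) :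
    ∀ m (z z' : X m × Y m), dist (WithLp.toLp p (iter H k m z)) (WithLp.toLp p (iter H k m z')) ≤
      cocycle u (fun m => (ν m : ℝ)) k m * dist (WithLp.toLp p z) (WithLp.toLp p z') := by
  induction k with
  | zero => intro m z z'; rw [cocycle_zero, one_mul]; exact le_rfl
  | succ k ih =>
    intro m z z'
    refine (ih (u m) (H m z) (H m z')).trans ?_
    rw [cocycle_succ, mul_comm ((ν m : ℝ)), mul_assoc]
    exact mul_le_mul_of_nonneg_left (h m z z') (cocycle_nonneg (fun m => (ν m).coe_nonneg) _ _)

omit [∀ m, NormedSpace ℝ (X m)] [∀ m, NormedSpace ℝ (Y m)] in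
-- The iteration is done for d_p, where the constants multiply exactly. The comparison with the
-- maximum metric is made once, at the two ends, and costs 2^{1/p}.
theorem LipschitzBound.dist_iter_le (h : LipschitzBound p H ν) (k : ℕ) (m : M)
    (z z' : X m × Y m) : dist (iter H k m z) (iter H k m z') ≤
      ((2 : ℝ≥0) ^ (1 / p).toReal : ℝ≥0) * cocycle u (fun m => (ν m : ℝ)) k m * dist z z' := by
  have h1 := (WithLp.prod_antilipschitzWith_toLp p (X (u^[k] m)) (Y (u^[k] m))).le_mul_dist
    (iter H k m z) (iter H k m z')
  have h2 := (WithLp.prod_lipschitzWith_toLp p (X m) (Y m)).dist_le_mul z z'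
  have h3 := h.dist_iter_toLp_le k m z z'
  have h4 := mul_le_mul_of_nonneg_left h2 (cocycle_nonneg (u := u) (fun m => (ν m).coe_nonneg) k m)
  rw [NNReal.coe_one, one_mul] at h1
  calc _ ≤ _ := h1
    _ ≤ _ := h3
    _ ≤ _ := h4
    _ = _ := by rw [← mul_assoc, mul_comm (cocycle u (fun m => (ν m : ℝ)) k m)]

omit [∀ m, NormedSpace ℝ (X m)] [∀ m, NormedSpace ℝ (Y m)] in
theorem LipschitzBound.exists_bunched (h : LipschitzBound p H ν) (hν : BddAbove (Set.range ν))
    {lu ls : M → ℝ≥0} {ϑ : M → ℝ}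
    (hsup : SupLtOne (fun m => (ν m : ℝ) * ls m * lu m * ϑ m)) :
    ∃ c A : ℝ, Bunched H (fun m => (ls m : ℝ)) (fun m => lu m * ϑ m) (fun m => (ν m : ℝ)) c A := by
  obtain ⟨c, hc, hcs⟩ := hsup
  obtain ⟨N, hN⟩ := hν
  have hA : 0 ≤ ((2 : ℝ≥0) ^ (1 / p).toReal : ℝ≥0).1 := NNReal.zero_le_coe
  have hN0 : (0 : ℝ) ≤ N := N.2
  refine ⟨max c 0, 1 + N + ((2 : ℝ≥0) ^ (1 / p).toReal : ℝ≥0),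
    { μ_nonneg := fun m => (ν m).coe_nonneg
      μ_le := fun m => ?_
      one_le := ?_
      rate := fun m => le_trans (le_of_eq (by ring)) ((hcs m).trans (le_max_left _ _))
      c_nonneg := le_max_right _ _
      c_lt := max_lt hc one_pos
      dist_iter := fun k m z z' => (h.dist_iter_le k m z z').trans ?_ }⟩
  · have h1 : (ν m : ℝ) ≤ N := hN ⟨m, rfl⟩
    have h2 : (0 : ℝ) ≤ ((2 : ℝ≥0) ^ (1 / p).toReal : ℝ≥0) := hA
    linarith
  · have h2 : (0 : ℝ) ≤ ((2 : ℝ≥0) ^ (1 / p).toReal : ℝ≥0) := hA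
    linarith
  · have := cocycle_nonneg (u := u) (fun m => (ν m).coe_nonneg) k m
    refine mul_le_mul_of_nonneg_right (mul_le_mul_of_nonneg_right ?_ this) dist_nonneg
    linarith

end LipschitzBound

theorem UniformC1Holder.exists_bound {ι : Type*} {E E' : ι → Type*}
    [∀ i, NormedAddCommGroup (E i)] [∀ i, NormedSpace ℝ (E i)]
    [∀ i, NormedAddCommGroup (E' i)] [∀ i, NormedSpace ℝ (E' i)] {γ : ℝ} {φ : ∀ i, E i → E' i}
    (h : UniformC1Holder γ φ) : ∃ C : ℝ, 0 ≤ C ∧ ∀ (i : ι) (x x' : E i),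
      ‖fderiv ℝ (φ i) x‖ ≤ C ∧ ‖fderiv ℝ (φ i) x - fderiv ℝ (φ i) x'‖ ≤ C * ‖x - x'‖ ^ γ := by
  obtain ⟨C, hC⟩ := h.2
  refine ⟨max C 0, le_max_right _ _, fun i x x' => ⟨(hC i x x').1.trans (le_max_left _ _),
    (hC i x x').2.trans ?_⟩⟩
  exact mul_le_mul_of_nonneg_right (le_max_left _ _) (Real.rpow_nonneg (norm_nonneg _) _)

end Foliation

/-! ### The smoothness statements under the original hypotheses. -/

section Smooth

variable {M : Type*} {X : M → Type*} {Y : M → Type*} {u : M → M}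
  [∀ m, NormedAddCommGroup (X m)] [∀ m, NormedSpace ℝ (X m)] [∀ m, CompleteSpace (X m)]
  [∀ m, NormedAddCommGroup (Y m)] [∀ m, NormedSpace ℝ (Y m)] [∀ m, CompleteSpace (Y m)]
  {H : ∀ m, X m × Y m → X (u m) × Y (u m)}
  {F : ∀ m, X m × Y (u m) → X (u m)} {G : ∀ m, X m × Y (u m) → Y m}
  {α lu β β' ls : M → ℝ≥0} {ϑ : M → ℝ} {f : ∀ m, X m × Y m → X m → Y m}

omit [∀ m, CompleteSpace (X m)] [∀ m, CompleteSpace (Y m)] in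
theorem exists_common_bound {γ : ℝ} (hF : UniformC1Holder γ F) (hG : UniformC1Holder γ G) :
    ∃ C : ℝ, 0 ≤ C ∧
      (∀ m z z', ‖fderiv ℝ (F m) z - fderiv ℝ (F m) z'‖ ≤ C * ‖z - z'‖ ^ γ) ∧
      ∀ m z z', ‖fderiv ℝ (G m) z - fderiv ℝ (G m) z'‖ ≤ C * ‖z - z'‖ ^ γ := by
  obtain ⟨C₁, h1, hF'⟩ := hF.exists_bound
  obtain ⟨C₂, h2, hG'⟩ := hG.exists_bound
  refine ⟨C₁ + C₂, add_nonneg h1 h2, fun m z z' => (hF' m z z').2.trans ?_,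
    fun m z z' => (hG' m z z').2.trans ?_⟩
  · exact mul_le_mul_of_nonneg_right (by linarith) (Real.rpow_nonneg (norm_nonneg _) _)
  · exact mul_le_mul_of_nonneg_right (by linarith) (Real.rpow_nonneg (norm_nonneg _) _)

theorem Hyperbolic.contDiff_leaves (h : Hyperbolic H F G α lu β β' ls ϑ)
    (hf : IsInvariantGraphFamily H β' (leaf f)) (hF : ∀ m, ContDiff ℝ 1 (F m))
    (hG : ∀ m, ContDiff ℝ 1 (G m)) :
    (∀ m q, ContDiff ℝ 1 (f m q)) ∧ ((∀ m, Continuous (H m)) → LeafDerivContinuous f) := by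
  obtain ⟨κ, c, B, S⟩ := h.exists_graphSystem
  have hf' := isInvariantGraphFamily_iff.1 hf
  exact ⟨S.contDiff_leaf hF hG hf', S.leafDerivContinuous hF hG hf'⟩

theorem Hyperbolic.uniformC1Holder_leaves (h : Hyperbolic H F G α lu β β' ls ϑ)
    (hf : IsInvariantGraphFamily H β' (leaf f)) {γ : ℝ} (hγ : 0 < γ) (hγ1 : γ ≤ 1)
    (hF : UniformC1Holder γ F) (hG : UniformC1Holder γ G) :
    (∃ ζ : ℝ, 0 < ζ ∧ ζ ≤ γ ∧
      UniformC1Holder ζ (fun (i : Σ m, X m × Y m) (x : X i.1) => f i.1 i.2 x)) ∧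
    (UniformLipschitz H → TangentUniformLocallyHolder f) := by
  obtain ⟨κ, c, B, S⟩ := h.exists_graphSystem
  have hf' := isInvariantGraphFamily_iff.1 hf
  obtain ⟨C, hC, hF', hG'⟩ := exists_common_bound hF hG
  exact ⟨S.exists_uniformC1Holder_leaves hF.1 hG.1 hC hF' hG' hγ hf',
    S.tangentUniformLocallyHolder hF.1 hG.1 hC hF' hG' hγ hγ1 hf'⟩

theorem Hyperbolic.isC1Foliation (h : Hyperbolic H F G α lu β β' ls ϑ)
    (hf : IsInvariantGraphFamily H β' (leaf f)) {p : ℝ≥0∞} [Fact (1 ≤ p)] {μ : M → ℝ≥0}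
    (hμ : BddAbove (Set.range μ)) (hH : LipschitzBound p H μ) (hF : UniformC1Holder 1 F)
    (hG : UniformC1Holder 1 G) (hsup : SupLtOne (fun m => (μ m : ℝ) * ls m * lu m * ϑ m)) :
    IsC1Foliation f ∧ (UniformC1Holder 1 H →
      ∃ s : ℝ, 0 < s ∧ s ≤ 1 ∧ IsUniformLocallyC1HolderFoliation s f) := by
  obtain ⟨κ, c, B, S⟩ := h.exists_graphSystem
  have hf' := isInvariantGraphFamily_iff.1 hf
  obtain ⟨C, hC, hF', hG'⟩ := exists_common_bound hF hG
  obtain ⟨c₁, A, hb⟩ := hH.exists_bunched hμ hsup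
  have hA := hb.one_le
  have hA0 : 0 ≤ A := zero_le_one.trans hA
  have hAA : 1 ≤ A * A := one_le_mul_of_one_le_of_one_le hA hA
  -- One factor A is the comparison of metrics, the other bounds μ.
  have hHL : ∀ m z z', dist (H m z) (H m z') ≤ A * A * dist z z' := fun m z z' => by
    refine (hb.dist_iter 1 m z z').trans ?_
    rw [cocycle_succ, cocycle_zero, mul_one]
    gcongr
    exact hb.μ_le m
  refine ⟨S.isC1Foliation hF.1 hG.1 hC hF' hG' hb hf' (S.contDiff_of_lipschitz hF.1 hG.1 hAA hHL),
    fun hH1 => ?_⟩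
  obtain ⟨C₁, hC₁, hHd⟩ := hH1.exists_bound
  refine S.exists_isUniformLocallyC1HolderFoliation hF.1 hG.1 hC hF' hG' hb hf' hH1.1
    (K := A * A + C₁) (by positivity) (fun m z z' => (hHL m z z').trans ?_) fun m z z' => ⟨?_, ?_⟩
  · gcongr
    linarith
  · have := (hHd m z z').1
    linarith
  · have h1 := (hHd m z z').2
    rw [Real.rpow_one, ← dist_eq_norm z z'] at h1
    refine h1.trans ?_
    gcongr
    linarith

end Smooth

end BundleFoliation

theorem theorem7p4 {M : Type a} (u : M → M) :
    (∀ (X : M → Type b) (Y : M → Type c)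
      [∀ m, MetricSpace (X m)] [∀ m, MetricSpace (Y m)]
      [∀ m, CompleteSpace (X m)] [∀ m, CompleteSpace (Y m)]
      (H : ∀ m, X m × Y m → X (u m) × Y (u m))
      (F : ∀ m, X m × Y (u m) → X (u m)) (G : ∀ m, X m × Y (u m) → Y m)
      (α lu β β' ls : M → ℝ≥0) (ϑ : M → ℝ),
      BundleFoliation.Hyperbolic H F G α lu β β' ls ϑ →
      ∃ f : ∀ m, X m × Y m → X m → Y m,
        -- existence and uniqueness of the invariant family of Lipschitz graphs
        BundleFoliation.IsInvariantGraphFamily H β' (BundleFoliation.leaf f) ∧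
        (∀ W : ∀ m, X m × Y m → Set (X m × Y m),
          BundleFoliation.IsInvariantGraphFamily H β' W → W = BundleFoliation.leaf f) ∧
        -- characterization of the leaves by the rate of approach
        (∀ (ς : ℝ) (ε : M → ℝ), 0 < ς → (∀ m, ls m + ς < ε m) →
          BundleFoliation.SupLtOne (fun m => ε m * lu m * ϑ m) →
          ∀ (m : M) (q : X m × Y m), BundleFoliation.leaf f m q =
            {p | ∃ C : ℝ, ∀ n : ℕ,
              dist (BundleFoliation.iter H n m p) (BundleFoliation.iter H n m q) ≤
                C * BundleFoliation.cocycle u ε n m}) ∧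
        -- the leaves partition the fibers, and form a continuous foliation
        (∀ (m : M) (q₁ q₂ : X m × Y m),
          (BundleFoliation.leaf f m q₁ ∩ BundleFoliation.leaf f m q₂).Nonempty →
            q₁ ∈ BundleFoliation.leaf f m q₂ ∧
            BundleFoliation.leaf f m q₁ = BundleFoliation.leaf f m q₂) ∧
        ((∀ m, Continuous (H m)) →
          ∀ m, Continuous (fun z : (X m × Y m) × X m => f m z.1 z.2)) ∧
        -- uniform local Hölder regularity of the foliation
        (BundleFoliation.UniformLipschitz H → BundleFoliation.UniformLocallyHolder f)) ∧
    (∀ (X : M → Type b) (Y : M → Type c)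
      [∀ m, NormedAddCommGroup (X m)] [∀ m, NormedSpace ℝ (X m)] [∀ m, CompleteSpace (X m)]
      [∀ m, NormedAddCommGroup (Y m)] [∀ m, NormedSpace ℝ (Y m)] [∀ m, CompleteSpace (Y m)]
      (H : ∀ m, X m × Y m → X (u m) × Y (u m))
      (F : ∀ m, X m × Y (u m) → X (u m)) (G : ∀ m, X m × Y (u m) → Y m)
      (α lu β β' ls : M → ℝ≥0) (ϑ : M → ℝ) (f : ∀ m, X m × Y m → X m → Y m),
      BundleFoliation.Hyperbolic H F G α lu β β' ls ϑ →
      BundleFoliation.IsInvariantGraphFamily H β' (BundleFoliation.leaf f) →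
        -- `C^1` leaves
        ((∀ m, ContDiff ℝ 1 (F m)) → (∀ m, ContDiff ℝ 1 (G m)) →
          (∀ m q, ContDiff ℝ 1 (f m q)) ∧
          ((∀ m, Continuous (H m)) → BundleFoliation.LeafDerivContinuous f)) ∧
        -- uniformly `C^{1,ζ}` leaves, and Hölder dependence of the tangent spaces
        (∀ γ : ℝ, 0 < γ → γ ≤ 1 →
          BundleFoliation.UniformC1Holder γ F → BundleFoliation.UniformC1Holder γ G →
          (∃ ζ : ℝ, 0 < ζ ∧ ζ ≤ γ ∧
            BundleFoliation.UniformC1Holder ζ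
              (fun (i : Σ m, X m × Y m) (x : X i.1) => f i.1 i.2 x)) ∧
          (BundleFoliation.UniformLipschitz H →
            BundleFoliation.TangentUniformLocallyHolder f)) ∧
        -- `C^1` and uniformly `C^{1,s}` foliations under the bunching conditions
        (∀ (p : ℝ≥0∞) [Fact (1 ≤ p)] (μ : M → ℝ≥0), BddAbove (Set.range μ) →
          BundleFoliation.LipschitzBound p H μ →
          BundleFoliation.UniformC1Holder 1 F → BundleFoliation.UniformC1Holder 1 G →
          BundleFoliation.SupLtOne (fun m => (μ m : ℝ) * ls m * lu m * ϑ m) →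
          BundleFoliation.IsC1Foliation f ∧
          (BundleFoliation.UniformC1Holder 1 H →
            (BundleFoliation.SupLtOne (fun m => (ls m : ℝ)) ∨
              (BundleFoliation.SupLtOne (fun m => (ls m : ℝ) ^ 2 * lu m * ϑ m) ∧
                BundleFoliation.SupLtOne
                  (fun m => (μ m : ℝ) * (ls m : ℝ) ^ 2 * lu m * ϑ m))) →
            ∃ s : ℝ, 0 < s ∧ s ≤ 1 ∧
              BundleFoliation.IsUniformLocallyC1HolderFoliation s f))) := by
  refine ⟨fun X Y _ _ _ _ H F G α lu β β' ls ϑ h => h.exists_foliation,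
    fun X Y _ _ _ _ _ _ H F G α lu β β' ls ϑ f h hf => ⟨h.contDiff_leaves hf,
      fun γ hγ hγ1 hF hG => h.uniformC1Holder_leaves hf hγ hγ1 hF hG,
      fun p _ μ hμ hH hF hG hsup => ?_⟩⟩
  obtain ⟨h1, h2⟩ := h.isC1Foliation hf hμ hH hF hG hsup
  exact ⟨h1, fun hH1 _ => h2 hH1⟩
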